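/- Let $c\in\mathbb N$. There is a deterministic word RAM algorithm that, given $n\ge 1$, an integer $t$ with $1\le t\le n^2$, and $n\times n$ integer matrices $A,B,C$ all of whose entries have absolute value at most $n^c$, always halts with one of the two outputs "$C=AB$" or "$C\neq AB$", such that the output is correct whenever $C$ and $AB$ differ in at most $t$ entries. Its running time is $O\big((n^2+tn)\log^{2+o(1)} n\big)$; that is, there are a constant $K$ and a function $\varepsilon:\mathbb N\to\mathbb R$ with $\varepsilon(n)\to 0$ as $n\to\infty$, both depending only on $c$, such that for all $n\ge 2$ and all such $t,A,B,C$ it halts after at most $K\,(n^2+tn)\,(\log n)^{2+\varepsilon(n)}$ steps. Here the word RAM has words of $w$ bits, where $w\ge\kappa(\lfloor\log_2 n\rfloor+1)$ for a constant $\kappa$ depending only on $c$ (in particular $w=\Theta(\log n)$ is enough); arithmetic, bitwise and comparison operations on words and memory accesses take unit time; each matrix entry occupies one word of the input; and one program serves all $n$, $t$ and $w$. -/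

import Mathlib

open Filter Topology

/-! The word RAM with word size `w`: `2 ^ w` memory cells, each holding a `w`-bit word,
registers holding `w`-bit words, and unit-cost instructions. A program is a fixed finite object
that does not depend on the input or on the word size. Control flow is structured (sequencing,
branching, loops); such a program is a special case of a jump program, with the same number of
steps up to a constant factor. -/

namespace WordRAM

/-- A configuration: contents of the registers (a program mentions only finitely many of them)
and of the memory, whose cells are addressed by words. -/
@[ext] structure State (w : ℕ) where
  reg : ℕ → BitVec w
  mem : BitVec w → BitVec w

/-- The binary word operations. -/
inductive BinOp where
  | add | sub | mul | div | mod | and | or | xor | shl | shr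

/-- Arithmetic is unsigned and modulo `2 ^ w` (for `add`, `sub`, `mul` this is also two's
complement arithmetic); `div` and `mod` are quotient and remainder of unsigned words, with
`x div 0 = 0` and `x mod 0 = x`; `shl`, `shr` are logical shifts. -/
def BinOp.eval {w : ℕ} : BinOp → BitVec w → BitVec w → BitVec w
  | add, x, y => x + y
  | sub, x, y => x - y
  | mul, x, y => x * y
  | div, x, y => x / y
  | mod, x, y => x % y
  | and, x, y => x &&& y
  | or, x, y => x ||| y
  | xor, x, y => x ^^^ y
  | shl, x, y => x <<< y
  | shr, x, y => x >>> y

/-- The elementary instructions (the arguments other than the literal `k` are register names). -/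
inductive Instr where
  /-- `r := k` (a literal of the program) -/
  | const (r k : ℕ)
  /-- `r := s` -/
  | move (r s : ℕ)
  /-- `r := s op u` -/
  | op (o : BinOp) (r s u : ℕ)
  /-- `r := mem[s]` -/
  | load (r s : ℕ)
  /-- `mem[r] := s` -/
  | store (r s : ℕ)

/-- The effect of one elementary instruction. -/
def Instr.apply {w : ℕ} (σ : State w) : Instr → State w
  | const r k => { σ with reg := Function.update σ.reg r (BitVec.ofNat w k) }
  | move r s => { σ with reg := Function.update σ.reg r (σ.reg s) }
  | op o r s u => { σ with reg := Function.update σ.reg r (o.eval (σ.reg s) (σ.reg u)) }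
  | load r s => { σ with reg := Function.update σ.reg r (σ.mem (σ.reg s)) }
  | store r s => { σ with mem := Function.update σ.mem (σ.reg r) (σ.reg s) }

/-- Tests: comparison of two registers as unsigned words. -/
inductive Cond where
  | eq (r s : ℕ)
  | lt (r s : ℕ)

/-- Truth of a test in a state. -/
def Cond.Holds {w : ℕ} (σ : State w) : Cond → Prop
  | eq r s => σ.reg r = σ.reg s
  | lt r s => (σ.reg r).toNat < (σ.reg s).toNat

/-- Programs. -/
inductive Program where
  | skip
  | instr (i : Instr)
  | seq (P Q : Program)
  | ite (b : Cond) (P Q : Program)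
  | loop (b : Cond) (P : Program)

/-- `Exec P σ σ' k`: started in the state `σ`, the program `P` halts in the state `σ'` after
exactly `k` steps. Every elementary instruction and every evaluation of a test is one step;
`loop b P` runs `P` as long as `b` holds. -/
inductive Exec {w : ℕ} : Program → State w → State w → ℕ → Prop where
  | skip (σ : State w) : Exec .skip σ σ 1
  | instr (i : Instr) (σ : State w) : Exec (.instr i) σ (i.apply σ) 1
  | seq {P Q : Program} {σ σ₁ σ₂ : State w} {k l : ℕ} :
      Exec P σ σ₁ k → Exec Q σ₁ σ₂ l → Exec (.seq P Q) σ σ₂ (k + l)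
  | iteTrue {b : Cond} {P Q : Program} {σ σ₁ : State w} {k : ℕ} :
      b.Holds σ → Exec P σ σ₁ k → Exec (.ite b P Q) σ σ₁ (k + 1)
  | iteFalse {b : Cond} {P Q : Program} {σ σ₁ : State w} {k : ℕ} :
      ¬ b.Holds σ → Exec Q σ σ₁ k → Exec (.ite b P Q) σ σ₁ (k + 1)
  | loopTrue {b : Cond} {P : Program} {σ σ₁ σ₂ : State w} {k l : ℕ} :
      b.Holds σ → Exec P σ σ₁ k → Exec (.loop b P) σ₁ σ₂ l → Exec (.loop b P) σ σ₂ (k + l + 1)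
  | loopFalse {b : Cond} {P : Program} {σ : State w} :
      ¬ b.Holds σ → Exec (.loop b P) σ σ 1

/-- The model is deterministic: final state and number of steps are determined by the program and
the initial state. -/
theorem Exec.deterministic {w : ℕ} {P : Program} {σ σ₁ : State w} {k : ℕ} (h : Exec P σ σ₁ k) :
    ∀ {σ₂ : State w} {l : ℕ}, Exec P σ σ₂ l → σ₁ = σ₂ ∧ k = l := by
  induction h with
  | skip σ => intro _ _ h'; cases h'; exact ⟨rfl, rfl⟩
  | instr i σ => intro _ _ h'; cases h'; exact ⟨rfl, rfl⟩
  | seq _ _ ih₁ ih₂ =>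
    intro _ _ h'
    cases h' with
    | seq h₁ h₂ =>
      obtain ⟨rfl, rfl⟩ := ih₁ h₁
      obtain ⟨rfl, rfl⟩ := ih₂ h₂
      exact ⟨rfl, rfl⟩
  | iteTrue hb _ ih =>
    intro _ _ h'
    cases h' with
    | iteTrue _ h₁ => obtain ⟨rfl, rfl⟩ := ih h₁; exact ⟨rfl, rfl⟩
    | iteFalse hb' _ => exact absurd hb hb'
  | iteFalse hb _ ih =>
    intro _ _ h'
    cases h' with
    | iteTrue hb' _ => exact absurd hb' hb
    | iteFalse _ h₁ => obtain ⟨rfl, rfl⟩ := ih h₁; exact ⟨rfl, rfl⟩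
  | loopTrue hb _ _ ih₁ ih₂ =>
    intro _ _ h'
    cases h' with
    | loopTrue _ h₁ h₂ =>
      obtain ⟨rfl, rfl⟩ := ih₁ h₁
      obtain ⟨rfl, rfl⟩ := ih₂ h₂
      exact ⟨rfl, rfl⟩
    | loopFalse hb' => exact absurd hb hb'
  | loopFalse hb =>
    intro _ _ h'
    cases h' with
    | loopTrue hb' _ _ => exact absurd hb' hb
    | loopFalse _ => exact ⟨rfl, rfl⟩

end WordRAM

namespace MMVerification

/-- The entries of an `n × n` matrix in row-major order: the entry in row `i`, column `j`
(counted from `0`) has position `i * n + j`. Positions from `n * n` on are filled with `0`. -/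
def rowMajor {n : ℕ} (M : Matrix (Fin n) (Fin n) ℤ) (k : ℕ) : ℤ :=
  if h : k < n * n then M (Fin.divNat ⟨k, h⟩) (Fin.modNat ⟨k, h⟩) else 0

/-- The initial state on the input `(n, t, A, B, C)`: `n` and `t` are in the registers `0` and `1`;
the entries of `A`, `B`, `C` are stored in this order, row by row, in two's complement, one entry
per cell, in the memory cells from `0` on; everything else is `0`. -/
def input (w : ℕ) {n : ℕ} (t : ℕ) (A B C : Matrix (Fin n) (Fin n) ℤ) : WordRAM.State w where
  reg r := if r = 0 then BitVec.ofNat w n else if r = 1 then BitVec.ofNat w t else 0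
  mem a := BitVec.ofInt w <|
    if a.toNat < n * n then rowMajor A a.toNat
    else if a.toNat < 2 * (n * n) then rowMajor B (a.toNat - n * n)
    else rowMajor C (a.toNat - 2 * (n * n))

/-- The number of entries in which `C` and `A * B` differ. -/
def errorCount {n : ℕ} (A B C : Matrix (Fin n) (Fin n) ℤ) : ℕ :=
  (Finset.univ.filter fun p : Fin n × Fin n => C p.1 p.2 ≠ (A * B) p.1 p.2).card

/-- All entries of `M` have absolute value at most `n ^ c`. -/
def EntriesBounded (c : ℕ) {n : ℕ} (M : Matrix (Fin n) (Fin n) ℤ) : Prop :=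
  ∀ i j, |M i j| ≤ (n : ℤ) ^ c

end MMVerification

/-! Put `D = A * B - C`, which is the product of `[A | -C]` with `[B; 1]` through `2 * n` inner
indices (`sum_workVec`). The test computes mixed factorial moments of `D`, that is, the sums of `D i
j` times the falling factorials of `i` of order `s` and of `j` of order `u`, without ever forming
`D`.

Why few moments suffice: a vector supported on `r` indices is determined by its first `r` factorial
moments, because these control the sums against all polynomials of degree below `r`
(`eq_zero_of_moments_eq_zero`). Suppose `D ≠ 0` has `a` nonzero rows and let `b` be the smallest
support size of such a row; then `a * b ≤ t`. Some moment of order `u < b` of the sparsest row is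
nonzero, so the vector of the `u`-th moments of all rows is nonzero and supported on at most `a`
indices, and it has a nonzero moment of order `s < a`. Hence only orders with `(s + 1) * (u + 1) ≤
t` need checking (`eq_zero_of_mixed_moments_eq_zero`). By the harmonic sum there are `O(t log n)`
such pairs.

All of this happens modulo `p ^ g`, with `p` a prime in `(n, 2n]` and `g = 2c + 2`. Differences of
distinct indices and `(n - 1)!` are units there, and the entries of `D` are too small to be nonzero
multiples of the modulus (`eq_mul_of_checkValue`).

The moments of `D` are inner products of moments of the `2n` columns of `[A | -C]` with moments of
the `2n` rows of `[B; 1]`. Up to the unit `(n - 1)!`, all moments of one vector form a correlation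
with the fixed kernel `(n - 1)! / i!` (`momentTransform_eq`), hence one FFT convolution of length `2
^ k ≤ 4n`. The `4n` convolutions cost `O(n ^ 2 log n)` and the inner products `O(t n log n)`, so a
single logarithm is enough and the exponent correction in the theorem can be taken to be `0`.

The convolutions are exact integer convolutions, recovered by rounding a complex FFT in fixed-point
arithmetic. With `N = 2 ^ k` and residues at most `X = N ^ g`, crude error bounds that are monomials
in `N` and `X` show that `O(g log N)` bits suffice (`Budget`, `convCode_spec`). The roots of unity
are themselves computed with integer square roots and the half-angle formulas (`RootApprox.half`).
The inverse transform undoes the forward stages one by one, so no bit reversal is needed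
(`backward_mul_forward`).

To obtain a statement about the word RAM, the algorithm is written in a small language over the
integers whose step counts are those of its compiled code (`Run.compile`); its programs are analysed
with total-correctness triples that carry time bounds. -/

set_option linter.constructorNameAsVariable false

/-! ### A small imperative language over the integers and its compilation to the word RAM

Scalars and array cells hold integers, represented on the RAM in two's complement. Sums,
differences and products need no overflow conditions, since `BitVec.ofInt` is a ring homomorphism;
divisions, comparisons and array accesses require their arguments to be in range. -/

namespace ArrayLang

open WordRAM

/-- Scalar variables. -/
inductive Var where
  | n | t | nn | p | q | len | hlen | lg | scale | off | shift | half | total | vecs | cols | iters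
  | i | j | u | v | l | m | st | x | y | z | a | b | c | d | e | res | bound
  deriving DecidableEq

/-- Arrays. -/
inductive Arr where
  | input | vec | fact | ker | twRe | twIm | sigRe | sigIm | kerRe | kerIm
  deriving DecidableEq

/-- Arithmetic operations. -/
inductive Op where
  | add | sub | mul | div | mod

def Op.val : Op → ℤ → ℤ → ℤ
  | add, x, y => x + y
  | sub, x, y => x - y
  | mul, x, y => x * y
  | div, x, y => x / y
  | mod, x, y => x % y

/-- Range conditions: only `div` and `mod` have any. -/
def Op.ok (W : ℕ) : Op → ℤ → ℤ → Prop
  | div, x, y | mod, x, y => (0 ≤ x ∧ x < W) ∧ 0 < y ∧ y < W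
  | _, _, _ => True

def Op.toBinOp : Op → BinOp
  | add => .add
  | sub => .sub
  | mul => .mul
  | div => .div
  | mod => .mod

inductive Expr where
  | const (k : ℕ)
  | var (x : Var)
  | op (o : Op) (e f : Expr)
  | get (a : Arr) (e : Expr)

instance : Coe Var Expr := ⟨Expr.var⟩
instance (k : ℕ) : OfNat Expr k := ⟨Expr.const k⟩
instance : Add Expr := ⟨Expr.op .add⟩
instance : Sub Expr := ⟨Expr.op .sub⟩
instance : Mul Expr := ⟨Expr.op .mul⟩
instance : Div Expr := ⟨Expr.op .div⟩
instance : Mod Expr := ⟨Expr.op .mod⟩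

/-- States of the language. -/
@[ext] structure St where
  var : Var → ℤ
  arr : Arr → ℤ → ℤ

def St.set (σ : St) (x : Var) (v : ℤ) : St := { σ with var := Function.update σ.var x v }

def St.put (σ : St) (a : Arr) (k v : ℤ) : St :=
  { σ with arr := Function.update σ.arr a (Function.update (σ.arr a) k v) }

@[simp] theorem St.set_var (σ : St) (x y : Var) (v : ℤ) :
    (σ.set x v).var y = if y = x then v else σ.var y := by
  simp [St.set, Function.update_apply]

@[simp] theorem St.set_arr (σ : St) (x : Var) (v : ℤ) : (σ.set x v).arr = σ.arr := rfl

@[simp] theorem St.put_var (σ : St) (a : Arr) (k v : ℤ) : (σ.put a k v).var = σ.var := rfl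

@[simp] theorem St.put_arr (σ : St) (a b : Arr) (k l v : ℤ) :
    (σ.put a k v).arr b l = if b = a ∧ l = k then v else σ.arr b l := by
  by_cases h : b = a
  · subst h; simp [St.put, Function.update_apply]
  · simp [St.put, h]

def Expr.val (σ : St) : Expr → ℤ
  | const k => k
  | var x => σ.var x
  | op o e f => o.val (e.val σ) (f.val σ)
  | get a e => σ.arr a (e.val σ)

def Expr.ok (W : ℕ) (sz : Arr → ℕ) (σ : St) : Expr → Prop
  | const _ => True
  | var _ => True
  | op o e f => e.ok W sz σ ∧ f.ok W sz σ ∧ o.ok W (e.val σ) (f.val σ)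
  | get a e => e.ok W sz σ ∧ 0 ≤ e.val σ ∧ e.val σ < sz a

/-- Number of RAM steps of the compiled expression. -/
def Expr.cost : Expr → ℕ
  | const _ => 1
  | var _ => 1
  | op _ e f => e.cost + f.cost + 1
  | get _ e => e.cost + 2

inductive Test where
  | eq (e f : Expr)
  | lt (e f : Expr)

def Test.lhs : Test → Expr
  | eq e _ => e
  | lt e _ => e

def Test.rhs : Test → Expr
  | eq _ f => f
  | lt _ f => f

def Test.Holds (σ : St) : Test → Prop
  | eq e f => e.val σ = f.val σ
  | lt e f => e.val σ < f.val σ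

/-- RAM comparisons are unsigned, so they agree with comparisons of integers only when both sides
lie in `[0, W)`. -/
def Test.ok (W : ℕ) (sz : Arr → ℕ) (σ : St) (b : Test) : Prop :=
  b.lhs.ok W sz σ ∧ b.rhs.ok W sz σ ∧
    (0 ≤ b.lhs.val σ ∧ b.lhs.val σ < W) ∧ (0 ≤ b.rhs.val σ ∧ b.rhs.val σ < W)

inductive Stmt where
  | skip
  | assign (x : Var) (e : Expr)
  | put (a : Arr) (e f : Expr)
  | seq (S T : Stmt)
  | ite (b : Test) (S T : Stmt)
  /-- run `S` while `x < y` -/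
  | loop (x y : Var) (S : Stmt)

/-- The last index counts the steps of the compiled code, not source-level operations. Range
violations have no rule, so a derivation certifies that no overflow or bad access affects the
result. -/
inductive Run (W : ℕ) (sz : Arr → ℕ) : Stmt → St → St → ℕ → Prop where
  | skip (σ : St) : Run W sz .skip σ σ 1
  | assign {x : Var} {e : Expr} {σ : St} : e.ok W sz σ →
      Run W sz (.assign x e) σ (σ.set x (e.val σ)) (e.cost + 1)
  | put {a : Arr} {e f : Expr} {σ : St} : e.ok W sz σ → f.ok W sz σ →
      0 ≤ e.val σ → e.val σ < sz a →
      Run W sz (.put a e f) σ (σ.put a (e.val σ) (f.val σ)) (e.cost + f.cost + 2)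
  | seq {S T : Stmt} {σ σ₁ σ₂ : St} {k l : ℕ} :
      Run W sz S σ σ₁ k → Run W sz T σ₁ σ₂ l → Run W sz (.seq S T) σ σ₂ (k + l)
  | iteTrue {b : Test} {S T : Stmt} {σ σ₁ : St} {k : ℕ} : b.ok W sz σ →
      b.Holds σ → Run W sz S σ σ₁ k → Run W sz (.ite b S T) σ σ₁ (b.lhs.cost + b.rhs.cost + (k + 1))
  | iteFalse {b : Test} {S T : Stmt} {σ σ₁ : St} {k : ℕ} : b.ok W sz σ →
      ¬ b.Holds σ → Run W sz T σ σ₁ k →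
      Run W sz (.ite b S T) σ σ₁ (b.lhs.cost + b.rhs.cost + (k + 1))
  | loopTrue {x y : Var} {S : Stmt} {σ σ₁ σ₂ : St} {k l : ℕ} :
      0 ≤ σ.var x → σ.var x < σ.var y → σ.var y < W →
      Run W sz S σ σ₁ k → Run W sz (.loop x y S) σ₁ σ₂ l →
      Run W sz (.loop x y S) σ σ₂ (k + l + 1)
  | loopFalse {x y : Var} {S : Stmt} {σ : St} :
      0 ≤ σ.var y → σ.var y ≤ σ.var x → σ.var x < W → Run W sz (.loop x y S) σ σ 1

/-! #### Compilation -/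

/-- Variables, array bases and temporaries occupy the three residue classes modulo 3. In particular
`n` stays in register `0`, where the input puts it, and the base of `input` is register `1`, which
initially holds `t`. -/
def Var.reg (x : Var) : ℕ := 3 * x.ctorIdx

def Arr.reg (a : Arr) : ℕ := 3 * a.ctorIdx + 1

def tmp (d : ℕ) : ℕ := 3 * d + 2

theorem Var.reg_inj {x y : Var} : x.reg = y.reg ↔ x = y := by
  refine ⟨fun h => ?_, fun h => h ▸ rfl⟩
  have h' : x.ctorIdx = y.ctorIdx := by simpa [Var.reg] using h
  have := congrArg Var.ofNat h'
  rwa [Var.ofNat_ctorIdx, Var.ofNat_ctorIdx] at this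

@[simp] theorem Var.reg_ne_tmp (x : Var) (d : ℕ) : x.reg ≠ tmp d := by
  simp only [Var.reg, tmp]; omega

@[simp] theorem Arr.reg_ne_tmp (a : Arr) (d : ℕ) : a.reg ≠ tmp d := by
  simp only [Arr.reg, tmp]; omega

@[simp] theorem Arr.reg_ne_var (a : Arr) (x : Var) : a.reg ≠ x.reg := by
  simp only [Arr.reg, Var.reg]; omega

/-- Code that leaves the value of the expression in the temporary register `tmp d`, using only
temporary registers from there on. -/
def Expr.compile : Expr → ℕ → Program
  | const k, d => .instr (.const (tmp d) k)
  | var x, d => .instr (.move (tmp d) x.reg)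
  | op o e f, d => .seq (.seq (e.compile d) (f.compile (d + 1)))
      (.instr (.op o.toBinOp (tmp d) (tmp d) (tmp (d + 1))))
  | get a e, d => .seq (e.compile d)
      (.seq (.instr (.op .add (tmp d) a.reg (tmp d))) (.instr (.load (tmp d) (tmp d))))

def Test.cond : Test → Cond
  | eq _ _ => .eq (tmp 0) (tmp 1)
  | lt _ _ => .lt (tmp 0) (tmp 1)

def Stmt.compile : Stmt → Program
  | skip => .skip
  | assign x e => .seq (e.compile 0) (.instr (.move x.reg (tmp 0)))
  | put a e f => .seq (.seq (e.compile 0) (f.compile 1))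
      (.seq (.instr (.op .add (tmp 0) a.reg (tmp 0))) (.instr (.store (tmp 0) (tmp 1))))
  | seq S T => .seq S.compile T.compile
  | ite b S T => .seq (.seq (b.lhs.compile 0) (b.rhs.compile 1)) (.ite b.cond S.compile T.compile)
  | loop x y S => .loop (.lt x.reg y.reg) S.compile

/-- The placement of the arrays in memory. -/
structure Layout (w : ℕ) where
  base : Arr → ℕ
  size : Arr → ℕ
  le : ∀ a, base a + size a ≤ 2 ^ w
  disjoint : ∀ a b i j, i < size a → j < size b → base a + i = base b + j → a = b

/-- The RAM state `τ` represents the state `σ`. -/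
structure Repr {w : ℕ} (L : Layout w) (σ : St) (τ : State w) : Prop where
  var : ∀ x : Var, τ.reg x.reg = BitVec.ofInt w (σ.var x)
  base : ∀ a : Arr, τ.reg a.reg = BitVec.ofNat w (L.base a)
  mem : ∀ (a : Arr) (i : ℕ), i < L.size a →
    τ.mem (BitVec.ofNat w (L.base a + i)) = BitVec.ofInt w (σ.arr a i)

/-- Temporaries carry no information between statements. -/
theorem Repr.congr {w : ℕ} {L : Layout w} {σ : St} {τ τ' : State w} (h : Repr L σ τ)
    (hr : ∀ r, (∀ d, r ≠ tmp d) → τ'.reg r = τ.reg r) (hm : τ'.mem = τ.mem) : Repr L σ τ' :=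
  ⟨fun x => by rw [hr _ (by simp), h.var], fun a => by rw [hr _ (by simp), h.base],
    fun a i hi => by rw [hm, h.mem a i hi]⟩

theorem toNat_ofInt_of_range {w : ℕ} {x : ℤ} (h0 : 0 ≤ x) (h1 : x < (2 ^ w : ℕ)) :
    ((BitVec.ofInt w x).toNat : ℤ) = x := by
  lift x to ℕ using h0
  rw [BitVec.ofInt_natCast, BitVec.toNat_ofNat, Nat.mod_eq_of_lt (by exact_mod_cast h1)]

theorem ofInt_toNat {w : ℕ} (x : BitVec w) : BitVec.ofInt w (x.toNat : ℤ) = x := by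
  rw [BitVec.ofInt_natCast]; simp

theorem Op.eval_ofInt {w : ℕ} (o : Op) {x y : ℤ} (h : o.ok (2 ^ w) x y) :
    o.toBinOp.eval (BitVec.ofInt w x) (BitVec.ofInt w y) = BitVec.ofInt w (o.val x y) := by
  cases o with
  | add => simp [Op.toBinOp, BinOp.eval, Op.val, BitVec.ofInt_add]
  | sub => simp [Op.toBinOp, BinOp.eval, Op.val, sub_eq_add_neg, BitVec.ofInt_add,
      BitVec.ofInt_neg]
  | mul => simp [Op.toBinOp, BinOp.eval, Op.val, BitVec.ofInt_mul]
  | div =>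
    obtain ⟨⟨hx, hx'⟩, hy, hy'⟩ := h
    rw [← ofInt_toNat (BinOp.eval _ _ _)]
    congr 1
    simp only [Op.toBinOp, BinOp.eval, BitVec.toNat_udiv, Op.val]
    push_cast
    rw [toNat_ofInt_of_range hx hx', toNat_ofInt_of_range hy.le hy']
  | mod =>
    obtain ⟨⟨hx, hx'⟩, hy, hy'⟩ := h
    rw [← ofInt_toNat (BinOp.eval _ _ _)]
    congr 1
    simp only [Op.toBinOp, BinOp.eval, BitVec.toNat_umod, Op.val]
    push_cast
    rw [toNat_ofInt_of_range hx hx', toNat_ofInt_of_range hy.le hy']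

theorem ofNat_add_ofInt {w : ℕ} (b : ℕ) {x : ℤ} (hx : 0 ≤ x) :
    BitVec.ofNat w b + BitVec.ofInt w x = BitVec.ofNat w (b + x.toNat) := by
  lift x to ℕ using hx
  rw [BitVec.ofInt_natCast, BitVec.ofNat_add]; rfl

/-- The preservation of all registers other than temporaries from `d` on is what the induction
needs: the value of a left operand waits in `tmp d` while the right operand is evaluated from `tmp
(d + 1)` on. -/
theorem Expr.compile_spec {w : ℕ} {L : Layout w} {σ : St} (e : Expr) :
    ∀ (d : ℕ) (τ : State w), Repr L σ τ → e.ok (2 ^ w) L.size σ →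
      ∃ τ', Exec (e.compile d) τ τ' e.cost ∧ τ'.mem = τ.mem ∧
        τ'.reg (tmp d) = BitVec.ofInt w (e.val σ) ∧
        ∀ r, (∀ d', d ≤ d' → r ≠ tmp d') → τ'.reg r = τ.reg r := by
  induction e with
  | const k =>
    intro d τ _ _
    refine ⟨_, .instr _ _, rfl, ?_, fun r hr => ?_⟩
    · simp [Instr.apply, Expr.val]
    · simp [Instr.apply, Function.update_of_ne (hr d le_rfl)]
  | var x =>
    intro d τ h _
    refine ⟨_, .instr _ _, rfl, ?_, fun r hr => ?_⟩
    · simp [Instr.apply, Expr.val, h.var]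
    · simp [Instr.apply, Function.update_of_ne (hr d le_rfl)]
  | op o e f ihe ihf =>
    intro d τ h ⟨hoe, hof, ho⟩
    obtain ⟨τ₁, hx₁, hm₁, hv₁, hr₁⟩ := ihe d τ h hoe
    obtain ⟨τ₂, hx₂, hm₂, hv₂, hr₂⟩ := ihf (d + 1) τ₁
      (h.congr (fun r hr => hr₁ r fun d' _ => hr d') hm₁) hof
    refine ⟨_, .seq (.seq hx₁ hx₂) (.instr _ _), ?_, ?_, fun r hr => ?_⟩
    · simp [Instr.apply, hm₁, hm₂]
    · have : τ₂.reg (tmp d) = BitVec.ofInt w (e.val σ) := by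
        rw [hr₂ _ fun d' hd => by simp only [tmp]; omega, hv₁]
      simp [Instr.apply, this, hv₂, Op.eval_ofInt o ho, Expr.val]
    · simp only [Instr.apply]
      rw [Function.update_of_ne (hr d le_rfl), hr₂ r fun d' hd => hr d' (by omega), hr₁ r hr]
  | get a e ih =>
    intro d τ h ⟨hoe, h0, hs⟩
    obtain ⟨τ₁, hx₁, hm₁, hv₁, hr₁⟩ := ih d τ h hoe
    refine ⟨_, .seq hx₁ (.seq (.instr _ _) (.instr _ _)), ?_, ?_, fun r hr => ?_⟩
    · simp [Instr.apply, hm₁]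
    · have h1 : τ₁.reg a.reg = BitVec.ofNat w (L.base a) := by
        rw [hr₁ _ (by simp), h.base]
      have h2 := h.mem a (e.val σ).toNat (by omega)
      simp only [Instr.apply, Function.update_self, BinOp.eval, h1, hv₁, hm₁, Expr.val]
      rw [ofNat_add_ofInt _ h0, h2, Int.toNat_of_nonneg h0]
    · simp only [Instr.apply]
      rw [Function.update_of_ne (hr d le_rfl), Function.update_of_ne (hr d le_rfl), hr₁ r hr]

theorem Repr.set {w : ℕ} {L : Layout w} {σ : St} {τ : State w} (h : Repr L σ τ) (x : Var) {v : ℤ}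
    {b : BitVec w} (hb : b = BitVec.ofInt w v) :
    Repr L (σ.set x v) { τ with reg := Function.update τ.reg x.reg b } := by
  refine ⟨fun y => ?_, fun a => ?_, fun a i hi => h.mem a i hi⟩
  · by_cases hy : y = x
    · subst hy; simp [hb]
    · simp [hy, h.var, Function.update_of_ne (mt Var.reg_inj.1 hy)]
  · simp [h.base]

/-- Addresses below `2 ^ w` do not wrap around and the arrays are disjoint, so a store changes
exactly one cell of one array. -/
theorem Repr.put {w : ℕ} {L : Layout w} {σ : St} {τ : State w} (h : Repr L σ τ) (a : Arr) {k v : ℤ}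
    {b c : BitVec w} (hk : 0 ≤ k) (hs : k < L.size a) (hb : b = BitVec.ofNat w (L.base a + k.toNat))
    (hc : c = BitVec.ofInt w v) :
    Repr L (σ.put a k v) { τ with mem := Function.update τ.mem b c } := by
  refine ⟨h.var, h.base, fun a' i hi => ?_⟩
  have e : BitVec.ofNat w (L.base a' + i) = b ↔ a' = a ∧ (i : ℤ) = k := by
    have h1 := L.le a'
    have h2 := L.le a
    rw [hb]
    constructor
    · intro h
      have := congrArg BitVec.toNat h
      rw [BitVec.toNat_ofNat, BitVec.toNat_ofNat, Nat.mod_eq_of_lt (by omega),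
        Nat.mod_eq_of_lt (by omega)] at this
      have e := L.disjoint a' a i k.toNat hi (by omega) this
      subst e
      exact ⟨rfl, by omega⟩
    · rintro ⟨rfl, rfl⟩
      simp
  simp only [Function.update_apply, e, St.put_arr]
  split_ifs
  · exact hc
  · exact h.mem a' i hi

theorem Test.cond_holds {w : ℕ} {σ : St} {τ : State w} {sz : Arr → ℕ} (b : Test)
    (hok : b.ok (2 ^ w) sz σ) (h0 : τ.reg (tmp 0) = BitVec.ofInt w (b.lhs.val σ))
    (h1 : τ.reg (tmp 1) = BitVec.ofInt w (b.rhs.val σ)) : b.cond.Holds τ ↔ b.Holds σ := by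
  obtain ⟨-, -, ⟨hl, hl'⟩, hr, hr'⟩ := hok
  have e1 := toNat_ofInt_of_range (w := w) hl hl'
  have e2 := toNat_ofInt_of_range (w := w) hr hr'
  cases b with
  | eq e f =>
    simp only [Test.cond, Cond.Holds, Test.Holds, h0, h1]
    constructor
    · intro h; rw [h] at e1; exact e1.symm.trans e2
    · intro h; simp only [Test.lhs, Test.rhs]; rw [h]
  | lt e f =>
    simp only [Test.cond, Cond.Holds, Test.Holds, h0, h1]
    simp only [Test.lhs, Test.rhs] at e1 e2 ⊢
    omega

/-- The compiler is correct, and the RAM takes the number of steps predicted by `Run`. -/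
theorem Run.compile {w : ℕ} {L : Layout w} {S : Stmt} {σ σ' : St} {k : ℕ}
    (h : Run (2 ^ w) L.size S σ σ' k) :
    ∀ {τ : State w}, Repr L σ τ → ∃ τ', Exec S.compile τ τ' k ∧ Repr L σ' τ' := by
  induction h with
  | skip σ => exact fun {τ} hR => ⟨τ, .skip τ, hR⟩
  | @assign x e σ hok =>
    intro τ hR
    obtain ⟨τ₁, hx, hm, hv, hr⟩ := e.compile_spec 0 τ hR hok
    exact ⟨_, .seq hx (.instr _ _),
      (hR.congr (fun r h => hr r fun d _ => h d) hm).set x hv⟩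
  | @put a e f σ hoe hof h0 hs =>
    intro τ hR
    obtain ⟨τ₁, hx₁, hm₁, hv₁, hr₁⟩ := e.compile_spec 0 τ hR hoe
    have hR₁ : Repr L σ τ₁ := hR.congr (fun r h => hr₁ r fun d _ => h d) hm₁
    obtain ⟨τ₂, hx₂, hm₂, hv₂, hr₂⟩ := f.compile_spec 1 τ₁ hR₁ hof
    have hR₂ : Repr L σ τ₂ := hR₁.congr (fun r h => hr₂ r fun d _ => h d) hm₂
    have ht : τ₂.reg (tmp 0) = BitVec.ofInt w (e.val σ) := by
      rw [hr₂ _ fun d' hd => by simp only [tmp]; omega, hv₁]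
    refine ⟨_, .seq (.seq hx₁ hx₂) (.seq (.instr _ _) (.instr _ _)), ?_⟩
    refine (hR₂.put a h0 hs (b := BitVec.ofNat w (L.base a) + BitVec.ofInt w (e.val σ))
      (ofNat_add_ofInt _ h0) hv₂).congr (fun r hr => ?_) ?_
    · simp [Instr.apply, Function.update_of_ne (hr 0)]
    · simp only [Instr.apply, BinOp.eval, Function.update_self, hR₂.base, ht]
      rw [Function.update_of_ne (by simp [tmp])]
  | seq _ _ ih₁ ih₂ =>
    intro τ hR
    obtain ⟨τ₁, hx₁, hR₁⟩ := ih₁ hR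
    obtain ⟨τ₂, hx₂, hR₂⟩ := ih₂ hR₁
    exact ⟨τ₂, .seq hx₁ hx₂, hR₂⟩
  | @iteTrue b S T σ σ₁ k hok hb _ ih =>
    intro τ hR
    obtain ⟨τ₁, hx₁, hm₁, hv₁, hr₁⟩ := b.lhs.compile_spec 0 τ hR hok.1
    have hR₁ : Repr L σ τ₁ := hR.congr (fun r h => hr₁ r fun d _ => h d) hm₁
    obtain ⟨τ₂, hx₂, hm₂, hv₂, hr₂⟩ := b.rhs.compile_spec 1 τ₁ hR₁ hok.2.1
    have hR₂ : Repr L σ τ₂ := hR₁.congr (fun r h => hr₂ r fun d _ => h d) hm₂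
    have ht : τ₂.reg (tmp 0) = BitVec.ofInt w (b.lhs.val σ) := by
      rw [hr₂ _ fun d' hd => by simp only [tmp]; omega, hv₁]
    obtain ⟨τ₃, hx₃, hR₃⟩ := ih hR₂
    exact ⟨τ₃, .seq (.seq hx₁ hx₂) (.iteTrue ((b.cond_holds hok ht hv₂).2 hb) hx₃), hR₃⟩
  | @iteFalse b S T σ σ₁ k hok hb _ ih =>
    intro τ hR
    obtain ⟨τ₁, hx₁, hm₁, hv₁, hr₁⟩ := b.lhs.compile_spec 0 τ hR hok.1
    have hR₁ : Repr L σ τ₁ := hR.congr (fun r h => hr₁ r fun d _ => h d) hm₁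
    obtain ⟨τ₂, hx₂, hm₂, hv₂, hr₂⟩ := b.rhs.compile_spec 1 τ₁ hR₁ hok.2.1
    have hR₂ : Repr L σ τ₂ := hR₁.congr (fun r h => hr₂ r fun d _ => h d) hm₂
    have ht : τ₂.reg (tmp 0) = BitVec.ofInt w (b.lhs.val σ) := by
      rw [hr₂ _ fun d' hd => by simp only [tmp]; omega, hv₁]
    obtain ⟨τ₃, hx₃, hR₃⟩ := ih hR₂
    exact ⟨τ₃, .seq (.seq hx₁ hx₂) (.iteFalse (mt (b.cond_holds hok ht hv₂).1 hb) hx₃), hR₃⟩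
  | @loopTrue x y S σ σ₁ σ₂ k l hx hlt hy _ _ ih₁ ih₂ =>
    intro τ hR
    obtain ⟨τ₁, hx₁, hR₁⟩ := ih₁ hR
    obtain ⟨τ₂, hx₂, hR₂⟩ := ih₂ hR₁
    refine ⟨τ₂, .loopTrue ?_ hx₁ hx₂, hR₂⟩
    have e1 := toNat_ofInt_of_range (w := w) hx (hlt.trans hy)
    have e2 := toNat_ofInt_of_range (w := w) (hx.trans hlt.le) hy
    simp only [Cond.Holds, hR.var]
    omega
  | @loopFalse x y S σ hy hle hx =>
    intro τ hR
    refine ⟨τ, .loopFalse ?_, hR⟩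
    have e1 := toNat_ofInt_of_range (w := w) (hy.trans hle) hx
    have e2 := toNat_ofInt_of_range (w := w) hy (hle.trans_lt hx)
    simp only [Cond.Holds, hR.var]
    omega

end ArrayLang

/-! ### Total correctness with time bounds -/

namespace ArrayLang

infixr:60 " ;; " => Stmt.seq

/-- Whether the statement assigns to the variable. -/
def Stmt.writes : Stmt → Var → Bool
  | skip, _ => false
  | assign x _, z => decide (x = z)
  | put _ _ _, _ => false
  | seq S T, z => S.writes z || T.writes z
  | ite _ S T, z => S.writes z || T.writes z
  | loop _ _ S, z => S.writes z

/-- Whether the statement writes into the array. -/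
def Stmt.stores : Stmt → Arr → Bool
  | skip, _ => false
  | assign _ _, _ => false
  | put a _ _, b => decide (a = b)
  | seq S T, b => S.stores b || T.stores b
  | ite _ S T, b => S.stores b || T.stores b
  | loop _ _ S, b => S.stores b

/-- `σ'` differs from `σ` only where `S` may write. -/
structure Frame (S : Stmt) (σ σ' : St) : Prop where
  var : ∀ z, S.writes z = false → σ'.var z = σ.var z
  arr : ∀ a, S.stores a = false → σ'.arr a = σ.arr a

/-- The write sets are Boolean functions of the syntax, so every frame condition needed later is
closed by `rfl` or `decide`. -/
theorem Run.frame {W : ℕ} {sz : Arr → ℕ} {S : Stmt} {σ σ' : St} {k : ℕ}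
    (h : Run W sz S σ σ' k) : Frame S σ σ' := by
  induction h with
  | skip => exact ⟨fun _ _ => rfl, fun _ _ => rfl⟩
  | assign =>
    refine ⟨fun z hz => ?_, fun _ _ => rfl⟩
    have : z ≠ _ := fun h => (of_decide_eq_false hz) h.symm
    simp [this]
  | @put a e f σ =>
    refine ⟨fun _ _ => rfl, fun b hb => ?_⟩
    have : b ≠ a := fun h => (of_decide_eq_false hb) h.symm
    funext k
    simp [this]
  | seq _ _ ih₁ ih₂ =>
    refine ⟨fun z hz => ?_, fun z hz => ?_⟩ <;>
    simp only [Stmt.writes, Stmt.stores, Bool.or_eq_false_iff] at hz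
    · rw [ih₂.var z hz.2, ih₁.var z hz.1]
    · rw [ih₂.arr z hz.2, ih₁.arr z hz.1]
  | iteTrue _ _ _ ih =>
    refine ⟨fun z hz => ?_, fun z hz => ?_⟩ <;>
    simp only [Stmt.writes, Stmt.stores, Bool.or_eq_false_iff] at hz
    · exact ih.var z hz.1
    · exact ih.arr z hz.1
  | iteFalse _ _ _ ih =>
    refine ⟨fun z hz => ?_, fun z hz => ?_⟩ <;>
    simp only [Stmt.writes, Stmt.stores, Bool.or_eq_false_iff] at hz
    · exact ih.var z hz.2
    · exact ih.arr z hz.2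
  | loopTrue _ _ _ _ _ ih₁ ih₂ =>
    exact ⟨fun z hz => (ih₂.var z hz).trans (ih₁.var z hz),
      fun z hz => (ih₂.arr z hz).trans (ih₁.arr z hz)⟩
  | loopFalse => exact ⟨fun _ _ => rfl, fun _ _ => rfl⟩

/-- Started in `σ`, the statement halts within `t` steps in a state satisfying `Q`. -/
def Triple (W : ℕ) (sz : Arr → ℕ) (S : Stmt) (σ : St) (t : ℕ) (Q : St → Prop) : Prop :=
  ∃ σ' k, Run W sz S σ σ' k ∧ k ≤ t ∧ Q σ'

variable {W : ℕ} {sz : Arr → ℕ}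

theorem Triple.mono {S : Stmt} {σ : St} {t t' : ℕ} {Q Q' : St → Prop}
    (h : Triple W sz S σ t Q) (ht : t ≤ t') (hQ : ∀ σ', Q σ' → Frame S σ σ' → Q' σ') :
    Triple W sz S σ t' Q' := by
  obtain ⟨σ', k, hr, hk, hq⟩ := h
  exact ⟨σ', k, hr, hk.trans ht, hQ _ hq hr.frame⟩

theorem Triple.seq {S T : Stmt} {σ : St} {t₁ t₂ : ℕ} {P Q : St → Prop}
    (h₁ : Triple W sz S σ t₁ P)
    (h₂ : ∀ σ₁, P σ₁ → Frame S σ σ₁ → Triple W sz T σ₁ t₂ Q) :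
    Triple W sz (S ;; T) σ (t₁ + t₂) Q := by
  obtain ⟨σ₁, k, hr, hk, hp⟩ := h₁
  obtain ⟨σ₂, l, hr', hl, hq⟩ := h₂ σ₁ hp hr.frame
  exact ⟨σ₂, k + l, .seq hr hr', by omega, hq⟩

/-- Weakest preconditions of loop-free statements. -/
def Stmt.wp (W : ℕ) (sz : Arr → ℕ) : Stmt → (St → Prop) → St → Prop
  | skip, Q, σ => Q σ
  | assign x e, Q, σ => e.ok W sz σ ∧ Q (σ.set x (e.val σ))
  | put a e f, Q, σ => e.ok W sz σ ∧ f.ok W sz σ ∧ (0 ≤ e.val σ ∧ e.val σ < sz a) ∧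
      Q (σ.put a (e.val σ) (f.val σ))
  | seq S T, Q, σ => S.wp W sz (T.wp W sz Q) σ
  | ite b S T, Q, σ => b.ok W sz σ ∧ (b.Holds σ → S.wp W sz Q σ) ∧ (¬ b.Holds σ → T.wp W sz Q σ)
  | loop _ _ _, _, _ => False

/-- Worst-case running time of loop-free statements. -/
def Stmt.time : Stmt → ℕ
  | skip => 1
  | assign _ e => e.cost + 1
  | put _ e f => e.cost + f.cost + 2
  | seq S T => S.time + T.time
  | ite b S T => b.lhs.cost + b.rhs.cost + max S.time T.time + 1
  | loop _ _ _ => 0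

theorem Stmt.wp_sound {S : Stmt} :
    ∀ {Q : St → Prop} {σ : St}, S.wp W sz Q σ → Triple W sz S σ S.time Q := by
  induction S with
  | skip => exact fun h => ⟨_, _, .skip _, le_rfl, h⟩
  | assign x e => exact fun h => ⟨_, _, .assign h.1, le_rfl, h.2⟩
  | put a e f => exact fun h => ⟨_, _, .put h.1 h.2.1 h.2.2.1.1 h.2.2.1.2, le_rfl, h.2.2.2⟩
  | seq S T ihS ihT => exact fun h => (ihS h).seq fun σ₁ h₁ _ => ihT h₁
  | ite b S T ihS ihT =>
    intro Q σ ⟨hok, hS, hT⟩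
    by_cases hb : b.Holds σ
    · obtain ⟨σ', k, hr, hk, hq⟩ := ihS (hS hb)
      exact ⟨σ', _, .iteTrue hok hb hr, by simp only [Stmt.time]; omega, hq⟩
    · obtain ⟨σ', k, hr, hk, hq⟩ := ihT (hT hb)
      exact ⟨σ', _, .iteFalse hok hb hr, by simp only [Stmt.time]; omega, hq⟩
  | loop => exact fun h => h.elim

theorem Triple.of_wp {S : Stmt} {Q : St → Prop} {σ : St} {t : ℕ} (h : S.wp W sz Q σ)
    (ht : S.time ≤ t := by decide) : Triple W sz S σ t Q :=
  (Stmt.wp_sound h).mono ht fun _ h _ => h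

/-- `for x = 0, …, y - 1 do S`. -/
def Stmt.forTo (x y : Var) (S : Stmt) : Stmt :=
  .assign x 0 ;; .loop x y (S ;; .assign x (.var x + 1))

/-- The rule for `for` loops, with a time bound for each iteration. -/
theorem Triple.forTo' {x y : Var} {S : Stmt} {σ : St} {m t : ℕ} {tb : ℕ → ℕ} {Q : St → Prop}
    (Inv : ℕ → St → Prop) (hm : σ.var y = m) (hW : m < W)
    (hx : S.writes x = false) (hy : S.writes y = false) (hxy : x ≠ y)
    (h0 : Inv 0 (σ.set x 0))
    (step : ∀ i < m, ∀ σ₁, Inv i σ₁ → σ₁.var x = i →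
      (∀ z, S.writes z = false → z ≠ x → σ₁.var z = σ.var z) →
      (∀ a, S.stores a = false → σ₁.arr a = σ.arr a) →
      Triple W sz S σ₁ (tb i) fun σ₂ => Inv (i + 1) (σ₂.set x (i + 1 : ℕ)))
    (ht : ∑ i ∈ Finset.range m, (tb i + 5) + 3 ≤ t)
    (hQ : ∀ σ₁, Inv m σ₁ → σ₁.var x = m →
      (∀ z, S.writes z = false → z ≠ x → σ₁.var z = σ.var z) →
      (∀ a, S.stores a = false → σ₁.arr a = σ.arr a) → Q σ₁) :
    Triple W sz (.forTo x y S) σ t Q := by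
  -- Induction on the number `j` of remaining iterations. The time bound is stated additively, the
  -- cost of the finished iterations being added on the left, to avoid subtraction.
  have key : ∀ j ≤ m, ∀ σ₁, Inv (m - j) σ₁ → σ₁.var x = (m - j : ℕ) →
      (∀ z, S.writes z = false → z ≠ x → σ₁.var z = σ.var z) →
      (∀ a, S.stores a = false → σ₁.arr a = σ.arr a) →
      ∃ σ₂ k, Run W sz (.loop x y (S ;; .assign x (.var x + 1))) σ₁ σ₂ k ∧
        k + ∑ i ∈ Finset.range (m - j), (tb i + 5) ≤ ∑ i ∈ Finset.range m, (tb i + 5) + 1 ∧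
        Q σ₂ := by
    intro j
    induction j with
    | zero =>
      intro _ σ₁ hI hv hfv hfa
      rw [Nat.sub_zero] at hI hv
      refine ⟨σ₁, 1, .loopFalse ?_ ?_ ?_, ?_, hQ σ₁ hI hv hfv hfa⟩
      · rw [hfv y hy hxy.symm, hm]; positivity
      · rw [hfv y hy hxy.symm, hm, hv]
      · rw [hv]; exact_mod_cast hW
      · simp only [Nat.sub_zero]; omega
    | succ j ih =>
      intro hj σ₁ hI hv hfv hfa
      have hlt : m - (j + 1) < m := by omega
      have hs : m - (j + 1) + 1 = m - j := by omega
      obtain ⟨σ₂, k, hr, hk, hI₂⟩ := step _ hlt σ₁ hI hv hfv hfa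
      have hf := hr.frame
      rw [hs] at hI₂
      have hx₂ : σ₂.var x = (m - (j + 1) : ℕ) := by rw [hf.var x hx, hv]
      have hadd : (Expr.var x + 1 : Expr).val σ₂ = (m - j : ℕ) := by
        change σ₂.var x + ((1 : ℕ) : ℤ) = _
        rw [hx₂]; omega
      obtain ⟨σ₃, l, hr₃, hl, hq⟩ := ih (by omega) (σ₂.set x (m - j : ℕ)) hI₂ (by simp)
        (fun z hz hzx => by simp [hzx, hf.var z hz, hfv z hz hzx])
        (fun a ha => by simp [hf.arr a ha, hfa a ha])
      -- These 4 steps and one test make up the overhead 5 per iteration; the final 3 consists of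
      -- the initialisation (2) and the last test (1).
      have ha : Run W sz (.assign x (.var x + 1)) σ₂ (σ₂.set x (m - j : ℕ)) 4 := by
        have := Run.assign (W := W) (sz := sz) (x := x) (e := .op .add (.var x) (.const 1))
          (σ := σ₂) ⟨trivial, trivial, trivial⟩
        exact hadd ▸ this
      refine ⟨σ₃, k + 4 + l + 1, .loopTrue ?_ ?_ ?_ (.seq hr ha) hr₃, ?_, hq⟩
      · rw [hv]; positivity
      · rw [hv, hfv y hy hxy.symm, hm]; exact_mod_cast hlt
      · rw [hfv y hy hxy.symm, hm]; exact_mod_cast hW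
      · have := Finset.sum_range_succ (fun i => tb i + 5) (m - (j + 1))
        rw [hs] at this
        omega
  obtain ⟨σ₂, k, hr, hk, hq⟩ := key m le_rfl (σ.set x 0) (by simpa using h0) (by simp)
    (fun z _ hz => by simp [hz]) (fun _ _ => rfl)
  refine ⟨σ₂, 2 + k, .seq (Run.assign (e := 0) trivial) hr, ?_, hq⟩
  simp only [Nat.sub_self, Finset.range_zero, Finset.sum_empty] at hk
  omega

/-- The rule for `for` loops, with a uniform time bound. -/
theorem Triple.forTo {x y : Var} {S : Stmt} {σ : St} {m t tb : ℕ} {Q : St → Prop}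
    (Inv : ℕ → St → Prop) (hm : σ.var y = m) (hW : m < W)
    (hx : S.writes x = false) (hy : S.writes y = false) (hxy : x ≠ y)
    (h0 : Inv 0 (σ.set x 0))
    (step : ∀ i < m, ∀ σ₁, Inv i σ₁ → σ₁.var x = i →
      (∀ z, S.writes z = false → z ≠ x → σ₁.var z = σ.var z) →
      (∀ a, S.stores a = false → σ₁.arr a = σ.arr a) →
      Triple W sz S σ₁ tb fun σ₂ => Inv (i + 1) (σ₂.set x (i + 1 : ℕ)))
    (ht : m * (tb + 5) + 3 ≤ t)
    (hQ : ∀ σ₁, Inv m σ₁ → σ₁.var x = m →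
      (∀ z, S.writes z = false → z ≠ x → σ₁.var z = σ.var z) →
      (∀ a, S.stores a = false → σ₁.arr a = σ.arr a) → Q σ₁) :
    Triple W sz (.forTo x y S) σ t Q :=
  Triple.forTo' Inv hm hW hx hy hxy h0 step (by simpa using ht) hQ

/-- The power `x ^ k` as an iterated product. -/
def Expr.pow (x : Var) : ℕ → Expr
  | 0 => 1
  | k + 1 => .op .mul (Expr.pow x k) x

theorem Expr.pow_val (x : Var) (k : ℕ) (σ : St) : (Expr.pow x k).val σ = σ.var x ^ k := by
  induction k with
  | zero => simp [Expr.pow]; rfl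
  | succ k ih => rw [pow_succ, ← ih]; rfl

theorem Expr.pow_ok (x : Var) (k : ℕ) (σ : St) : (Expr.pow x k).ok W sz σ := by
  induction k with
  | zero => trivial
  | succ k ih => exact ⟨ih, trivial, trivial⟩

section Simp

variable (σ : St) (e f : Expr)

@[simp] theorem Expr.val_add : (e + f).val σ = e.val σ + f.val σ := rfl
@[simp] theorem Expr.val_sub : (e - f).val σ = e.val σ - f.val σ := rfl
@[simp] theorem Expr.val_mul : (e * f).val σ = e.val σ * f.val σ := rfl
@[simp] theorem Expr.val_div : (e / f).val σ = e.val σ / f.val σ := rfl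
@[simp] theorem Expr.val_mod : (e % f).val σ = e.val σ % f.val σ := rfl
@[simp] theorem Expr.val_var (x : Var) : (Expr.var x).val σ = σ.var x := rfl
@[simp] theorem Expr.val_get (a : Arr) : (Expr.get a e).val σ = σ.arr a (e.val σ) := rfl
@[simp] theorem Expr.val_zero : (0 : Expr).val σ = 0 := rfl
@[simp] theorem Expr.val_one : (1 : Expr).val σ = 1 := rfl
@[simp] theorem Expr.val_two : (2 : Expr).val σ = 2 := rfl
@[simp] theorem Expr.val_three : (3 : Expr).val σ = 3 := rfl
@[simp] theorem Expr.val_four : (4 : Expr).val σ = 4 := rfl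
@[simp] theorem Expr.ok_add : (e + f).ok W sz σ ↔ e.ok W sz σ ∧ f.ok W sz σ := by
  change _ ∧ _ ∧ True ↔ _; simp
@[simp] theorem Expr.ok_sub : (e - f).ok W sz σ ↔ e.ok W sz σ ∧ f.ok W sz σ := by
  change _ ∧ _ ∧ True ↔ _; simp
@[simp] theorem Expr.ok_mul : (e * f).ok W sz σ ↔ e.ok W sz σ ∧ f.ok W sz σ := by
  change _ ∧ _ ∧ True ↔ _; simp
@[simp] theorem Expr.ok_div : (e / f).ok W sz σ ↔ e.ok W sz σ ∧ f.ok W sz σ ∧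
    (0 ≤ e.val σ ∧ e.val σ < W) ∧ 0 < f.val σ ∧ f.val σ < W := Iff.rfl
@[simp] theorem Expr.ok_mod : (e % f).ok W sz σ ↔ e.ok W sz σ ∧ f.ok W sz σ ∧
    (0 ≤ e.val σ ∧ e.val σ < W) ∧ 0 < f.val σ ∧ f.val σ < W := Iff.rfl
@[simp] theorem Expr.ok_var (x : Var) : (Expr.var x).ok W sz σ := trivial
@[simp] theorem Expr.ok_get (a : Arr) : (Expr.get a e).ok W sz σ ↔
    e.ok W sz σ ∧ 0 ≤ e.val σ ∧ e.val σ < sz a := Iff.rfl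
@[simp] theorem Expr.ok_zero : (0 : Expr).ok W sz σ := trivial
@[simp] theorem Expr.ok_one : (1 : Expr).ok W sz σ := trivial
@[simp] theorem Expr.ok_two : (2 : Expr).ok W sz σ := trivial
@[simp] theorem Expr.ok_three : (3 : Expr).ok W sz σ := trivial
@[simp] theorem Expr.ok_four : (4 : Expr).ok W sz σ := trivial
@[simp] theorem Test.holds_lt : (Test.lt e f).Holds σ ↔ e.val σ < f.val σ := Iff.rfl
@[simp] theorem Test.holds_eq : (Test.eq e f).Holds σ ↔ e.val σ = f.val σ := Iff.rfl
@[simp] theorem Test.ok_lt : (Test.lt e f).ok W sz σ ↔ e.ok W sz σ ∧ f.ok W sz σ ∧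
    (0 ≤ e.val σ ∧ e.val σ < W) ∧ 0 ≤ f.val σ ∧ f.val σ < W := Iff.rfl
@[simp] theorem Test.ok_eq : (Test.eq e f).ok W sz σ ↔ e.ok W sz σ ∧ f.ok W sz σ ∧
    (0 ≤ e.val σ ∧ e.val σ < W) ∧ 0 ≤ f.val σ ∧ f.val σ < W := Iff.rfl

variable (Q : St → Prop) (S T : Stmt) (b : Test)

@[simp] theorem Stmt.wp_assign (x : Var) :
    (Stmt.assign x e).wp W sz Q σ ↔ e.ok W sz σ ∧ Q (σ.set x (e.val σ)) := Iff.rfl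
@[simp] theorem Stmt.wp_put (a : Arr) : (Stmt.put a e f).wp W sz Q σ ↔
    e.ok W sz σ ∧ f.ok W sz σ ∧ (0 ≤ e.val σ ∧ e.val σ < sz a) ∧
      Q (σ.put a (e.val σ) (f.val σ)) := Iff.rfl
@[simp] theorem Stmt.wp_seq : (S ;; T).wp W sz Q σ ↔ S.wp W sz (T.wp W sz Q) σ := Iff.rfl
@[simp] theorem Stmt.wp_skip : Stmt.skip.wp W sz Q σ ↔ Q σ := Iff.rfl
@[simp] theorem Stmt.wp_ite : (Stmt.ite b S T).wp W sz Q σ ↔ b.ok W sz σ ∧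
    (b.Holds σ → S.wp W sz Q σ) ∧ (¬ b.Holds σ → T.wp W sz Q σ) := Iff.rfl

end Simp

end ArrayLang

/-! ### Detecting sparse matrices by products of factorial moments -/

namespace MMVerification

open Finset Polynomial

/-- A vector supported on `S`, whose elements have invertible differences, is determined by its
first `#S` factorial moments. -/
theorem eq_zero_of_moments_eq_zero {R : Type*} [CommRing R] {S : Finset ℕ} {v : ℕ → R}
    (hS : ∀ i ∈ S, ∀ j ∈ S, i ≠ j → IsUnit ((i : R) - j))
    (h : ∀ u < #S, ∑ i ∈ S, v i * (i.descFactorial u : R) = 0) : ∀ i ∈ S, v i = 0 := by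
  nontriviality R
  -- The falling factorials are monic of each degree, so subtracting leading terms reduces any
  -- polynomial of degree below `#S` to the assumed moments, over any commutative ring.
  have key : ∀ d : ℕ, ∀ f : R[X], f.natDegree < d → d ≤ #S → ∑ i ∈ S, v i * f.eval (i : R) = 0 := by
    intro d
    induction d with
    | zero => intro f hf; omega
    | succ d ih =>
      intro f hf hd
      set g := f - C (f.coeff d) * descPochhammer R d with hg
      have hmon : (descPochhammer R d).Monic := by
        rw [← descPochhammer_map (Int.castRingHom R)]
        exact (monic_descPochhammer ℤ d).map _
      have hdeg : (descPochhammer R d).natDegree = d := by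
        rw [← descPochhammer_map (Int.castRingHom R), (monic_descPochhammer ℤ d).natDegree_map,
          descPochhammer_natDegree]
      have hge : ∀ x : ℕ, f.eval (x : R) = g.eval (x : R) + f.coeff d * (x.descFactorial d : R) := by
        intro x
        rw [hg, eval_sub, eval_mul, eval_C, descPochhammer_eval_eq_descFactorial]; ring
      have hz : ∑ i ∈ S, v i * g.eval (i : R) = 0 := by
        -- `natDegree` cannot drop below `0`, so constants are treated separately.
        rcases Nat.eq_zero_or_pos d with rfl | hpos
        · have : g = 0 := by
            rw [hg, eq_C_of_natDegree_le_zero (p := f) (by omega)]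
            simp
          simp [this]
        · refine ih g ?_ (by omega)
          refine lt_of_le_of_ne ?_ ?_ |>.trans_le le_rfl
          · refine (natDegree_sub_le _ _).trans (max_le (by omega) ?_)
            exact (natDegree_C_mul_le _ _).trans hdeg.le
          · intro hgd
            have : g.coeff d = 0 := by
              rw [hg, coeff_sub, coeff_C_mul]
              have : (descPochhammer R d).coeff d = 1 := by
                conv_lhs => rw [← hdeg]
                rw [hdeg]; nth_rewrite 2 [← hdeg]; exact hmon
              rw [this]; ring
            have h0 : g ≠ 0 := by rintro h; rw [h] at hgd; simp at hgd; omega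
            rw [← hgd] at this
            exact h0 (leadingCoeff_eq_zero.1 this)
      simp_rw [hge, mul_add, sum_add_distrib, hz, zero_add]
      have := h d (by omega)
      calc ∑ i ∈ S, v i * (f.coeff d * (i.descFactorial d : R))
          = f.coeff d * ∑ i ∈ S, v i * (i.descFactorial d : R) := by
            rw [mul_sum]; exact sum_congr rfl fun _ _ => by ring
        _ = 0 := by rw [this, mul_zero]
  intro i hi
  -- An unnormalised Lagrange polynomial isolates `v i`, with a product of differences, hence a
  -- unit, as its factor.
  have hz := key #S (∏ j ∈ S.erase i, (X - C (j : R))) (by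
    have := natDegree_prod_le (S.erase i) fun j => (X - C (j : R))
    simp only [natDegree_X_sub_C, sum_const, smul_eq_mul, mul_one] at this
    rw [card_erase_of_mem hi] at this
    have : 0 < #S := card_pos.2 ⟨i, hi⟩
    omega) le_rfl
  rw [sum_eq_single_of_mem i hi fun j hj hji => by
    rw [eval_prod, prod_eq_zero (mem_erase.2 ⟨hji, hj⟩) (by simp), mul_zero]] at hz
  have hu : IsUnit (∏ j ∈ S.erase i, ((i : R) - j)) := by
    rw [IsUnit.prod_iff]
    exact fun j hj => hS i hi j (mem_of_mem_erase hj) (ne_of_mem_erase hj).symm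
  rw [eval_prod] at hz
  simp only [eval_sub, eval_X, eval_C] at hz
  exact (hu.mul_left_eq_zero).1 hz

/-- A matrix with at most `t` nonzero entries vanishes if the mixed moments of orders `s`, `u`
with `(s + 1) * (u + 1) ≤ t` vanish. -/
theorem eq_zero_of_mixed_moments_eq_zero {R : Type*} [CommRing R] [DecidableEq R] {n t : ℕ}
    {D : ℕ → ℕ → R} (hn : ∀ i < n, ∀ j < n, i ≠ j → IsUnit ((i : R) - j))
    (hD : #{x ∈ range n ×ˢ range n | D x.1 x.2 ≠ 0} ≤ t)
    (h : ∀ s < n, ∀ u < n, (s + 1) * (u + 1) ≤ t →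
      ∑ i ∈ range n, ∑ j ∈ range n, D i j * (i.descFactorial s * j.descFactorial u : R) = 0) :
    ∀ i < n, ∀ j < n, D i j = 0 := by
  by_contra! hne
  obtain ⟨i₀, hi₀, j₀, hj₀, h₀⟩ := hne
  let row (i : ℕ) : Finset ℕ := {j ∈ range n | D i j ≠ 0}
  let I : Finset ℕ := {i ∈ range n | (row i).Nonempty}
  have hi₀I : i₀ ∈ I := by
    simp only [I, row, mem_filter, mem_range, filter_nonempty_iff]
    exact ⟨hi₀, j₀, hj₀, h₀⟩
  -- Choosing the sparsest nonzero row makes the product of the number of nonzero rows and its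
  -- support size at most the number of nonzero entries.
  obtain ⟨i₁, hi₁, hmin⟩ := exists_min_image I (fun i => #(row i)) ⟨i₀, hi₀I⟩
  have hcard : #I * #(row i₁) ≤ t := by
    refine le_trans ?_ hD
    calc #I * #(row i₁) = ∑ i ∈ I, #(row i₁) := by simp
      _ ≤ ∑ i ∈ I, #(row i) := sum_le_sum hmin
      _ = #(I.sigma row) := (card_sigma _ _).symm
      _ ≤ _ := by
        refine card_le_card_of_injOn (fun x => (x.1, x.2)) ?_ ?_
        · rintro ⟨i, j⟩ hx
          simp only [coe_sigma, Set.mem_sigma_iff, mem_coe, I, row, mem_filter, mem_range] at hx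
          simp [hx.1.1, hx.2]
        · rintro ⟨i, j⟩ _ ⟨i', j'⟩ _ h
          simp only [Prod.mk.injEq] at h
          obtain ⟨rfl, rfl⟩ := h
          rfl
  have hi₁' := mem_filter.1 hi₁
  have hIn : ∀ i ∈ I, i < n := fun i hi => mem_range.1 (mem_filter.1 hi).1
  have hrn : ∀ i, ∀ j ∈ row i, j < n := fun i j hj => mem_range.1 (mem_filter.1 hj).1
  have hIc : #I ≤ n := (card_le_card (filter_subset _ _)).trans_eq (card_range n)
  have hrc : #(row i₁) ≤ n := (card_le_card (filter_subset _ _)).trans_eq (card_range n)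
  -- some moment of the row `i₁` does not vanish
  obtain ⟨u, hu, hu0⟩ : ∃ u < #(row i₁),
      ∑ j ∈ row i₁, D i₁ j * (j.descFactorial u : R) ≠ 0 := by
    by_contra! hall
    obtain ⟨j, hj⟩ := hi₁'.2
    exact (mem_filter.1 hj).2 (eq_zero_of_moments_eq_zero
      (fun i hi j hj => hn i (hrn _ i hi) j (hrn _ j hj)) hall j hj)
  -- The one-dimensional statement is applied a second time, now to the `u`-th moments of the rows:
  -- this vector lives on `I` and does not vanish at `i₁`.
  let w (i : ℕ) : R := ∑ j ∈ range n, D i j * (j.descFactorial u : R)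
  obtain ⟨s, hs, hs0⟩ : ∃ s < #I, ∑ i ∈ I, w i * (i.descFactorial s : R) ≠ 0 := by
    by_contra! hall
    refine hu0 ?_
    rw [← eq_zero_of_moments_eq_zero (fun i hi j hj => hn i (hIn i hi) j (hIn j hj)) hall i₁ hi₁]
    exact sum_filter_of_ne fun j _ hj h => hj (by rw [h, zero_mul])
  refine hs0 ?_
  rw [← h s (by omega) u (by omega) (le_trans (Nat.mul_le_mul hs hu) hcard)]
  rw [sum_subset (filter_subset _ _ : I ⊆ range n)]
  · refine sum_congr rfl fun i _ => ?_
    simp only [w]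
    rw [sum_mul]
    exact sum_congr rfl fun j _ => by ring
  · intro i hi hiI
    have : w i = 0 := by
      refine sum_eq_zero fun j hj => ?_
      have : D i j = 0 := by
        by_contra hne
        exact hiI (mem_filter.2 ⟨hi, j, mem_filter.2 ⟨hj, hne⟩⟩)
      rw [this, zero_mul]
    rw [this, zero_mul]

/-- The table entry `(n - 1)! / k!`. -/
def kernel (n k : ℕ) : ℕ := (n - 1).factorial / k.factorial

/-- The factorial moments, up to the common factor `(n - 1)!`, as a correlation. -/
def momentTransform {R : Type*} [CommRing R] (n : ℕ) (v : ℕ → R) (s : ℕ) : R :=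
  ∑ i ∈ range (n - s), v (s + i) * (s + i).factorial * kernel n i

/-- The falling factorial of `s + i` of order `s` is `(s + i)! / i!`. Multiplying by `(n - 1)!`
turns `1 / i!` into an integer and leaves a factor depending on `s + i` times one depending on `i`:
a correlation. -/
theorem momentTransform_eq {R : Type*} [CommRing R] {n s : ℕ} (v : ℕ → R) (hs : s ≤ n) :
    momentTransform n v s = (n - 1).factorial * ∑ i ∈ range n, v i * (i.descFactorial s : R) := by
  obtain ⟨m, rfl⟩ := Nat.exists_eq_add_of_le hs
  rw [momentTransform, sum_range_add, Nat.add_sub_cancel_left]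
  rw [sum_eq_zero (s := range s) (fun i hi => by
    rw [Nat.descFactorial_eq_zero_iff_lt.2 (mem_range.1 hi)]; simp), zero_add, mul_sum]
  refine sum_congr rfl fun i hi => ?_
  have hi := mem_range.1 hi
  have h1 : (s + i).factorial * kernel (s + m) i
      = (s + m - 1).factorial * (s + i).descFactorial s := by
    have h2 : kernel (s + m) i * i.factorial = (s + m - 1).factorial :=
      Nat.div_mul_cancel (Nat.factorial_dvd_factorial (by omega))
    have h3 := Nat.factorial_mul_descFactorial (n := s + i) (k := s) (by omega)
    rw [Nat.add_sub_cancel_left] at h3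
    rw [← h3, ← h2]; ring
  have := congrArg (Nat.cast : ℕ → R) h1
  push_cast at this
  rw [mul_assoc, this]; ring

end MMVerification

/-! ### Verification through moments modulo a prime power -/

namespace MMVerification

open Finset Polynomial

section Detect

variable {n : ℕ} (A B C : Matrix (Fin n) (Fin n) ℤ)

theorem rowMajor_apply (M : Matrix (Fin n) (Fin n) ℤ) {i j : ℕ} (hi : i < n) (hj : j < n) :
    rowMajor M (i * n + j) = M ⟨i, hi⟩ ⟨j, hj⟩ := by
  have h : i * n + j < n * n := by nlinarith
  rw [rowMajor, dif_pos h]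
  congr 1
  · ext
    simp only [Fin.divNat]
    rw [mul_comm, Nat.mul_add_div (by omega), Nat.div_eq_of_lt hj, add_zero]
  · ext
    simp only [Fin.modNat]
    rw [mul_comm, Nat.mul_add_mod, Nat.mod_eq_of_lt hj]

/-- The columns of `[A | -C]`, followed by the rows of `[B; 1]`. -/
def workVec (v i : ℕ) : ℤ :=
  if v < n then rowMajor A (i * n + v)
  else if v < 2 * n then -rowMajor C (i * n + (v - n))
  else if v < 3 * n then rowMajor B ((v - 2 * n) * n + i)
  else if v - 3 * n = i then 1 else 0

/-- The entries of `A * B - C`. -/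
def defect (i j : ℕ) : ℤ :=
  ∑ k ∈ range n, rowMajor A (i * n + k) * rowMajor B (k * n + j) - rowMajor C (i * n + j)

theorem defect_apply (i j : Fin n) : defect A B C i j = (A * B) i j - C i j := by
  rw [defect, rowMajor_apply C i.2 j.2, Matrix.mul_apply, ← Fin.sum_univ_eq_sum_range
    (fun k => rowMajor A (i * n + k) * rowMajor B (k * n + j))]
  congr 1
  exact sum_congr rfl fun k _ => by rw [rowMajor_apply A i.2 k.2, rowMajor_apply B k.2 j.2]

/-- The first `n` inner indices give `A * B`; the last `n` pair the columns of `-C` with unit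
vectors and give `-C`. -/
theorem sum_workVec {i j : ℕ} (hj : j < n) :
    ∑ k ∈ range (2 * n), workVec A B C k i * workVec A B C (2 * n + k) j = defect A B C i j := by
  rw [two_mul, sum_range_add, defect, sub_eq_add_neg]
  congr 1
  · refine sum_congr rfl fun k hk => ?_
    have hk := mem_range.1 hk
    simp only [workVec, if_pos hk]
    rw [if_neg (by omega), if_neg (by omega), if_pos (by omega)]
    rw [show n + n + k - 2 * n = k by omega]
  · rw [sum_eq_single_of_mem j (mem_range.2 hj)]
    · simp only [workVec]
      rw [if_neg (by omega), if_pos (by omega), if_neg (by omega), if_neg (by omega),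
        if_neg (by omega), if_pos (by omega), Nat.add_sub_cancel_left, mul_one]
    · intro k hk hkj
      have hk := mem_range.1 hk
      simp only [workVec]
      rw [if_neg (by omega : ¬ n + n + (n + k) < n), if_neg (by omega : ¬ n + n + (n + k) < 2 * n),
        if_neg (by omega : ¬ n + n + (n + k) < 3 * n), if_neg (by omega : ¬ _ = j), mul_zero]

/-- The value computed by the algorithm for the orders `s` and `u`. -/
def checkValue (R : Type*) [CommRing R] (s u : ℕ) : R :=
  ∑ k ∈ range (2 * n), momentTransform n (fun i => (workVec A B C k i : R)) s *
    momentTransform n (fun j => (workVec A B C (2 * n + k) j : R)) u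

/-- Moments are linear, so the mixed moment of a sum of rank-one matrices is the sum of the products
of the moments of their factors. The square of `(n - 1)!` comes from the two transforms. -/
theorem checkValue_eq (R : Type*) [CommRing R] {s u : ℕ} (hs : s ≤ n) (hu : u ≤ n) :
    checkValue A B C R s u = ((n - 1).factorial : R) ^ 2 *
      ∑ i ∈ range n, ∑ j ∈ range n, (defect A B C i j : R) *
        (i.descFactorial s * j.descFactorial u) := by
  have h : ∀ i ∈ range n, ∀ j ∈ range n, (defect A B C i j : R) *
        (i.descFactorial s * j.descFactorial u) = ∑ k ∈ range (2 * n),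
        ((workVec A B C k i : R) * i.descFactorial s) *
          ((workVec A B C (2 * n + k) j : R) * j.descFactorial u) := by
    intro i hi j hj
    rw [← sum_workVec A B C (mem_range.1 hj)]
    push_cast
    rw [sum_mul]
    exact sum_congr rfl fun k _ => by ring
  rw [checkValue, sum_congr rfl fun i hi => sum_congr rfl (h i hi)]
  simp_rw [momentTransform_eq _ hs, momentTransform_eq _ hu]
  rw [sum_congr rfl fun i _ => sum_comm, sum_comm, mul_sum]
  refine sum_congr rfl fun k _ => ?_
  rw [← sum_mul_sum]; ring

variable {A B C}

theorem checkValue_eq_zero (R : Type*) [CommRing R] {s u : ℕ} (hs : s ≤ n) (hu : u ≤ n)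
    (h : C = A * B) : checkValue A B C R s u = 0 := by
  rw [checkValue_eq A B C R hs hu, sum_eq_zero, mul_zero]
  intro i hi
  refine sum_eq_zero fun j hj => ?_
  have := defect_apply A B C ⟨i, mem_range.1 hi⟩ ⟨j, mem_range.1 hj⟩
  rw [h, sub_self] at this
  simp only at this
  rw [h, this]; simp

theorem isUnit_natCast_zmod {p g k : ℕ} (hp : p.Prime) (h0 : k ≠ 0) (hk : k < p) :
    IsUnit (k : ZMod (p ^ g)) := by
  rw [ZMod.isUnit_iff_coprime]
  exact Nat.Coprime.pow_right g
    ((hp.coprime_iff_not_dvd).2 fun h => h0 (Nat.eq_zero_of_dvd_of_lt h hk)).symm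

/-- If `C` and `A * B` differ in at most `t` entries, then the vanishing of the computed values
of orders `s`, `u` with `(s + 1) * (u + 1) ≤ t` implies `C = A * B`. -/
theorem eq_mul_of_checkValue {c p g t : ℕ} (hp : p.Prime) (hn : n < p) (hg : 2 * c + 2 ≤ g)
    (hA : EntriesBounded c A) (hB : EntriesBounded c B) (hC : EntriesBounded c C)
    (ht : errorCount A B C ≤ t)
    (h : ∀ s < n, ∀ u < n, (s + 1) * (u + 1) ≤ t → checkValue A B C (ZMod (p ^ g)) s u = 0) :
    C = A * B := by
  classical
  -- The common factor of the computed values can be cancelled because all prime factors of `(n -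
  -- 1)!` are below `p`.
  have hfac : IsUnit (((n - 1).factorial : ZMod (p ^ g)) ^ 2) := by
    refine IsUnit.pow 2 ?_
    rw [ZMod.isUnit_iff_coprime]
    exact Nat.Coprime.pow_right g (hp.coprime_factorial_of_lt (by omega)).symm
  have hz := eq_zero_of_mixed_moments_eq_zero (R := ZMod (p ^ g)) (n := n) (t := t)
    (D := fun i j => (defect A B C i j : ZMod (p ^ g))) ?_ ?_ ?_
  · ext i j
    have h1 := hz i i.2 j j.2
    rw [defect_apply, ZMod.intCast_zmod_eq_zero_iff_dvd] at h1
    have hi : 0 < n := i.pos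
    have hab : |(A * B) i j| ≤ n * ((n : ℤ) ^ c * (n : ℤ) ^ c) := by
      rw [Matrix.mul_apply]
      refine (abs_sum_le_sum_abs _ _).trans ((sum_le_sum fun k _ => ?_).trans_eq
        (b := ∑ k : Fin n, (n : ℤ) ^ c * (n : ℤ) ^ c) (by simp))
      rw [abs_mul]
      exact mul_le_mul (hA i k) (hB k j) (abs_nonneg _) (by positivity)
    have hlt : |(A * B) i j - C i j| < (p ^ g : ℕ) := by
      have h2 : |(A * B) i j - C i j| ≤ 2 * (n : ℤ) ^ (2 * c + 1) := by
        refine (abs_sub _ _).trans ?_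
        have h3 : (n : ℤ) ^ c ≤ (n : ℤ) ^ (2 * c + 1) :=
          pow_le_pow_right₀ (by exact_mod_cast hi) (by omega)
        have h4 : n * ((n : ℤ) ^ c * (n : ℤ) ^ c) = (n : ℤ) ^ (2 * c + 1) := by ring
        have := hC i j
        linarith
      -- Here `g ≥ 2c + 2` is used: one factor `p` absorbs the 2, the other `2c + 1` dominate the
      -- powers of `n`.
      have h5 : 2 * n ^ (2 * c + 1) < p ^ g := by
        calc 2 * n ^ (2 * c + 1) ≤ p * n ^ (2 * c + 1) := by
              exact Nat.mul_le_mul_right _ (by omega)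
          _ < p * p ^ (2 * c + 1) :=
              Nat.mul_lt_mul_of_pos_left (Nat.pow_lt_pow_left hn (by omega)) hp.pos
          _ = p ^ (2 * c + 2) := by ring
          _ ≤ p ^ g := Nat.pow_le_pow_right hp.pos hg
      refine h2.trans_lt ?_
      exact_mod_cast h5
    have := Int.eq_zero_of_abs_lt_dvd h1 hlt
    linarith
  · intro i hi j hj hij
    rcases lt_or_gt_of_ne hij with hlt | hlt
    · have := isUnit_natCast_zmod (g := g) hp (k := j - i) (by omega) (by omega)
      rw [Nat.cast_sub hlt.le] at this
      simpa using this.neg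
    · have := isUnit_natCast_zmod (g := g) hp (k := i - j) (by omega) (by omega)
      rwa [Nat.cast_sub hlt.le] at this
  · refine le_trans ?_ ht
    rw [errorCount]
    refine (card_le_card ?_).trans (card_image_le (f := fun x : Fin n × Fin n => (x.1.1, x.2.1)))
    rintro ⟨i, j⟩ hx
    simp only [mem_filter, mem_product, mem_range] at hx
    refine mem_image.2 ⟨(⟨i, hx.1.1⟩, ⟨j, hx.1.2⟩), mem_filter.2 ⟨mem_univ _, fun heq => hx.2 ?_⟩, rfl⟩
    have := defect_apply A B C ⟨i, hx.1.1⟩ ⟨j, hx.1.2⟩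
    simp only at this
    rw [this, heq, sub_self, Int.cast_zero]
  · intro s hs u hu hsu
    have := h s hs u hu hsu
    rw [checkValue_eq A B C _ hs.le hu.le] at this
    exact (hfac.mul_right_eq_zero).1 this

end Detect

end MMVerification

/-! ### The fast Fourier transform: exact identities -/

namespace FFT

open Finset

/-- One stage of the decimation-in-frequency transform: the blocks of length `2 * m` are split,
the twiddle factors are powers of `ω ^ r`. -/
def difStage (ω : ℂ) (r m : ℕ) (f : ℕ → ℂ) (x : ℕ) : ℂ :=
  if x % (2 * m) < m then f x + f (x + m) else (f (x - m) - f x) * ω ^ (x % m * r)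

/-- One stage of the inverse transform. -/
def ditStage (ω : ℂ) (r m : ℕ) (f : ℕ → ℂ) (x : ℕ) : ℂ :=
  if x % (2 * m) < m then f x + f (x + m) * ω ^ (x % m * r) else f (x - m) - f x * ω ^ (x % m * r)

/-- The first `l` stages of the forward transform of length `2 ^ k`. -/
def forward (ω : ℂ) (k : ℕ) (f : ℕ → ℂ) : ℕ → ℕ → ℂ
  | 0 => f
  | l + 1 => difStage ω (2 ^ l) (2 ^ (k - 1 - l)) (forward ω k f l)

/-- The first `l` stages of the inverse transform of length `2 ^ k`. -/
def backward (ω : ℂ) (k : ℕ) (f : ℕ → ℂ) : ℕ → ℕ → ℂ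
  | 0 => f
  | l + 1 => ditStage ω (2 ^ (k - 1 - l)) (2 ^ l) (backward ω k f l)

theorem mod_two_mul_of_lt {m x : ℕ} (h : x % (2 * m) < m) : x % m = x % (2 * m) := by
  rw [← Nat.mod_mul_left_mod x 2 m, Nat.mod_eq_of_lt h]

theorem mod_two_mul_of_ge {m x : ℕ} (hm : 0 < m) (h : m ≤ x % (2 * m)) :
    x % m = x % (2 * m) - m := by
  have := Nat.mod_lt x (by omega : 0 < 2 * m)
  rw [← Nat.mod_mul_left_mod x 2 m, Nat.mod_eq_sub_mod h, Nat.mod_eq_of_lt (by omega)]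

theorem add_half_mod {m x : ℕ} (h : x % (2 * m) < m) : (x + m) % (2 * m) = x % (2 * m) + m := by
  rw [Nat.add_mod, Nat.mod_eq_of_lt (by omega : m < 2 * m), Nat.mod_eq_of_lt (by omega)]

theorem le_of_ge_mod {m x : ℕ} (h : m ≤ x % (2 * m)) : m ≤ x := h.trans (Nat.mod_le _ _)

theorem sub_half_mod {m x : ℕ} (hm : 0 < m) (h : m ≤ x % (2 * m)) :
    (x - m) % (2 * m) = x % (2 * m) - m := by
  have h1 := Nat.mod_lt x (by omega : 0 < 2 * m)
  have h2 := Nat.div_add_mod x (2 * m)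
  have : x - m = 2 * m * (x / (2 * m)) + (x % (2 * m) - m) := by omega
  rw [this, Nat.mul_add_mod, Nat.mod_eq_of_lt (by omega)]

/-- On a pair `(a, b)` the forward butterfly gives `(a + b, (a - b) * w)`; multiplying the second
entry by `w⁻¹` and taking sum and difference gives `(2a, 2b)`. -/
theorem ditStage_difStage {ω ω' : ℂ} (h : ω * ω' = 1) {r m : ℕ} (hm : 0 < m) (f : ℕ → ℂ) (x : ℕ) :
    ditStage ω' r m (difStage ω r m f) x = 2 * f x := by
  have hp : ∀ e : ℕ, ω ^ e * ω' ^ e = 1 := fun e => by rw [← mul_pow, h, one_pow]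
  unfold ditStage difStage
  split_ifs with h1 h2 h2
  · rw [add_half_mod h1] at h2; omega
  · rw [Nat.add_sub_cancel, Nat.add_mod_right, mul_assoc, hp]; ring
  · rw [Nat.sub_add_cancel (le_of_ge_mod (not_lt.1 h1)), mul_assoc, hp]; ring
  · rw [sub_half_mod hm (not_lt.1 h1)] at h2
    have := Nat.mod_lt x (by omega : 0 < 2 * m)
    omega

theorem ditStage_smul (ω : ℂ) (r m : ℕ) (c : ℂ) (f : ℕ → ℂ) :
    ditStage ω r m (fun x => c * f x) = fun x => c * ditStage ω r m f x := by
  funext x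
  unfold ditStage
  split_ifs <;> ring

/-- Each inverse stage undoes the last forward stage not yet undone, so the scrambled order of the
spectrum never has to be repaired. -/
theorem backward_forward {ω ω' : ℂ} (h : ω * ω' = 1) {k : ℕ} (f : ℕ → ℂ) {j : ℕ} (hj : j ≤ k) :
    backward ω' k (forward ω k f k) j = fun x => 2 ^ j * forward ω k f (k - j) x := by
  induction j with
  | zero => simp [backward]
  | succ j ih =>
    rw [backward, ih (by omega), ditStage_smul]
    funext x
    have e : k - j = k - (j + 1) + 1 := by omega
    rw [e, forward, show k - 1 - (k - (j + 1)) = j by omega, show k - (j + 1) = k - 1 - j by omega,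
      ditStage_difStage h (by positivity)]
    ring

theorem sum_range_two_mul' {M : Type*} [AddCommMonoid M] (f : ℕ → M) (n : ℕ) :
    ∑ i ∈ range (2 * n), f i = ∑ i ∈ range n, (f (2 * i) + f (2 * i + 1)) := by
  induction n with
  | zero => simp
  | succ n ih => rw [mul_add, mul_one, sum_range_succ, sum_range_succ, ih, sum_range_succ, add_assoc]

/-- After `l` stages, each block holds the residue of the input polynomial modulo a factor of
`X ^ (2 ^ k) - 1`, up to a change of variables. -/
theorem forward_eq {ω : ℂ} {k : ℕ} (hω : ω ^ 2 ^ (k - 1) = -1) {l : ℕ} (hl : l ≤ k)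
    {b : ℕ} (hb : b < 2 ^ l) : ∃ e : ℕ, ∀ f : ℕ → ℂ, ∀ r < 2 ^ (k - l),
      forward ω k f l (b * 2 ^ (k - l) + r) =
        ∑ i ∈ range (2 ^ l), f (i * 2 ^ (k - l) + r) * ω ^ (e * (i * 2 ^ (k - l) + r)) := by
  induction l generalizing b with
  | zero =>
    obtain rfl : b = 0 := by simpa using hb
    exact ⟨0, fun f r hr => by simp [forward]⟩
  | succ l ih =>
    obtain ⟨e, he⟩ := ih (by omega) (b := b / 2) (by rw [pow_succ] at hb; omega)
    set m := 2 ^ (k - (l + 1)) with hm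
    have hmpos : 0 < m := by positivity
    have h2m : 2 ^ (k - l) = 2 * m := by
      rw [hm, show k - l = k - (l + 1) + 1 by omega, pow_succ, mul_comm]
    rw [h2m] at he
    have hN : 2 ^ l * m = 2 ^ (k - 1) := by rw [hm, ← pow_add]; congr 1; omega
    have hN2 : ω ^ (2 ^ l * (2 * m)) = 1 := by
      rw [show 2 ^ l * (2 * m) = 2 ^ (k - 1) * 2 by rw [← hN]; ring, pow_mul, hω]; norm_num
    have hst : 2 ^ (k - 1 - l) = m := by rw [hm]; congr 1; omega
    -- Block `c` of the previous stage splits into block `2 * c`, the sums, and block `2 * c + 1`,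
    -- the twisted differences.
    rcases Nat.even_or_odd' b with ⟨c, rfl | rfl⟩
    · rw [show 2 * c / 2 = c by omega] at he
      refine ⟨e, fun f r hr => ?_⟩
      rw [forward, hst, difStage]
      have hx : 2 * c * m + r = c * (2 * m) + r := by ring
      have hmod : (2 * c * m + r) % (2 * m) = r := by
        rw [hx, mul_comm c, Nat.mul_add_mod, Nat.mod_eq_of_lt (by omega)]
      rw [if_pos (by omega), hx, add_assoc, he f r (by omega), he f (r + m) (by omega), pow_succ,
        mul_comm (2 ^ l) 2, sum_range_two_mul', ← sum_add_distrib]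
      refine sum_congr rfl fun i _ => ?_
      rw [show 2 * i * m + r = i * (2 * m) + r by ring,
        show (2 * i + 1) * m + r = i * (2 * m) + (r + m) by ring]
    · rw [show (2 * c + 1) / 2 = c by omega] at he
      -- Raising the exponent by `2 ^ l` contributes the twiddle factor `ω ^ (r * 2 ^ l)` and, on
      -- the odd terms, the extra sign `ω ^ (2 ^ l * m) = -1` of the difference.
      refine ⟨e + 2 ^ l, fun f r hr => ?_⟩
      rw [forward, hst, difStage]
      have hx : (2 * c + 1) * m + r = c * (2 * m) + (r + m) := by ring
      have hmod : ((2 * c + 1) * m + r) % (2 * m) = r + m := by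
        rw [hx, mul_comm c, Nat.mul_add_mod, Nat.mod_eq_of_lt (by omega)]
      have hmod' : ((2 * c + 1) * m + r) % m = r := by
        rw [mul_comm, Nat.mul_add_mod, Nat.mod_eq_of_lt hr]
      rw [if_neg (by omega), hmod', hx, show c * (2 * m) + (r + m) - m = c * (2 * m) + r by omega,
        he f r (by omega), he f (r + m) (by omega), pow_succ,
        mul_comm (2 ^ l) 2, sum_range_two_mul', ← sum_sub_distrib, sum_mul]
      refine sum_congr rfl fun i _ => ?_
      rw [show 2 * i * m + r = i * (2 * m) + r by ring,
        show (2 * i + 1) * m + r = i * (2 * m) + (r + m) by ring]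
      have h1 : ω ^ ((e + 2 ^ l) * (i * (2 * m) + r)) = ω ^ (e * (i * (2 * m) + r)) * ω ^ (r * 2 ^ l) := by
        rw [show (e + 2 ^ l) * (i * (2 * m) + r)
          = e * (i * (2 * m) + r) + (2 ^ l * (2 * m)) * i + r * 2 ^ l by ring, pow_add, pow_add,
          pow_mul ω (2 ^ l * (2 * m)), hN2, one_pow, mul_one]
      have h2 : ω ^ ((e + 2 ^ l) * (i * (2 * m) + (r + m)))
          = -(ω ^ (e * (i * (2 * m) + (r + m))) * ω ^ (r * 2 ^ l)) := by
        rw [show (e + 2 ^ l) * (i * (2 * m) + (r + m))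
          = e * (i * (2 * m) + (r + m)) + (2 ^ l * (2 * m)) * i + r * 2 ^ l + 2 ^ l * m by ring,
          pow_add, pow_add, pow_add, pow_mul ω (2 ^ l * (2 * m)), hN2, one_pow, hN, hω]
        ring
      rw [h1, h2]; ring

/-- The outputs of the forward transform are values at powers of `ω`. -/
theorem forward_eq_sum {ω : ℂ} {k : ℕ} (hω : ω ^ 2 ^ (k - 1) = -1) {x : ℕ} (hx : x < 2 ^ k) :
    ∃ e : ℕ, ∀ f : ℕ → ℂ, forward ω k f k x = ∑ i ∈ range (2 ^ k), f i * (ω ^ e) ^ i := by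
  obtain ⟨e, he⟩ := forward_eq hω le_rfl hx
  refine ⟨e, fun f => ?_⟩
  have := he f 0 (by simp)
  simp only [Nat.sub_self, pow_zero, mul_one, add_zero] at this
  rw [this]
  exact sum_congr rfl fun i _ => by rw [pow_mul]

/-- The convolution of two sequences. -/
def conv {R : Type*} [CommSemiring R] (a h : ℕ → R) (s : ℕ) : R :=
  ∑ i ∈ range (s + 1), a i * h (s - i)

/-- Padding with zeros to twice the length prevents wrap-around, so the cyclic product is the
ordinary convolution. -/
theorem sum_mul_sum_eq_conv {R : Type*} [CommSemiring R] {a h : ℕ → R} {M : ℕ} (z : R)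
    (ha : ∀ i, M ≤ i → a i = 0) (hh : ∀ i, M ≤ i → h i = 0) :
    (∑ i ∈ range (2 * M), a i * z ^ i) * ∑ i ∈ range (2 * M), h i * z ^ i
      = ∑ s ∈ range (2 * M), conv a h s * z ^ s := by
  rw [sum_mul_sum, ← sum_product', ← sum_subset (filter_subset (fun x => x.1 + x.2 < 2 * M) _),
    ← sum_fiberwise_of_maps_to (t := range (2 * M)) (g := fun x => x.1 + x.2)]
  · refine sum_congr rfl fun s hs => ?_
    have hs := mem_range.1 hs
    rw [conv, sum_mul]
    refine sum_nbij' (fun x => x.1) (fun i => (i, s - i)) ?_ ?_ ?_ ?_ ?_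
    · rintro ⟨i, j⟩ h
      simp only [mem_filter, mem_product, mem_range] at h ⊢
      omega
    · intro i hi
      simp only [mem_filter, mem_product, mem_range] at hi ⊢
      omega
    · rintro ⟨i, j⟩ h
      simp only [mem_filter, mem_product, mem_range] at h
      rw [Prod.mk.injEq]
      exact ⟨rfl, by omega⟩
    · intro i _; rfl
    · rintro ⟨i, j⟩ h
      simp only [mem_filter, mem_product, mem_range] at h ⊢
      rw [← h.2, pow_add, Nat.add_sub_cancel_left]; ring
  · rintro ⟨i, j⟩ h
    simp only [mem_filter, mem_product, mem_range] at h ⊢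
    omega
  · rintro ⟨i, j⟩ h h'
    simp only [mem_filter, mem_product, mem_range] at h h'
    rcases le_or_gt M i with hi | hi
    · rw [ha i hi]; simp
    · rw [hh j (by omega)]; simp

/-- The blocks of length `2 ^ (j + 1)` tile `[0, 2 ^ k)`, so the partner of a position stays inside.
-/
theorem half_index {k j x : ℕ} (hj : j < k) (hx : x < 2 ^ k) (h : x % (2 * 2 ^ j) < 2 ^ j) :
    x + 2 ^ j < 2 ^ k := by
  have h2 : 2 * 2 ^ j * (x / (2 * 2 ^ j) + 1) ≤ 2 ^ k := by
    have : 2 ^ k = 2 * 2 ^ j * 2 ^ (k - 1 - j) := by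
      rw [← pow_succ', ← pow_add]; congr 1; omega
    rw [this]
    refine Nat.mul_le_mul_left _ (Nat.succ_le_of_lt ?_)
    exact Nat.div_lt_of_lt_mul (this ▸ hx)
  have := Nat.div_add_mod x (2 * 2 ^ j)
  rw [mul_add] at h2
  omega

/-- Multiplying two transforms and transforming back computes the convolution. -/
theorem backward_mul_forward {ω ω' : ℂ} {k : ℕ} (hk : 1 ≤ k) (hω : ω ^ 2 ^ (k - 1) = -1)
    (h : ω * ω' = 1) {f g : ℕ → ℂ} (hf : ∀ i, 2 ^ (k - 1) ≤ i → f i = 0)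
    (hg : ∀ i, 2 ^ (k - 1) ≤ i → g i = 0) {F : ℕ → ℂ}
    (hF : ∀ x < 2 ^ k, F x = forward ω k f k x * forward ω k g k x) {x : ℕ} (hx : x < 2 ^ k) :
    backward ω' k F k x = 2 ^ k * conv f g x := by
  have hkk : 2 ^ k = 2 * 2 ^ (k - 1) := by rw [← pow_succ']; congr 1; omega
  -- The evaluation point belonging to `x` does not depend on the sequence, so the three transforms
  -- are values of polynomials at one and the same point.
  have hF' : ∀ x < 2 ^ k, F x = forward ω k (conv f g) k x := by
    intro x hx
    obtain ⟨e, he⟩ := forward_eq_sum hω hx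
    rw [hF x hx, he, he, he, hkk, sum_mul_sum_eq_conv _ hf hg]
  -- `F` is controlled only below `2 ^ k`, but the stages never look beyond it.
  have hb : ∀ j ≤ k, ∀ x < 2 ^ k, backward ω' k F j x
      = backward ω' k (forward ω k (conv f g) k) j x := by
    intro j
    induction j with
    | zero => exact fun _ => hF'
    | succ j ih =>
      intro hj x hx
      have ih := ih (by omega)
      simp only [backward, ditStage]
      split_ifs with h1
      · rw [ih x hx, ih (x + 2 ^ j) (half_index (by omega) hx h1)]
      · rw [ih x hx, ih (x - 2 ^ j) ((Nat.sub_le _ _).trans_lt hx)]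
  rw [hb k le_rfl x hx, backward_forward h _ le_rfl, Nat.sub_self, forward]

end FFT

/-! ### Fixed-point arithmetic -/

namespace FFT

open Finset

/-- The pair of integers `(x, y)` represents `z` with `P` units per `1`, up to an error of `E`
units. -/
def Approx (P : ℝ) (x y : ℤ) (z : ℂ) (E : ℝ) : Prop := ‖(⟨x, y⟩ : ℂ) - P * z‖ ≤ E

variable {P E F : ℝ} {x y x' y' : ℤ} {z z' : ℂ}

theorem Approx.mono (h : Approx P x y z E) (hE : E ≤ F) : Approx P x y z F := le_trans h hE

theorem Approx.nonneg (h : Approx P x y z E) : 0 ≤ E := (norm_nonneg _).trans h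

theorem Approx.add (h : Approx P x y z E) (h' : Approx P x' y' z' F) :
    Approx P (x + x') (y + y') (z + z') (E + F) := by
  have : (⟨((x + x' : ℤ) : ℝ), ((y + y' : ℤ) : ℝ)⟩ : ℂ) - P * (z + z')
      = ((⟨x, y⟩ : ℂ) - P * z) + ((⟨x', y'⟩ : ℂ) - P * z') := by
    apply Complex.ext <;> simp <;> ring
  rw [Approx, this]
  exact (norm_add_le _ _).trans (add_le_add h h')

theorem Approx.neg (h : Approx P x y z E) : Approx P (-x) (-y) (-z) E := by
  have : (⟨((-x : ℤ) : ℝ), ((-y : ℤ) : ℝ)⟩ : ℂ) - P * (-z) = -((⟨x, y⟩ : ℂ) - P * z) := by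
    apply Complex.ext <;> simp <;> ring
  rw [Approx, this, norm_neg]
  exact h

theorem Approx.sub (h : Approx P x y z E) (h' : Approx P x' y' z' F) :
    Approx P (x - x') (y - y') (z - z') (E + F) := by
  simpa only [sub_eq_add_neg] using h.add h'.neg

theorem Approx.conj (h : Approx P x y z E) : Approx P x (-y) (starRingEnd ℂ z) E := by
  have : (⟨((x : ℤ) : ℝ), ((-y : ℤ) : ℝ)⟩ : ℂ) - P * (starRingEnd ℂ z)
      = starRingEnd ℂ ((⟨x, y⟩ : ℂ) - P * z) := by
    apply Complex.ext <;> simp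
  rw [Approx, this, RCLike.norm_conj]
  exact h

theorem Approx.norm_le (hP : 0 ≤ P) (h : Approx P x y z E) :
    ‖(⟨x, y⟩ : ℂ)‖ ≤ P * ‖z‖ + E := by
  have := norm_le_norm_add_norm_sub' (⟨x, y⟩ : ℂ) (P * z)
  rw [norm_mul, Complex.norm_real, Real.norm_of_nonneg hP] at this
  exact this.trans (add_le_add le_rfl h)

theorem Approx.abs_re_le (hP : 0 ≤ P) (h : Approx P x y z E) : |(x : ℝ)| ≤ P * ‖z‖ + E :=
  (Complex.abs_re_le_norm ⟨x, y⟩).trans (h.norm_le hP)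

theorem Approx.abs_im_le (hP : 0 ≤ P) (h : Approx P x y z E) : |(y : ℝ)| ≤ P * ‖z‖ + E :=
  (Complex.abs_im_le_norm ⟨x, y⟩).trans (h.norm_le hP)

theorem approx_exact (P : ℝ) (a : ℤ) {S : ℤ} (hS : P = S) : Approx P (a * S) 0 a 0 := by
  have : (⟨((a * S : ℤ) : ℝ), ((0 : ℤ) : ℝ)⟩ : ℂ) - P * a = 0 := by
    apply Complex.ext <;> simp [hS, mul_comm]
  rw [Approx, this, norm_zero]

/-- Multiplication, rounding towards negative infinity. -/
theorem Approx.mul {S : ℤ} (hS : P = S) (hP : 0 < S) (h : Approx P x y z E)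
    (h' : Approx P x' y' z' F) :
    Approx P ((x * x' - y * y') / S) ((x * y' + y * x') / S) (z * z')
      (E * (‖z'‖ + F / P) + ‖z‖ * F + 2) := by
  have hPr : 0 < P := by rw [hS]; exact_mod_cast hP
  -- Rounding costs at most one unit in each coordinate, which gives the summand 2 in the error.
  have hfloor : ∀ a : ℤ, |((a / S : ℤ) : ℝ) - a / P| ≤ 1 := by
    intro a
    have h1 := Int.emod_add_mul_ediv a S
    have h2 := Int.emod_nonneg a hP.ne'
    have h3 := Int.emod_lt_of_pos a hP
    have : ((a / S : ℤ) : ℝ) - a / P = -((a % S : ℤ) : ℝ) / P := by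
      rw [← sub_eq_zero]
      field_simp
      rw [hS]
      have := congrArg (Int.cast : ℤ → ℝ) h1
      push_cast at this
      linarith
    rw [this, abs_div, abs_neg, abs_of_pos hPr, div_le_one hPr, abs_of_nonneg (by exact_mod_cast h2),
      hS]
    exact_mod_cast h3.le
  set d : ℂ := ⟨x, y⟩ with hd
  set w : ℂ := ⟨x', y'⟩ with hw
  -- With `d ≈ P * z` and `w ≈ P * z'`, the error splits as rounding plus `(d - P * z) * (w / P)`
  -- plus `z * (w - P * z')`.
  have hdw : (⟨(((x * x' - y * y') / S : ℤ) : ℝ), (((x * y' + y * x') / S : ℤ) : ℝ)⟩ : ℂ)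
      - P * (z * z') = ((⟨(((x * x' - y * y') / S : ℤ) : ℝ), (((x * y' + y * x') / S : ℤ) : ℝ)⟩ : ℂ)
        - d * w / P) + ((d - P * z) * (w / P) + z * (w - P * z')) := by
    have : (P : ℂ) ≠ 0 := by exact_mod_cast hPr.ne'
    field_simp
    ring
  rw [Approx, hdw]
  have hb : ‖(⟨(((x * x' - y * y') / S : ℤ) : ℝ), (((x * y' + y * x') / S : ℤ) : ℝ)⟩ : ℂ)
        - d * w / P‖ ≤ 2 := by
    refine (Complex.norm_le_abs_re_add_abs_im _).trans ?_
    have h1 := hfloor (x * x' - y * y')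
    have h2 := hfloor (x * y' + y * x')
    push_cast at h1 h2
    simp only [Complex.sub_re, Complex.sub_im, Complex.div_ofReal_re, Complex.div_ofReal_im,
      Complex.mul_re, Complex.mul_im, hd, hw]
    linarith
  have hw' : ‖w / P‖ ≤ ‖z'‖ + F / P := by
    rw [norm_div, Complex.norm_real, Real.norm_of_nonneg hPr.le, div_le_iff₀ hPr, add_mul,
      div_mul_cancel₀ _ hPr.ne', mul_comm]
    exact h'.norm_le hPr.le
  have hE := h.nonneg
  calc _ ≤ 2 + (E * (‖z'‖ + F / P) + ‖z‖ * F) := by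
        refine (norm_add_le _ _).trans (add_le_add hb ((norm_add_le _ _).trans (add_le_add ?_ ?_)))
        · rw [norm_mul]
          exact mul_le_mul h hw' (norm_nonneg _) hE
        · rw [norm_mul]
          exact mul_le_mul_of_nonneg_left h' (norm_nonneg _)
    _ = _ := by ring

/-- Rounding to the nearest integer recovers integers. -/
theorem Approx.round {N : ℕ} {c : ℤ} {S : ℤ} (hS : P = S) (hP : 0 < S) (hN : 0 < N)
    (h : Approx P x y ((N : ℂ) * c) E) (hE : E < P * N / 2) (heven : 2 ∣ S) :
    (x + S / 2 * N) / (S * N) = c ∧ S * N * c ≤ x + S / 2 * N ∧ x + S / 2 * N < S * N * (c + 1) := by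
  have h1 : |(x : ℝ) - P * N * c| ≤ E := by
    have := (Complex.abs_re_le_norm ((⟨x, y⟩ : ℂ) - P * (N * c))).trans h
    have e : ((⟨x, y⟩ : ℂ) - P * (N * c)).re = (x : ℝ) - P * N * c := by simp; ring
    rwa [e] at this
  obtain ⟨H, rfl⟩ := heven
  rw [Int.mul_ediv_cancel_left _ two_ne_zero]
  have h2 := abs_le.1 (h1.trans hE.le)
  have h3 := abs_lt.1 (h1.trans_lt hE)
  rw [hS] at h3
  push_cast at h3
  have h4 : (2 * H : ℤ) * N * c ≤ x + H * N := by
    have : ((2 * H : ℤ) * N * c : ℝ) ≤ x + H * N := by push_cast; linarith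
    exact_mod_cast this
  have h5 : x + H * N < (2 * H : ℤ) * N * (c + 1) := by
    have : (x + H * N : ℝ) < (2 * H : ℤ) * N * (c + 1) := by push_cast; linarith
    exact_mod_cast this
  refine ⟨?_, h4, h5⟩
  have hpos : 0 < 2 * H * (N : ℤ) := by positivity
  apply le_antisymm
  · exact Int.le_of_lt_add_one (Int.ediv_lt_of_lt_mul hpos (by rwa [mul_comm (c + 1)]))
  · exact Int.le_ediv_of_mul_le hpos (by rw [mul_comm]; exact h4)

/-- Entrywise approximation of the first `N` terms. -/
def ApproxOn (P : ℝ) (N : ℕ) (re im : ℤ → ℤ) (f : ℕ → ℂ) (E : ℝ) : Prop :=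
  ∀ x : ℕ, x < N → Approx P (re x) (im x) (f x) E

section Magnitude

variable {ω : ℂ} {k : ℕ} {f : ℕ → ℂ} {Z : ℝ}

theorem norm_difStage_le (hω : ‖ω‖ = 1) {r j : ℕ} (hj : j < k) (hf : ∀ x < 2 ^ k, ‖f x‖ ≤ Z)
    {x : ℕ} (hx : x < 2 ^ k) : ‖difStage ω r (2 ^ j) f x‖ ≤ 2 * Z := by
  unfold difStage
  split_ifs with h
  · refine (norm_add_le _ _).trans ?_
    linarith [hf x hx, hf _ (half_index hj hx h)]
  · rw [norm_mul, norm_pow, hω, one_pow, mul_one]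
    refine (norm_sub_le _ _).trans ?_
    linarith [hf x hx, hf (x - 2 ^ j) ((Nat.sub_le _ _).trans_lt hx)]

theorem norm_ditStage_le (hω : ‖ω‖ = 1) {r j : ℕ} (hj : j < k) (hf : ∀ x < 2 ^ k, ‖f x‖ ≤ Z)
    {x : ℕ} (hx : x < 2 ^ k) : ‖ditStage ω r (2 ^ j) f x‖ ≤ 2 * Z := by
  have hm : ∀ y e, ‖f y * ω ^ e‖ = ‖f y‖ := fun y e => by
    rw [norm_mul, norm_pow, hω, one_pow, mul_one]
  unfold ditStage
  split_ifs with h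
  · refine (norm_add_le _ _).trans ?_
    rw [hm]
    linarith [hf x hx, hf _ (half_index hj hx h)]
  · refine (norm_sub_le _ _).trans ?_
    rw [hm]
    linarith [hf x hx, hf (x - 2 ^ j) ((Nat.sub_le _ _).trans_lt hx)]

/-- Twiddle factors have modulus 1, so a butterfly at most doubles the maximum. -/
theorem norm_forward_le (hω : ‖ω‖ = 1) (hf : ∀ x < 2 ^ k, ‖f x‖ ≤ Z) {l : ℕ} (hl : l ≤ k)
    {x : ℕ} (hx : x < 2 ^ k) : ‖forward ω k f l x‖ ≤ 2 ^ l * Z := by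
  induction l generalizing x with
  | zero => simpa [forward] using hf x hx
  | succ l ih =>
    rw [forward, pow_succ', mul_assoc]
    exact norm_difStage_le hω (by omega) (fun x hx => ih (by omega) hx) hx

theorem norm_backward_le (hω : ‖ω‖ = 1) (hf : ∀ x < 2 ^ k, ‖f x‖ ≤ Z) {l : ℕ} (hl : l ≤ k)
    {x : ℕ} (hx : x < 2 ^ k) : ‖backward ω k f l x‖ ≤ 2 ^ l * Z := by
  induction l generalizing x with
  | zero => simpa [backward] using hf x hx
  | succ l ih =>
    rw [backward, pow_succ', mul_assoc]
    exact norm_ditStage_le hω (by omega) (fun x hx => ih (by omega) hx) hx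

end Magnitude

end FFT

/-! ### Computing roots of unity by bisecting angles -/

namespace FFT

open Finset

/-- Approximations of the cosine and sine of `2 * π / 2 ^ l`. -/
structure RootApprox (P : ℤ) (l : ℕ) (c s : ℤ) : Prop where
  re : |(c : ℝ) - P * Real.cos (2 * Real.pi / 2 ^ l)| ≤ l
  im : |(s : ℝ) - P * Real.sin (2 * Real.pi / 2 ^ l)| ≤ 3 * l ^ 2
  re_nonneg : 0 ≤ c
  im_nonneg : 0 ≤ s

theorem rootApprox_two {P : ℤ} (hP : 0 ≤ P) : RootApprox P 2 0 P := by
  have h : 2 * Real.pi / 2 ^ 2 = Real.pi / 2 := by ring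
  refine ⟨?_, ?_, le_rfl, hP⟩ <;> rw [h] <;> norm_num

variable {P c s : ℤ} {l : ℕ}

theorem RootApprox.re_le (h : RootApprox P l c s) (hP : 0 ≤ P) : c ≤ P + l := by
  have h1 := (abs_le.1 h.re).2
  have h2 : (P : ℝ) * Real.cos (2 * Real.pi / 2 ^ l) ≤ P * 1 :=
    mul_le_mul_of_nonneg_left (Real.cos_le_one _) (by exact_mod_cast hP)
  have : (c : ℝ) ≤ P + l := by linarith
  exact_mod_cast this

theorem RootApprox.im_le (h : RootApprox P l c s) (hP : 0 ≤ P) : s ≤ P + 3 * l ^ 2 := by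
  have h1 := (abs_le.1 h.im).2
  have h2 : (P : ℝ) * Real.sin (2 * Real.pi / 2 ^ l) ≤ P * 1 :=
    mul_le_mul_of_nonneg_left (Real.sin_le_one _) (by exact_mod_cast hP)
  have : (s : ℝ) ≤ P + 3 * l ^ 2 := by linarith
  exact_mod_cast this

/-- The half-angle formulas: `cos φ = √((1 + cos 2φ) / 2)` becomes an integer square root and `sin φ
= sin 2φ / (2 cos φ)` a rounded quotient. Since `cos φ` stays away from 0, the square root damps the
inherited error, and the cosine error grows only by the rounding unit per step. This adds a linear
amount to the sine error, hence its quadratic bound. -/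
theorem RootApprox.half (h : RootApprox P l c s) (hl : 2 ≤ l) (hP : 10 * (l + 1) ≤ P)
    (heven : 2 ∣ P) {r : ℤ} (hr : 0 ≤ r) (hr₁ : r * r ≤ P / 2 * (P + c))
    (hr₂ : P / 2 * (P + c) < (r + 1) * (r + 1)) :
    P ≤ 2 * r ∧ RootApprox P (l + 1) r (s * P / (2 * r)) := by
  obtain ⟨H, rfl⟩ := heven
  rw [Int.mul_ediv_cancel_left _ two_ne_zero] at hr₁ hr₂
  set φ : ℝ := 2 * Real.pi / 2 ^ (l + 1) with hφ
  have hφ2 : 2 * Real.pi / 2 ^ l = 2 * φ := by rw [hφ, pow_succ]; field_simp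
  have hre := h.re
  have him := h.im
  rw [hφ2] at hre him
  have hφ0 : 0 ≤ φ := by positivity
  have hφ1 : φ ≤ Real.pi / 4 := by
    rw [hφ, div_le_div_iff₀ (by positivity) (by norm_num)]
    have : (2 : ℝ) ^ 3 ≤ 2 ^ (l + 1) := pow_le_pow_right₀ (by norm_num) (by omega)
    nlinarith [Real.pi_pos]
  -- `l ≥ 2` gives `φ ≤ π / 4`.
  have hC : 0.7 ≤ Real.cos φ := by
    have h1 : Real.cos (Real.pi / 4) ≤ Real.cos φ :=
      Real.cos_le_cos_of_nonneg_of_le_pi hφ0 (by linarith [Real.pi_pos]) hφ1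
    rw [Real.cos_pi_div_four] at h1
    have : (1.4 : ℝ) ≤ √2 := Real.le_sqrt_of_sq_le (by norm_num)
    linarith
  have hS0 : 0 ≤ Real.sin φ := Real.sin_nonneg_of_nonneg_of_le_pi hφ0 (by linarith [Real.pi_pos])
  have hS1 := Real.sin_le_one φ
  have hC1 := Real.cos_le_one φ
  rw [Real.cos_two_mul] at hre
  rw [Real.sin_two_mul] at him
  set C := Real.cos φ
  set S := Real.sin φ
  have hPr : 10 * ((l : ℝ) + 1) ≤ 2 * H := by exact_mod_cast hP
  have hl0 : (0 : ℝ) ≤ l := Nat.cast_nonneg l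
  have hrr : (0 : ℝ) ≤ r := by exact_mod_cast hr
  have h1 : (r : ℝ) * r ≤ H * (2 * H + c) := by exact_mod_cast hr₁
  have h2 : (H : ℝ) * (2 * H + c) < (r + 1) * (r + 1) := by exact_mod_cast hr₂
  push_cast at hre him
  obtain ⟨hre1, hre2⟩ := abs_le.1 hre
  have hH : (0 : ℝ) < H := by linarith
  -- The radicand is `(2HC) ^ 2` up to an error of `H * l`, while shifting `2HC` by `l` changes its
  -- square by at least `4HCl - l ^ 2`, which is larger because `C ≥ 0.7`.
  have hr_le : (r : ℝ) ≤ 2 * H * C + l := by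
    refine nonneg_le_nonneg_of_sq_le_sq (by positivity) (h1.trans ?_)
    nlinarith [mul_le_mul_of_nonneg_left hre2 hH.le, mul_nonneg hl0 hH.le,
      mul_nonneg (mul_nonneg hl0 hH.le) (sub_nonneg.2 hC), mul_nonneg hl0 hl0]
  have hr_ge : 2 * H * C - (l + 1) ≤ r := by
    by_contra! hlt
    have h3 : ((r : ℝ) + 1) * (r + 1) ≤ (2 * H * C - l) * (2 * H * C - l) := by
      refine mul_self_le_mul_self (by linarith) (by linarith)
    nlinarith [mul_le_mul_of_nonneg_left hre1 hH.le, mul_nonneg hl0 hH.le,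
      mul_nonneg (mul_nonneg hl0 hH.le) (sub_nonneg.2 hC), mul_nonneg hl0 hl0]
  -- From `r ≥ 1.4 * H - (l + 1)` and `l + 1 ≤ 0.2 * H`; this is where the factor 10 in the
  -- hypothesis on `P` is needed.
  have hrH : (H : ℝ) ≤ r := by nlinarith
  have hrpos : (0 : ℝ) < r := hH.trans_le hrH
  have hrpos' : 0 < r := by exact_mod_cast hrpos
  have hre' : |(r : ℝ) - 2 * H * C| ≤ (l + 1 : ℝ) := abs_le.2 ⟨by linarith, by linarith⟩
  refine ⟨by exact_mod_cast (by linarith : (2 * H : ℝ) ≤ 2 * r), ?_, ?_, hr, ?_⟩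
  · push_cast
    exact hre'
  · have hfl : |((s * (2 * H) / (2 * r) : ℤ) : ℝ) - s * (2 * H) / (2 * r)| ≤ 1 := by
      have e1 := Int.emod_add_mul_ediv (s * (2 * H)) (2 * r)
      have e2 := Int.emod_nonneg (s * (2 * H)) (by omega : 2 * r ≠ 0)
      have e3 := Int.emod_lt_of_pos (s * (2 * H)) (by omega : 0 < 2 * r)
      have : ((s * (2 * H) / (2 * r) : ℤ) : ℝ) - s * (2 * H) / (2 * r)
          = -((s * (2 * H) % (2 * r) : ℤ) : ℝ) / (2 * r) := by
        rw [← sub_eq_zero]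
        field_simp
        have := congrArg (Int.cast : ℤ → ℝ) e1
        push_cast at this ⊢
        linarith
      rw [this, abs_div, abs_neg, abs_of_pos (by positivity : (0 : ℝ) < 2 * r),
        div_le_one (by positivity), abs_of_nonneg (by exact_mod_cast e2)]
      exact_mod_cast e3.le
    -- With one more unit for rounding, `3 * l ^ 2 + 2 * (l + 1) + 1 ≤ 3 * (l + 1) ^ 2` closes the
    -- induction.
    have hmain : |(s * (2 * H) / (2 * r) : ℝ) - 2 * H * S| ≤ 3 * l ^ 2 + 2 * (l + 1) := by
      have e : (s * (2 * H) / (2 * r) : ℝ) - 2 * H * S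
          = H / r * ((s - 2 * H * (2 * S * C)) + 2 * S * (2 * H * C - r)) := by
        field_simp; ring
      rw [e, abs_mul, abs_of_pos (by positivity)]
      have hq : (H : ℝ) / r ≤ 1 := (div_le_one hrpos).2 hrH
      refine (mul_le_of_le_one_left (abs_nonneg _) hq).trans ((abs_add_le _ _).trans ?_)
      rw [abs_mul, abs_sub_comm (2 * H * C), abs_of_nonneg (by positivity : 0 ≤ 2 * S)]
      have : 2 * S * |(r : ℝ) - 2 * H * C| ≤ 2 * (l + 1) :=
        mul_le_mul (by linarith) hre' (abs_nonneg _) (by norm_num)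
      linarith
    push_cast
    have e : ((s * (2 * H) / (2 * r) : ℤ) : ℝ) - 2 * H * S
        = (((s * (2 * H) / (2 * r) : ℤ) : ℝ) - s * (2 * H) / (2 * r))
          + ((s * (2 * H) / (2 * r) : ℝ) - 2 * H * S) := by ring
    rw [e]
    refine (abs_add_le _ _).trans ?_
    nlinarith
  · exact Int.ediv_nonneg (mul_nonneg h.im_nonneg (by exact_mod_cast (by linarith : (0 : ℝ) ≤ 2 * H)))
      (by omega)

/-- The primitive root of unity of order `2 ^ k`. -/
noncomputable def root (k : ℕ) : ℂ := Complex.exp ((2 * Real.pi / 2 ^ k : ℝ) * Complex.I)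

theorem norm_root (k : ℕ) : ‖root k‖ = 1 := Complex.norm_exp_ofReal_mul_I _

theorem root_pow (k : ℕ) (hk : 1 ≤ k) : root k ^ 2 ^ (k - 1) = -1 := by
  rw [root, ← Complex.exp_nat_mul, ← Complex.exp_pi_mul_I]
  congr 1
  have : (2 : ℂ) ^ k = 2 * 2 ^ (k - 1) := by rw [← pow_succ']; congr 1; omega
  push_cast
  rw [this]
  field_simp

theorem root_mul_conj (k : ℕ) : root k * starRingEnd ℂ (root k) = 1 := by
  rw [Complex.mul_conj, Complex.normSq_eq_norm_sq, norm_root]; simp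

theorem RootApprox.approx {k : ℕ} (h : RootApprox P k c s) :
    Approx P c s (root k) (k + 3 * k ^ 2) := by
  refine (Complex.norm_le_abs_re_add_abs_im _).trans ?_
  have h1 : ((⟨c, s⟩ : ℂ) - (P : ℝ) * root k).re = c - P * Real.cos (2 * Real.pi / 2 ^ k) := by
    rw [Complex.sub_re, Complex.re_ofReal_mul, root, Complex.exp_ofReal_mul_I_re]
  have h2 : ((⟨c, s⟩ : ℂ) - (P : ℝ) * root k).im = s - P * Real.sin (2 * Real.pi / 2 ^ k) := by
    rw [Complex.sub_im, Complex.im_ofReal_mul, root, Complex.exp_ofReal_mul_I_im]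
  rw [h1, h2]
  exact add_le_add h.re h.im

/-- Powers of a root of unity by repeated multiplication. -/
theorem Approx.mul_root {k j : ℕ} {x y x' y' : ℤ} {F Y : ℝ} (hP : 0 < P)
    (h : Approx P x y (root k ^ j) (j * Y)) (h' : Approx P x' y' (root k) F) (hY : F + 3 ≤ Y)
    (hj : j * Y * F ≤ P) :
    Approx P ((x * x' - y * y') / P) ((x * y' + y * x') / P) (root k ^ (j + 1)) ((j + 1 : ℕ) * Y) := by
  rw [pow_succ]
  refine (h.mul rfl hP h').mono ?_
  rw [norm_root, norm_pow, norm_root, one_pow, one_mul]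
  have hPr : (0 : ℝ) < P := by exact_mod_cast hP
  -- The second-order term costs at most one unit, so a multiplication adds at most `F + 3 ≤ Y` and
  -- the error grows linearly.
  have : j * Y * (F / P) ≤ 1 := by rw [← mul_div_assoc, div_le_one hPr]; exact hj
  push_cast
  rw [mul_add]
  linarith

end FFT

/-! ### The transform as a program -/

namespace ArrayLang

open Stmt Finset

section

open Var

/-- The indices of the two entries of the `i`-th butterfly and of its twiddle factor. -/
def indexCode : Stmt :=
  assign x (i / m * (2 * m) + i % m) ;;
  assign y (x + m) ;;
  assign z (i % m * st)

/-- Complex product of `(c, d)` and `(a, b)`, rounded down, into `(u, v)`. -/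
def mulCode : Stmt :=
  assign u ((c * a - d * b + shift) / scale - off) ;;
  assign v ((c * b + d * a + shift) / scale - off)

/-- One stage of the forward transform. -/
def difCode : Stmt :=
  forTo i hlen (indexCode ;;
    (assign c (.get .sigRe x - .get .sigRe y) ;;
     assign d (.get .sigIm x - .get .sigIm y) ;;
     assign a (.get .twRe z) ;;
     assign b (.get .twIm z) ;;
     put .sigRe x (.get .sigRe x + .get .sigRe y) ;;
     put .sigIm x (.get .sigIm x + .get .sigIm y)) ;;
    mulCode ;;
    put .sigRe y u ;;
    put .sigIm y v)

/-- One stage of the inverse transform. -/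
def ditCode : Stmt :=
  forTo i hlen (indexCode ;;
    (assign c (.get .sigRe y) ;;
     assign d (.get .sigIm y) ;;
     assign a (.get .twRe z) ;;
     assign b (0 - .get .twIm z)) ;;
    mulCode ;;
    put .sigRe y (.get .sigRe x - u) ;;
    put .sigIm y (.get .sigIm x - v) ;;
    put .sigRe x (.get .sigRe x + u) ;;
    put .sigIm x (.get .sigIm x + v))

end
variable {W : ℕ} {sz : Arr → ℕ}

theorem indexCode_spec {σ : St} {i m st : ℕ} (hi : σ.var .i = i) (hm : σ.var .m = m)
    (hst : σ.var .st = st) (hm0 : 0 < m) (hiW : i < W) (hmW : m < W) :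
    Triple W sz indexCode σ 22 fun σ' => σ'.var .x = (i / m * (2 * m) + i % m : ℕ) ∧
      σ'.var .y = (i / m * (2 * m) + i % m + m : ℕ) ∧ σ'.var .z = (i % m * st : ℕ) := by
  refine Triple.of_wp ?_ (by decide)
  simp [indexCode, hi, hm, hst]
  omega

/-- Rounded product, as computed by `mulCode`. -/
theorem mulCode_spec {σ : St} {a b c d P O : ℤ} (ha : σ.var .a = a) (hb : σ.var .b = b)
    (hc : σ.var .c = c) (hd : σ.var .d = d) (hP : σ.var .scale = P) (hO : σ.var .off = O)
    (hs : σ.var .shift = O * P) (hP0 : 0 < P) (hPW : P < W) (hW : 2 * (O * P) ≤ W)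
    (h1 : |c * a - d * b| < O * P) (h2 : |c * b + d * a| < O * P) :
    Triple W sz mulCode σ 28 fun σ' =>
      σ'.var .u = (c * a - d * b) / P ∧ σ'.var .v = (c * b + d * a) / P := by
  refine Triple.of_wp ?_ (by decide)
  have h1' := abs_lt.1 h1
  have h2' := abs_lt.1 h2
  simp [mulCode, ha, hb, hc, hd, hP, hO, hs]
  refine ⟨⟨⟨by omega, by omega⟩, by omega, by omega⟩, ⟨⟨by omega, by omega⟩, by omega, by omega⟩, ?_, ?_⟩ <;>
  · rw [Int.add_mul_ediv_right _ _ hP0.ne']; ring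

/-- Position of the first entry of the `i`-th butterfly. -/
def butterfly (m i : ℕ) : ℕ := i / m * (2 * m) + i % m

/-- The butterfly to which a position belongs. -/
def butterflyIndex (m x : ℕ) : ℕ := x / (2 * m) * m + x % m

theorem butterfly_mod {m : ℕ} (hm : 0 < m) (i : ℕ) :
    butterfly m i % (2 * m) = i % m ∧ butterfly m i % m = i % m ∧
      butterfly m i / (2 * m) = i / m := by
  have h := Nat.mod_lt i hm
  have h1 : butterfly m i = i % m + 2 * m * (i / m) := by rw [butterfly]; ring
  refine ⟨?_, ?_, ?_⟩
  · rw [h1, Nat.add_mul_mod_self_left, Nat.mod_eq_of_lt (by omega)]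
  · rw [h1, mul_comm 2 m, mul_assoc, Nat.add_mul_mod_self_left, Nat.mod_mod]
  · rw [h1, Nat.add_mul_div_left _ _ (by omega), Nat.div_eq_of_lt (by omega), zero_add]

theorem butterfly_add_mod {m : ℕ} (hm : 0 < m) (i : ℕ) :
    (butterfly m i + m) % (2 * m) = i % m + m ∧ (butterfly m i + m) % m = i % m ∧
      (butterfly m i + m) / (2 * m) = i / m := by
  have h := Nat.mod_lt i hm
  have h1 : butterfly m i + m = i % m + m + 2 * m * (i / m) := by rw [butterfly]; ring
  refine ⟨?_, ?_, ?_⟩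
  · rw [h1, Nat.add_mul_mod_self_left, Nat.mod_eq_of_lt (by omega)]
  · rw [Nat.add_mod_right, (butterfly_mod hm i).2.1]
  · rw [h1, Nat.add_mul_div_left _ _ (by omega), Nat.div_eq_of_lt (by omega), zero_add]

theorem butterflyIndex_butterfly {m : ℕ} (hm : 0 < m) (i : ℕ) :
    butterflyIndex m (butterfly m i) = i ∧ butterflyIndex m (butterfly m i + m) = i := by
  simp only [butterflyIndex, (butterfly_mod hm i).2, (butterfly_add_mod hm i).2]
  have := Nat.div_add_mod i m
  rw [mul_comm] at this
  exact ⟨this, this⟩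

/-- Each butterfly owns exactly two positions, which makes the in-place update sound: no later
butterfly reads an overwritten entry. -/
theorem butterflyIndex_eq {m : ℕ} (hm : 0 < m) {i x : ℕ} (h : butterflyIndex m x = i) :
    x = if x % (2 * m) < m then butterfly m i else butterfly m i + m := by
  have h1 := Nat.mod_lt x hm
  have h2 : i / m = x / (2 * m) := by
    rw [← h, butterflyIndex, add_comm, mul_comm, Nat.add_mul_div_left _ _ hm, Nat.div_eq_of_lt h1,
      zero_add]
  have h3 : i % m = x % m := by
    rw [← h, butterflyIndex, add_comm, mul_comm, Nat.add_mul_mod_self_left, Nat.mod_mod]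
  have h4 := Nat.div_add_mod x (2 * m)
  rw [mul_comm] at h4
  rw [butterfly, h2, h3]
  split_ifs with h5
  · rw [FFT.mod_two_mul_of_lt h5, h4]
  · have h6 := not_lt.1 h5
    rw [FFT.mod_two_mul_of_ge hm h6]
    omega

theorem butterflyIndex_lt {m r x : ℕ} (hx : x < 2 * m * r) : butterflyIndex m x < m * r := by
  have hm : 0 < m := by
    rcases Nat.eq_zero_or_pos m with rfl | h
    · simp at hx
    · exact h
  have h1 : x / (2 * m) < r := Nat.div_lt_of_lt_mul hx
  have h2 := Nat.mod_lt x hm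
  have : m * (x / (2 * m) + 1) ≤ m * r := Nat.mul_le_mul_left _ h1
  rw [butterflyIndex]
  nlinarith

theorem butterfly_add_lt {m r i : ℕ} (hi : i < m * r) : butterfly m i + m < 2 * m * r := by
  have hm : 0 < m := by
    rcases Nat.eq_zero_or_pos m with rfl | h
    · simp at hi
    · exact h
  have h1 : i / m < r := Nat.div_lt_of_lt_mul hi
  have h2 := Nat.mod_lt i hm
  have : 2 * m * (i / m + 1) ≤ 2 * m * r := Nat.mul_le_mul_left _ h1
  rw [butterfly]
  nlinarith

end ArrayLang

/-! ### In-place butterfly stages in fixed-point arithmetic -/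

namespace ArrayLang

open Stmt Finset

variable {W : ℕ} {sz : Arr → ℕ}

/-- One stage of the forward transform in fixed-point arithmetic, real parts. -/
def difRe (P : ℤ) (re im wr wi : ℤ → ℤ) (m st x : ℕ) : ℤ :=
  if x % (2 * m) < m then re x + re (x + m : ℕ)
  else ((re (x - m : ℕ) - re x) * wr (x % m * st : ℕ)
    - (im (x - m : ℕ) - im x) * wi (x % m * st : ℕ)) / P

/-- One stage of the forward transform in fixed-point arithmetic, imaginary parts. -/
def difIm (P : ℤ) (re im wr wi : ℤ → ℤ) (m st x : ℕ) : ℤ :=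
  if x % (2 * m) < m then im x + im (x + m : ℕ)
  else ((re (x - m : ℕ) - re x) * wi (x % m * st : ℕ)
    + (im (x - m : ℕ) - im x) * wr (x % m * st : ℕ)) / P

/-- One stage of the inverse transform in fixed-point arithmetic, real parts. -/
def ditRe (P : ℤ) (re im wr wi : ℤ → ℤ) (m st x : ℕ) : ℤ :=
  if x % (2 * m) < m then re x + (re (x + m : ℕ) * wr (x % m * st : ℕ)
    - im (x + m : ℕ) * -wi (x % m * st : ℕ)) / P
  else re (x - m : ℕ) - (re x * wr (x % m * st : ℕ) - im x * -wi (x % m * st : ℕ)) / P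

/-- One stage of the inverse transform in fixed-point arithmetic, imaginary parts. -/
def ditIm (P : ℤ) (re im wr wi : ℤ → ℤ) (m st x : ℕ) : ℤ :=
  if x % (2 * m) < m then im x + (re (x + m : ℕ) * -wi (x % m * st : ℕ)
    + im (x + m : ℕ) * wr (x % m * st : ℕ)) / P
  else im (x - m : ℕ) - (re x * -wi (x % m * st : ℕ) + im x * wr (x % m * st : ℕ)) / P

/-- The variables that do not change during a transform. -/
structure Globals (σ : St) (N : ℕ) (P O : ℤ) : Prop where
  len : σ.var .len = (2 * N : ℕ)
  hlen : σ.var .hlen = N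
  scale : σ.var .scale = P
  off : σ.var .off = O
  shift : σ.var .shift = O * P

/-- Size conditions for the fixed-point arithmetic. -/
structure Sizes (W : ℕ) (sz : Arr → ℕ) (N : ℕ) (P O : ℤ) : Prop where
  pos : 0 < P
  lt : P < W
  shift : 2 * (O * P) ≤ W
  len : 2 * N < W
  sigRe : sz .sigRe = 2 * N
  sigIm : sz .sigIm = 2 * N
  twRe : sz .twRe = 2 * N
  twIm : sz .twIm = 2 * N

theorem Globals.of_eq {σ σ' : St} {N : ℕ} {P O : ℤ} (h : Globals σ N P O)
    (hl : σ'.var .len = σ.var .len) (h1 : σ'.var .hlen = σ.var .hlen)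
    (h2 : σ'.var .scale = σ.var .scale)
    (h3 : σ'.var .off = σ.var .off) (h4 : σ'.var .shift = σ.var .shift) : Globals σ' N P O :=
  ⟨hl.trans h.len, h1.trans h.hlen, h2.trans h.scale, h3.trans h.off, h4.trans h.shift⟩

/-- The bounds `hb` guarantee that the signed products become nonnegative words after adding `O *
P`, so that the unsigned division of the RAM computes the floor. -/
theorem difCode_spec {σ : St} {m st : ℕ} {P O : ℤ} (hg : Globals σ (m * st) P O)
    (hs : Sizes W sz (m * st) P O) (hm : σ.var .m = m) (hst : σ.var .st = st) (hm0 : 0 < m)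
    (hst0 : 0 < st)
    (hb : ∀ x < 2 * (m * st), m ≤ x % (2 * m) →
      |(σ.arr .sigRe (x - m : ℕ) - σ.arr .sigRe x) * σ.arr .twRe (x % m * st : ℕ)
        - (σ.arr .sigIm (x - m : ℕ) - σ.arr .sigIm x) * σ.arr .twIm (x % m * st : ℕ)| < O * P ∧
      |(σ.arr .sigRe (x - m : ℕ) - σ.arr .sigRe x) * σ.arr .twIm (x % m * st : ℕ)
        + (σ.arr .sigIm (x - m : ℕ) - σ.arr .sigIm x) * σ.arr .twRe (x % m * st : ℕ)| < O * P) :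
    Triple W sz difCode σ (m * st * 107 + 3) fun σ' => ∀ x : ℕ, x < 2 * (m * st) →
      σ'.arr .sigRe x = difRe P (σ.arr .sigRe) (σ.arr .sigIm) (σ.arr .twRe) (σ.arr .twIm) m st x ∧
      σ'.arr .sigIm x = difIm P (σ.arr .sigRe) (σ.arr .sigIm) (σ.arr .twRe) (σ.arr .twIm) m st x := by
  have hNW := hs.len
  -- A position holds its new value exactly when its butterfly has been processed.
  refine Triple.forTo (tb := 102) (m := m * st) (fun i σ' => ∀ x : ℕ, x < 2 * (m * st) →
      σ'.arr .sigRe x = (if butterflyIndex m x < i then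
        difRe P (σ.arr .sigRe) (σ.arr .sigIm) (σ.arr .twRe) (σ.arr .twIm) m st x
        else σ.arr .sigRe x) ∧
      σ'.arr .sigIm x = (if butterflyIndex m x < i then
        difIm P (σ.arr .sigRe) (σ.arr .sigIm) (σ.arr .twRe) (σ.arr .twIm) m st x
        else σ.arr .sigIm x))
    hg.hlen (by omega) rfl rfl (by decide) (by simp) ?_ (by omega) ?_
  swap
  · intro σ' h _ _ _ x hx
    have := butterflyIndex_lt (m := m) (r := st) (x := x) (by rwa [mul_assoc])
    simpa [this] using h x hx
  intro i hi σ₁ hinv hi₁ hfv hfa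
  have hmN : m ≤ m * st := Nat.le_mul_of_pos_right m hst0
  have hXY := butterfly_add_lt hi
  rw [mul_assoc] at hXY
  have hbm := butterfly_mod hm0 i
  have hbm' := butterfly_add_mod hm0 i
  have hidx := butterflyIndex_butterfly hm0 i
  set X := butterfly m i with hX
  have hjm := Nat.mod_lt i hm0
  have hzlt : i % m * st < 2 * (m * st) := by nlinarith
  -- The indices are made opaque, so that the range conditions below stay linear.
  obtain ⟨Y, hY⟩ : ∃ Y, Y = X + m := ⟨_, rfl⟩
  obtain ⟨Z, hZ⟩ : ∃ Z, Z = i % m * st := ⟨_, rfl⟩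
  obtain ⟨L, hL⟩ : ∃ L, L = 2 * (m * st) := ⟨_, rfl⟩
  have hx_of : ∀ x, butterflyIndex m x = i → x = X ∨ x = Y := fun x hx => by
    have := butterflyIndex_eq hm0 hx
    split_ifs at this <;> omega
  have hbY := hb (X + m) hXY (by omega)
  rw [Nat.add_sub_cancel, hbm'.2.1, ← hZ] at hbY
  have hdX : difRe P (σ.arr .sigRe) (σ.arr .sigIm) (σ.arr .twRe) (σ.arr .twIm) m st X =
        σ.arr .sigRe X + σ.arr .sigRe Y ∧
      difIm P (σ.arr .sigRe) (σ.arr .sigIm) (σ.arr .twRe) (σ.arr .twIm) m st X =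
        σ.arr .sigIm X + σ.arr .sigIm Y := by
    rw [difRe, difIm, if_pos (by omega), if_pos (by omega), ← hY]; exact ⟨rfl, rfl⟩
  have hdY : difRe P (σ.arr .sigRe) (σ.arr .sigIm) (σ.arr .twRe) (σ.arr .twIm) m st Y =
        ((σ.arr .sigRe X - σ.arr .sigRe Y) * σ.arr .twRe Z
          - (σ.arr .sigIm X - σ.arr .sigIm Y) * σ.arr .twIm Z) / P ∧
      difIm P (σ.arr .sigRe) (σ.arr .sigIm) (σ.arr .twRe) (σ.arr .twIm) m st Y =
        ((σ.arr .sigRe X - σ.arr .sigRe Y) * σ.arr .twIm Z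
          + (σ.arr .sigIm X - σ.arr .sigIm Y) * σ.arr .twRe Z) / P := by
    rw [difRe, difIm, hY, if_neg (by omega), if_neg (by omega), hbm'.2.1, Nat.add_sub_cancel, ← hZ]
    exact ⟨rfl, rfl⟩
  rw [← hY] at hbY hidx hXY
  rw [← hL] at hXY
  rw [← hZ, ← hL] at hzlt
  have hX₁ := hinv X (by omega)
  have hY₁ := hinv Y (by omega)
  rw [hidx.1] at hX₁
  rw [hidx.2] at hY₁
  simp only [lt_irrefl, if_false] at hX₁ hY₁
  have hwr := hfa .twRe rfl
  have hwi := hfa .twIm rfl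
  have hsR := hs.sigRe
  have hsI := hs.sigIm
  have hsr := hs.twRe
  have hsi := hs.twIm
  rw [← hL] at hsR hsI hsr hsi
  have hXne : X ≠ Y := by omega
  refine ((indexCode_spec hi₁ ((hfv .m rfl (by decide)).trans hm)
    ((hfv .st rfl (by decide)).trans hst) hm0 (by omega) (by omega)).seq
    fun σ₂ ⟨hx₂, hy₂, hz₂⟩ hf₂ => ?_ : Triple W sz _ σ₁ (22 + (44 + (28 + 8))) _)
  change σ₂.var .x = (X : ℕ) at hx₂
  change σ₂.var .y = (X + m : ℕ) at hy₂
  rw [← hY] at hy₂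
  rw [← hZ] at hz₂
  have ha₂ : ∀ a, σ₂.arr a = σ₁.arr a := fun a => hf₂.arr a rfl
  refine Triple.seq (P := fun σ₃ =>
    σ₃.var .c = σ.arr .sigRe X - σ.arr .sigRe Y ∧
    σ₃.var .d = σ.arr .sigIm X - σ.arr .sigIm Y ∧
    σ₃.var .a = σ.arr .twRe Z ∧ σ₃.var .b = σ.arr .twIm Z ∧
    (∀ x : ℕ, σ₃.arr .sigRe x =
      if x = X then σ.arr .sigRe X + σ.arr .sigRe Y else σ₁.arr .sigRe x) ∧
    (∀ x : ℕ, σ₃.arr .sigIm x =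
      if x = X then σ.arr .sigIm X + σ.arr .sigIm Y else σ₁.arr .sigIm x))
    (Triple.of_wp ?_ (by decide)) fun σ₃ ⟨hc₃, hd₃, ha₃, hb₃, hre₃, him₃⟩ hf₃ => ?_
  · simp [hx₂, hy₂, hz₂, ha₂, hX₁, hY₁, hwr, hwi, hsR, hsI, hsr, hsi]
    omega
  refine (mulCode_spec ha₃ hb₃ hc₃ hd₃ ?_ ?_ ?_ hs.pos hs.lt hs.shift hbY.1 hbY.2).seq
    fun σ₄ ⟨hu₄, hv₄⟩ hf₄ => ?_
  · rw [hf₃.var .scale rfl, hf₂.var .scale rfl, hfv .scale rfl (by decide), hg.scale]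
  · rw [hf₃.var .off rfl, hf₂.var .off rfl, hfv .off rfl (by decide), hg.off]
  · rw [hf₃.var .shift rfl, hf₂.var .shift rfl, hfv .shift rfl (by decide), hg.shift]
  have hy₄ : σ₄.var .y = (Y : ℕ) := by rw [hf₄.var .y rfl, hf₃.var .y rfl, hy₂]
  refine Triple.of_wp ?_ (by decide)
  simp [hy₄, hu₄, hv₄, hsR, hsI, hf₄.arr .sigRe rfl, hf₄.arr .sigIm rfl, hre₃, him₃]
  refine ⟨hXY, fun x hx => ?_⟩
  have h1 := hinv x hx
  by_cases hxY : x = Y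
  · subst hxY; simp [hdY, hidx]
  by_cases hxX : x = X
  · subst hxX; simp [hdX, hidx, hxY]
  have h2 : butterflyIndex m x ≠ i := fun h => (hx_of x h).elim hxX hxY
  have h3 : butterflyIndex m x ≤ i ↔ butterflyIndex m x < i := by omega
  simp only [hxX, hxY, h1, h3, if_false, and_self]

/-- The inverse transform reuses the forward twiddle table: inverses of numbers of modulus 1 are
conjugates, whence the negated imaginary parts. -/
theorem ditCode_spec {σ : St} {m st : ℕ} {P O : ℤ} (hg : Globals σ (m * st) P O)
    (hs : Sizes W sz (m * st) P O) (hm : σ.var .m = m) (hst : σ.var .st = st) (hm0 : 0 < m)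
    (hst0 : 0 < st)
    (hb : ∀ x < 2 * (m * st), m ≤ x % (2 * m) →
      |σ.arr .sigRe x * σ.arr .twRe (x % m * st : ℕ)
        - σ.arr .sigIm x * -σ.arr .twIm (x % m * st : ℕ)| < O * P ∧
      |σ.arr .sigRe x * -σ.arr .twIm (x % m * st : ℕ)
        + σ.arr .sigIm x * σ.arr .twRe (x % m * st : ℕ)| < O * P) :
    Triple W sz ditCode σ (m * st * 105 + 3) fun σ' => ∀ x : ℕ, x < 2 * (m * st) →
      σ'.arr .sigRe x = ditRe P (σ.arr .sigRe) (σ.arr .sigIm) (σ.arr .twRe) (σ.arr .twIm) m st x ∧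
      σ'.arr .sigIm x = ditIm P (σ.arr .sigRe) (σ.arr .sigIm) (σ.arr .twRe) (σ.arr .twIm) m st x := by
  have hNW := hs.len
  refine Triple.forTo (tb := 100) (m := m * st) (fun i σ' => ∀ x : ℕ, x < 2 * (m * st) →
      σ'.arr .sigRe x = (if butterflyIndex m x < i then
        ditRe P (σ.arr .sigRe) (σ.arr .sigIm) (σ.arr .twRe) (σ.arr .twIm) m st x
        else σ.arr .sigRe x) ∧
      σ'.arr .sigIm x = (if butterflyIndex m x < i then
        ditIm P (σ.arr .sigRe) (σ.arr .sigIm) (σ.arr .twRe) (σ.arr .twIm) m st x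
        else σ.arr .sigIm x))
    hg.hlen (by omega) rfl rfl (by decide) (by simp) ?_ (by omega) ?_
  swap
  · intro σ' h _ _ _ x hx
    have := butterflyIndex_lt (m := m) (r := st) (x := x) (by rwa [mul_assoc])
    simpa [this] using h x hx
  intro i hi σ₁ hinv hi₁ hfv hfa
  have hmN : m ≤ m * st := Nat.le_mul_of_pos_right m hst0
  have hXY := butterfly_add_lt hi
  rw [mul_assoc] at hXY
  have hbm := butterfly_mod hm0 i
  have hbm' := butterfly_add_mod hm0 i
  have hidx := butterflyIndex_butterfly hm0 i
  set X := butterfly m i with hX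
  have hjm := Nat.mod_lt i hm0
  have hzlt : i % m * st < 2 * (m * st) := by nlinarith
  obtain ⟨Y, hY⟩ : ∃ Y, Y = X + m := ⟨_, rfl⟩
  obtain ⟨Z, hZ⟩ : ∃ Z, Z = i % m * st := ⟨_, rfl⟩
  obtain ⟨L, hL⟩ : ∃ L, L = 2 * (m * st) := ⟨_, rfl⟩
  have hx_of : ∀ x, butterflyIndex m x = i → x = X ∨ x = Y := fun x hx => by
    have := butterflyIndex_eq hm0 hx
    split_ifs at this <;> omega
  have hbY := hb (X + m) hXY (by omega)
  rw [hbm'.2.1, ← hZ] at hbY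
  have hdX : ditRe P (σ.arr .sigRe) (σ.arr .sigIm) (σ.arr .twRe) (σ.arr .twIm) m st X =
        σ.arr .sigRe X + (σ.arr .sigRe Y * σ.arr .twRe Z - σ.arr .sigIm Y * -σ.arr .twIm Z) / P ∧
      ditIm P (σ.arr .sigRe) (σ.arr .sigIm) (σ.arr .twRe) (σ.arr .twIm) m st X =
        σ.arr .sigIm X + (σ.arr .sigRe Y * -σ.arr .twIm Z + σ.arr .sigIm Y * σ.arr .twRe Z) / P := by
    rw [ditRe, ditIm, if_pos (by omega), if_pos (by omega), ← hY, hbm.2.1, ← hZ]; exact ⟨rfl, rfl⟩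
  have hdY : ditRe P (σ.arr .sigRe) (σ.arr .sigIm) (σ.arr .twRe) (σ.arr .twIm) m st Y =
        σ.arr .sigRe X - (σ.arr .sigRe Y * σ.arr .twRe Z - σ.arr .sigIm Y * -σ.arr .twIm Z) / P ∧
      ditIm P (σ.arr .sigRe) (σ.arr .sigIm) (σ.arr .twRe) (σ.arr .twIm) m st Y =
        σ.arr .sigIm X - (σ.arr .sigRe Y * -σ.arr .twIm Z + σ.arr .sigIm Y * σ.arr .twRe Z) / P := by
    rw [ditRe, ditIm, hY, if_neg (by omega), if_neg (by omega), hbm'.2.1, Nat.add_sub_cancel, ← hZ]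
    exact ⟨rfl, rfl⟩
  rw [← hY] at hbY hidx hXY
  rw [← hL] at hXY
  rw [← hZ, ← hL] at hzlt
  have hX₁ := hinv X (by omega)
  have hY₁ := hinv Y (by omega)
  rw [hidx.1] at hX₁
  rw [hidx.2] at hY₁
  simp only [lt_irrefl, if_false] at hX₁ hY₁
  have hwr := hfa .twRe rfl
  have hwi := hfa .twIm rfl
  have hsR := hs.sigRe
  have hsI := hs.sigIm
  have hsr := hs.twRe
  have hsi := hs.twIm
  rw [← hL] at hsR hsI hsr hsi
  have hXne : X ≠ Y := by omega
  refine ((indexCode_spec hi₁ ((hfv .m rfl (by decide)).trans hm)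
    ((hfv .st rfl (by decide)).trans hst) hm0 (by omega) (by omega)).seq
    fun σ₂ ⟨hx₂, hy₂, hz₂⟩ hf₂ => ?_ : Triple W sz _ σ₁ (22 + (18 + (28 + 32))) _)
  change σ₂.var .x = (X : ℕ) at hx₂
  change σ₂.var .y = (X + m : ℕ) at hy₂
  rw [← hY] at hy₂
  rw [← hZ] at hz₂
  have ha₂ : ∀ a, σ₂.arr a = σ₁.arr a := fun a => hf₂.arr a rfl
  refine Triple.seq (P := fun σ₃ => σ₃.var .c = σ.arr .sigRe Y ∧ σ₃.var .d = σ.arr .sigIm Y ∧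
    σ₃.var .a = σ.arr .twRe Z ∧ σ₃.var .b = -σ.arr .twIm Z)
    (Triple.of_wp ?_ (by decide)) fun σ₃ ⟨hc₃, hd₃, ha₃, hb₃⟩ hf₃ => ?_
  · simp [hy₂, hz₂, ha₂, hY₁, hwr, hwi, hsR, hsI, hsr, hsi]
    omega
  refine (mulCode_spec ha₃ hb₃ hc₃ hd₃ ?_ ?_ ?_ hs.pos hs.lt hs.shift hbY.1 hbY.2).seq
    fun σ₄ ⟨hu₄, hv₄⟩ hf₄ => ?_
  · rw [hf₃.var .scale rfl, hf₂.var .scale rfl, hfv .scale rfl (by decide), hg.scale]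
  · rw [hf₃.var .off rfl, hf₂.var .off rfl, hfv .off rfl (by decide), hg.off]
  · rw [hf₃.var .shift rfl, hf₂.var .shift rfl, hfv .shift rfl (by decide), hg.shift]
  have hy₄ : σ₄.var .y = (Y : ℕ) := by rw [hf₄.var .y rfl, hf₃.var .y rfl, hy₂]
  have hx₄ : σ₄.var .x = (X : ℕ) := by rw [hf₄.var .x rfl, hf₃.var .x rfl, hx₂]
  have hr₄ : σ₄.arr .sigRe = σ₁.arr .sigRe := by rw [hf₄.arr .sigRe rfl, hf₃.arr .sigRe rfl, ha₂]
  have hi₄ : σ₄.arr .sigIm = σ₁.arr .sigIm := by rw [hf₄.arr .sigIm rfl, hf₃.arr .sigIm rfl, ha₂]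
  refine Triple.of_wp ?_ (by decide)
  simp [hx₄, hy₄, hu₄, hv₄, hsR, hsI, hr₄, hi₄, hX₁, hXne]
  refine ⟨by omega, hXY, by omega, hXY, by omega, fun x hx => ?_⟩
  have h1 := hinv x hx
  by_cases hxY : x = Y
  · subst hxY; simp [hdY, hidx, hXne.symm]
  by_cases hxX : x = X
  · subst hxX; simp [hdX, hidx]
  have h2 : butterflyIndex m x ≠ i := fun h => (hx_of x h).elim hxX hxY
  have h3 : butterflyIndex m x ≤ i ↔ butterflyIndex m x < i := by omega
  simp only [hxX, hxY, h1, h3, if_false, and_self]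

end ArrayLang

/-! ### Error propagation through the transforms -/

namespace ArrayLang

open Stmt Finset FFT

variable {W : ℕ} {sz : Arr → ℕ}

section Approximation

variable {P O : ℤ} {re im wr wi : ℤ → ℤ} {ω : ℂ} {f : ℕ → ℂ} {E Z τ : ℝ} {k j m st x : ℕ}

theorem norm_pow_root (hω : ‖ω‖ = 1) (e : ℕ) : ‖ω ^ e‖ = 1 := by rw [norm_pow, hω, one_pow]

/-- Products of representatives of bounded numbers by twiddle factors are bounded. -/
theorem abs_products_lt {a b c d : ℤ} {z w : ℂ} (hP : 0 < P) (hτP : τ ≤ P)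
    (h : Approx P c d z (2 * E)) (hz : ‖z‖ ≤ 2 * Z) (h' : Approx P a b w τ) (hw : ‖w‖ = 1)
    (hO : 8 * (P * Z + E) < O) :
    |c * a - d * b| < O * P ∧ |c * b + d * a| < O * P := by
  have hPr : (0 : ℝ) < P := by exact_mod_cast hP
  have key : ‖(⟨c, d⟩ : ℂ) * ⟨a, b⟩‖ < O * P := by
    rw [norm_mul]
    have h1 := h.norm_le hPr.le
    have h2 := h'.norm_le hPr.le
    rw [hw, mul_one] at h2
    have h3 : ‖(⟨c, d⟩ : ℂ)‖ ≤ 2 * (P * Z + E) := by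
      have := mul_le_mul_of_nonneg_left hz hPr.le
      linarith
    have h4 : ‖(⟨a, b⟩ : ℂ)‖ ≤ 2 * P := by linarith
    calc _ ≤ 2 * (P * Z + E) * (2 * P) :=
          mul_le_mul h3 h4 (norm_nonneg _) ((norm_nonneg _).trans h3)
      _ < O * P := by
          have h5 : 0 ≤ 2 * (P * Z + E) := (norm_nonneg _).trans h3
          nlinarith
  constructor
  · have := (Complex.abs_re_le_norm _).trans_lt key
    simp only [Complex.mul_re] at this
    exact_mod_cast this
  · have := (Complex.abs_im_le_norm _).trans_lt key
    simp only [Complex.mul_im] at this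
    exact_mod_cast this

/-- The stored twiddle factor has modulus at most `1 + τ / P ≤ 2`, which doubles the error `2 * E`
of the difference. -/
theorem butterfly_error (hP : 0 < P) (hτP : τ ≤ P) {a b c d : ℤ} {z w : ℂ}
    (h : Approx P c d z (2 * E)) (hz : ‖z‖ ≤ 2 * Z) (h' : Approx P a b w τ) (hw : ‖w‖ = 1) :
    Approx P ((c * a - d * b) / P) ((c * b + d * a) / P) (z * w) (4 * E + (2 * Z * τ + 2)) := by
  have hPr : (0 : ℝ) < P := by exact_mod_cast hP
  refine (h.mul rfl hP h').mono ?_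
  have h1 : τ / P ≤ 1 := (div_le_one hPr).2 hτP
  have h2 := mul_le_mul_of_nonneg_left h1 h.nonneg
  have h3 := mul_le_mul_of_nonneg_right hz h'.nonneg
  rw [hw]
  nlinarith

theorem approxOn_difStage (hP : 0 < P) (hτP : τ ≤ P) (hω : ‖ω‖ = 1) (hj : j < k)
    (hw : ApproxOn P (2 ^ k) wr wi (fun z => ω ^ z) τ) (hst : 2 ^ j * st ≤ 2 ^ k)
    (hf : ApproxOn P (2 ^ k) re im f E) (hZ : ∀ x < 2 ^ k, ‖f x‖ ≤ Z) (hx : x < 2 ^ k) :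
    Approx P (difRe P re im wr wi (2 ^ j) st x) (difIm P re im wr wi (2 ^ j) st x)
      (difStage ω st (2 ^ j) f x) (4 * E + (2 * Z * τ + 2)) := by
  have hτ := (hw x hx).nonneg
  have hZ0 : 0 ≤ Z := (norm_nonneg _).trans (hZ x hx)
  have hE := (hf x hx).nonneg
  simp only [difRe, difIm, difStage]
  split_ifs with h
  · exact ((hf x hx).add (hf _ (half_index hj hx h))).mono (by nlinarith)
  · have hlt : x - 2 ^ j < 2 ^ k := (Nat.sub_le _ _).trans_lt hx
    have hz : x % 2 ^ j * st < 2 ^ k := by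
      rcases Nat.eq_zero_or_pos st with rfl | hpos
      · simp
      · exact (Nat.mul_lt_mul_of_pos_right (Nat.mod_lt x (by positivity)) hpos).trans_le hst
    refine butterfly_error hP hτP (((hf _ hlt).sub (hf x hx)).mono (by linarith))
      ((norm_sub_le _ _).trans ?_) (hw _ hz) (norm_pow_root hω _)
    linarith [hZ _ hlt, hZ x hx]

theorem dif_products (hP : 0 < P) (hτP : τ ≤ P) (hω : ‖ω‖ = 1)
    (hw : ApproxOn P (2 ^ k) wr wi (fun z => ω ^ z) τ) (hst : 2 ^ j * st ≤ 2 ^ k)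
    (hf : ApproxOn P (2 ^ k) re im f E) (hZ : ∀ x < 2 ^ k, ‖f x‖ ≤ Z) (hO : 8 * (P * Z + E) < O)
    (hx : x < 2 ^ k) :
    |(re (x - 2 ^ j : ℕ) - re x) * wr (x % 2 ^ j * st : ℕ)
      - (im (x - 2 ^ j : ℕ) - im x) * wi (x % 2 ^ j * st : ℕ)| < O * P ∧
    |(re (x - 2 ^ j : ℕ) - re x) * wi (x % 2 ^ j * st : ℕ)
      + (im (x - 2 ^ j : ℕ) - im x) * wr (x % 2 ^ j * st : ℕ)| < O * P := by
  have hlt : x - 2 ^ j < 2 ^ k := (Nat.sub_le _ _).trans_lt hx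
  have hz : x % 2 ^ j * st < 2 ^ k := by
    rcases Nat.eq_zero_or_pos st with rfl | hpos
    · simp
    · exact (Nat.mul_lt_mul_of_pos_right (Nat.mod_lt x (by positivity)) hpos).trans_le hst
  refine abs_products_lt hP hτP (((hf _ hlt).sub (hf x hx)).mono (by linarith))
    ((norm_sub_le _ _).trans ?_) (hw _ hz) (norm_pow_root hω _) hO
  linarith [hZ _ hlt, hZ x hx]

theorem approxOn_ditStage (hP : 0 < P) (hτP : τ ≤ P) (hω : ‖ω‖ = 1) (hj : j < k)
    (hw : ApproxOn P (2 ^ k) wr wi (fun z => ω ^ z) τ) (hst : 2 ^ j * st ≤ 2 ^ k)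
    (hf : ApproxOn P (2 ^ k) re im f E) (hZ : ∀ x < 2 ^ k, ‖f x‖ ≤ Z) (hx : x < 2 ^ k) :
    Approx P (ditRe P re im wr wi (2 ^ j) st x) (ditIm P re im wr wi (2 ^ j) st x)
      (ditStage (starRingEnd ℂ ω) st (2 ^ j) f x) (4 * E + (2 * Z * τ + 2)) := by
  have hPr : (0 : ℝ) < P := by exact_mod_cast hP
  have hz : x % 2 ^ j * st < 2 ^ k := by
    rcases Nat.eq_zero_or_pos st with rfl | hpos
    · simp
    · exact (Nat.mul_lt_mul_of_pos_right (Nat.mod_lt x (by positivity)) hpos).trans_le hst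
  have hw' := (hw _ hz).conj
  have hτ := hw'.nonneg
  have hZ0 : 0 ≤ Z := (norm_nonneg _).trans (hZ x hx)
  have hE := (hf x hx).nonneg
  simp only [map_pow] at hw'
  have hmul : ∀ y : ℕ, y < 2 ^ k → Approx P ((re y * wr (x % 2 ^ j * st : ℕ) - im y * -wi (x % 2 ^ j * st : ℕ)) / P)
      ((re y * -wi (x % 2 ^ j * st : ℕ) + im y * wr (x % 2 ^ j * st : ℕ)) / P)
      (f y * starRingEnd ℂ ω ^ (x % 2 ^ j * st)) (2 * E + (Z * τ + 2)) := by
    intro y hy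
    refine ((hf y hy).mul rfl hP hw').mono ?_
    have h1 : τ / P ≤ 1 := (div_le_one hPr).2 hτP
    have h2 := mul_le_mul_of_nonneg_left h1 hE
    have h3 := mul_le_mul_of_nonneg_right (hZ y hy) hτ
    rw [norm_pow, RCLike.norm_conj, hω, one_pow]
    linarith
  simp only [ditRe, ditIm, ditStage]
  split_ifs with h
  · exact ((hf x hx).add (hmul _ (half_index hj hx h))).mono (by nlinarith)
  · exact ((hf _ ((Nat.sub_le _ _).trans_lt hx)).sub (hmul x hx)).mono (by nlinarith)

theorem dit_products (hP : 0 < P) (hτP : τ ≤ P) (hω : ‖ω‖ = 1)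
    (hw : ApproxOn P (2 ^ k) wr wi (fun z => ω ^ z) τ) (hst : 2 ^ j * st ≤ 2 ^ k)
    (hf : ApproxOn P (2 ^ k) re im f E) (hZ : ∀ x < 2 ^ k, ‖f x‖ ≤ Z) (hO : 8 * (P * Z + E) < O)
    (hx : x < 2 ^ k) :
    |re x * wr (x % 2 ^ j * st : ℕ) - im x * -wi (x % 2 ^ j * st : ℕ)| < O * P ∧
    |re x * -wi (x % 2 ^ j * st : ℕ) + im x * wr (x % 2 ^ j * st : ℕ)| < O * P := by
  have hz : x % 2 ^ j * st < 2 ^ k := by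
    rcases Nat.eq_zero_or_pos st with rfl | hpos
    · simp
    · exact (Nat.mul_lt_mul_of_pos_right (Nat.mod_lt x (by positivity)) hpos).trans_le hst
  have hE := (hf x hx).nonneg
  have hw' := (hw _ hz).conj
  simp only [map_pow] at hw'
  refine abs_products_lt hP hτP ((hf x hx).mono (by linarith)) ((hZ x hx).trans ?_) hw' ?_ hO
  · linarith [(norm_nonneg _).trans (hZ x hx)]
  · rw [norm_pow, RCLike.norm_conj, hω, one_pow]

end Approximation

section

open Var

/-- The forward transform of the signal. -/
def forwardCode : Stmt :=
  (assign m hlen ;; assign st 1) ;;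
  forTo l lg (difCode ;; assign m (m / 2) ;; assign st (2 * st))

/-- The inverse transform of the signal, up to the factor `2 ^ k`. -/
def backwardCode : Stmt :=
  (assign m 1 ;; assign st hlen) ;;
  forTo l lg (ditCode ;; assign m (2 * m) ;; assign st (st / 2))

end

/-- The error after `l` stages. -/
noncomputable def stageError (E Y : ℝ) (l : ℕ) : ℝ := 4 ^ l * (E + Y) - Y

/-- A stage turns an error `e` into at most `4 * e + Y`; the closed form is a supersolution of this
recursion that starts at `E`. -/
theorem stageError_succ (E Y : ℝ) (hY : 0 ≤ Y) (l : ℕ) :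
    4 * stageError E Y l + Y ≤ stageError E Y (l + 1) := by
  simp only [stageError, pow_succ]; linarith

theorem stageError_le {E Y : ℝ} (hE : 0 ≤ E) (hY : 0 ≤ Y) {l k : ℕ} (h : l ≤ k) :
    stageError E Y l ≤ 4 ^ k * (E + Y) := by
  have : (4 : ℝ) ^ l ≤ 4 ^ k := pow_le_pow_right₀ (by norm_num) h
  have := mul_le_mul_of_nonneg_right this (add_nonneg hE hY)
  simp only [stageError]; linarith

theorem forwardCode_spec {σ : St} {k : ℕ} {P O : ℤ} {ω : ℂ} {f : ℕ → ℂ} {E Z₀ τ : ℝ} (hk : 1 ≤ k)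
    (hg : Globals σ (2 ^ (k - 1)) P O) (hs : Sizes W sz (2 ^ (k - 1)) P O)
    (hlg : σ.var .lg = k) (hτP : τ ≤ P) (hω : ‖ω‖ = 1)
    (hw : ApproxOn P (2 ^ k) (σ.arr .twRe) (σ.arr .twIm) (fun z => ω ^ z) τ)
    (hf : ApproxOn P (2 ^ k) (σ.arr .sigRe) (σ.arr .sigIm) f E) (hZ : ∀ x < 2 ^ k, ‖f x‖ ≤ Z₀)
    (hO : 8 * (P * (2 ^ k * Z₀) + 4 ^ k * (E + (2 * (2 ^ k * Z₀) * τ + 2))) < O) :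
    Triple W sz forwardCode σ (k * (2 ^ (k - 1) * 107 + 20) + 10) fun σ' =>
      ApproxOn P (2 ^ k) (σ'.arr .sigRe) (σ'.arr .sigIm) (forward ω k f k)
        (4 ^ k * (E + (2 * (2 ^ k * Z₀) * τ + 2))) := by
  have h2k : 2 ^ k = 2 * 2 ^ (k - 1) := by rw [← pow_succ']; congr 1; omega
  have hτ := (hw 0 (by positivity)).nonneg
  have hE := (hf 0 (by positivity)).nonneg
  have hZ0 : 0 ≤ Z₀ := (norm_nonneg _).trans (hZ 0 (by positivity))
  set Y : ℝ := 2 * (2 ^ k * Z₀) * τ + 2 with hY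
  have hY0 : 0 ≤ Y := by positivity
  have hkW : k < W := by have := hs.len; have := Nat.lt_two_pow_self (n := k); omega
  have hpos := hs.pos
  refine (Triple.seq (t₁ := 4) (t₂ := k * (2 ^ (k - 1) * 107 + 20) + 3)
    (P := fun σ' => σ'.var .m = (2 ^ (k - 1) : ℕ) ∧ σ'.var .st = 1)
    (Triple.of_wp (by simp [hg.hlen])) fun σ₁ ⟨hm₁, hst₁⟩ hf₁ => ?_).mono (by omega) fun _ h _ => h
  -- The guard `l < k` matters: after the last stage the program has halved `m` to `0`, whereas the
  -- truncated exponent would give `1`.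
  refine Triple.forTo (m := k) (tb := 2 ^ (k - 1) * 107 + 15) (fun l σ' =>
    (l < k → σ'.var .m = (2 ^ (k - 1 - l) : ℕ)) ∧ σ'.var .st = (2 ^ l : ℕ) ∧
    ApproxOn P (2 ^ k) (σ'.arr .sigRe) (σ'.arr .sigIm) (forward ω k f l) (stageError E Y l))
    ((hf₁.var _ rfl).trans hlg) hkW rfl rfl (by decide) ?_ ?_ (by nlinarith) ?_
  · refine ⟨fun _ => by simpa using hm₁, by simpa using hst₁, ?_⟩
    simp only [St.set_arr, hf₁.arr .sigRe rfl, hf₁.arr .sigIm rfl]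
    simpa [forward, stageError] using hf
  · intro l hl σ₂ ⟨hm₂, hst₂, hap⟩ _ hfv hfa
    have hm₂ := hm₂ hl
    have hprod : 2 ^ (k - 1 - l) * 2 ^ l = 2 ^ (k - 1) := by rw [← pow_add]; congr 1; omega
    have hprod' : 2 ^ (k - 1 - l) * 2 ^ l ≤ 2 ^ k := by omega
    have hg₂ : Globals σ₂ (2 ^ (k - 1 - l) * 2 ^ l) P O := by
      rw [hprod]
      exact hg.of_eq ((hfv .len rfl (by decide)).trans (hf₁.var _ rfl))
        ((hfv .hlen rfl (by decide)).trans (hf₁.var _ rfl))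
        ((hfv .scale rfl (by decide)).trans (hf₁.var _ rfl))
        ((hfv .off rfl (by decide)).trans (hf₁.var _ rfl))
        ((hfv .shift rfl (by decide)).trans (hf₁.var _ rfl))
    have hw₂ : ApproxOn P (2 ^ k) (σ₂.arr .twRe) (σ₂.arr .twIm) (fun z => ω ^ z) τ := by
      rw [hfa .twRe rfl, hfa .twIm rfl, hf₁.arr .twRe rfl, hf₁.arr .twIm rfl]; exact hw
    have hZl : ∀ x < 2 ^ k, ‖forward ω k f l x‖ ≤ 2 ^ k * Z₀ := fun x hx =>
      (norm_forward_le hω hZ hl.le hx).trans (mul_le_mul_of_nonneg_right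
        (pow_le_pow_right₀ (by norm_num) hl.le) hZ0)
    have hOl : 8 * (P * (2 ^ k * Z₀) + stageError E Y l) < O :=
      lt_of_le_of_lt (by linarith [stageError_le hE hY0 hl.le]) hO
    refine (Triple.seq (t₁ := 2 ^ (k - 1) * 107 + 3) (t₂ := 8) ((difCode_spec hg₂ (by rwa [hprod])
      hm₂ hst₂ (by positivity) (by positivity) ?_).mono (by rw [hprod]) fun _ h _ => h)
      fun σ₃ hσ₃ hf₃ => ?_).mono (by omega) fun _ h _ => h
    · intro x hx _
      rw [hprod, ← h2k] at hx
      exact dif_products hpos hτP hω hw₂ hprod' hap hZl hOl hx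
    · refine Triple.of_wp ?_ (by decide)
      have h3m : σ₃.var .m = (2 ^ (k - 1 - l) : ℕ) := by rw [hf₃.var .m rfl, hm₂]
      have h3s : σ₃.var .st = (2 ^ l : ℕ) := by rw [hf₃.var .st rfl, hst₂]
      have hmlt : 2 ^ (k - 1 - l) < W := by
        have : 2 ^ (k - 1 - l) ≤ 2 ^ (k - 1) := Nat.pow_le_pow_right (by omega) (by omega)
        have := hs.len
        omega
      have h2W : 2 < W := by
        have := hs.len
        have : 1 ≤ 2 ^ (k - 1) := Nat.one_le_two_pow
        omega
      simp [h3m, h3s]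
      refine ⟨⟨by exact_mod_cast hmlt, by exact_mod_cast h2W⟩, fun hl1 => ?_, by ring, fun x hx => ?_⟩
      · rw [show k - 1 - l = k - 1 - (l + 1) + 1 by omega, pow_succ]; simp
      · obtain ⟨h1, h2⟩ := hσ₃ x (by rw [hprod, ← h2k]; exact hx)
        rw [h1, h2]
        exact (approxOn_difStage hpos hτP hω (by omega) hw₂ hprod' hap hZl hx).mono
          (stageError_succ E Y hY0 l)
  · intro σ₂ h _ _ _ x hx
    exact (h.2.2 x hx).mono (stageError_le hE hY0 le_rfl)

theorem backwardCode_spec {σ : St} {k : ℕ} {P O : ℤ} {ω : ℂ} {f : ℕ → ℂ} {E Z₀ τ : ℝ} (hk : 1 ≤ k)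
    (hg : Globals σ (2 ^ (k - 1)) P O) (hs : Sizes W sz (2 ^ (k - 1)) P O)
    (hlg : σ.var .lg = k) (hτP : τ ≤ P) (hω : ‖ω‖ = 1)
    (hw : ApproxOn P (2 ^ k) (σ.arr .twRe) (σ.arr .twIm) (fun z => ω ^ z) τ)
    (hf : ApproxOn P (2 ^ k) (σ.arr .sigRe) (σ.arr .sigIm) f E) (hZ : ∀ x < 2 ^ k, ‖f x‖ ≤ Z₀)
    (hO : 8 * (P * (2 ^ k * Z₀) + 4 ^ k * (E + (2 * (2 ^ k * Z₀) * τ + 2))) < O) :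
    Triple W sz backwardCode σ (k * (2 ^ (k - 1) * 105 + 20) + 10) fun σ' =>
      ApproxOn P (2 ^ k) (σ'.arr .sigRe) (σ'.arr .sigIm) (backward (starRingEnd ℂ ω) k f k)
        (4 ^ k * (E + (2 * (2 ^ k * Z₀) * τ + 2))) := by
  have h2k : 2 ^ k = 2 * 2 ^ (k - 1) := by rw [← pow_succ']; congr 1; omega
  have hτ := (hw 0 (by positivity)).nonneg
  have hE := (hf 0 (by positivity)).nonneg
  have hZ0 : 0 ≤ Z₀ := (norm_nonneg _).trans (hZ 0 (by positivity))
  set Y : ℝ := 2 * (2 ^ k * Z₀) * τ + 2 with hY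
  have hY0 : 0 ≤ Y := by positivity
  have hkW : k < W := by have := hs.len; have := Nat.lt_two_pow_self (n := k); omega
  have hpos := hs.pos
  refine (Triple.seq (t₁ := 4) (t₂ := k * (2 ^ (k - 1) * 105 + 20) + 3)
    (P := fun σ' => σ'.var .m = 1 ∧ σ'.var .st = (2 ^ (k - 1) : ℕ))
    (Triple.of_wp (by simp [hg.hlen])) fun σ₁ ⟨hm₁, hst₁⟩ hf₁ => ?_).mono (by omega) fun _ h _ => h
  -- Here the stride is halved, so the guard is on `st`.
  refine Triple.forTo (m := k) (tb := 2 ^ (k - 1) * 105 + 15) (fun l σ' =>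
    (l < k → σ'.var .st = (2 ^ (k - 1 - l) : ℕ)) ∧ σ'.var .m = (2 ^ l : ℕ) ∧
    ApproxOn P (2 ^ k) (σ'.arr .sigRe) (σ'.arr .sigIm) (backward (starRingEnd ℂ ω) k f l) (stageError E Y l))
    ((hf₁.var _ rfl).trans hlg) hkW rfl rfl (by decide) ?_ ?_ (by nlinarith) ?_
  · refine ⟨fun _ => by simpa using hst₁, by simpa using hm₁, ?_⟩
    simp only [St.set_arr, hf₁.arr .sigRe rfl, hf₁.arr .sigIm rfl]
    simpa [backward, stageError] using hf
  · intro l hl σ₂ ⟨hst₂, hm₂, hap⟩ _ hfv hfa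
    have hst₂ := hst₂ hl
    have hprod : 2 ^ l * 2 ^ (k - 1 - l) = 2 ^ (k - 1) := by rw [← pow_add]; congr 1; omega
    have hprod' : 2 ^ l * 2 ^ (k - 1 - l) ≤ 2 ^ k := by omega
    have hg₂ : Globals σ₂ (2 ^ l * 2 ^ (k - 1 - l)) P O := by
      rw [hprod]
      exact hg.of_eq ((hfv .len rfl (by decide)).trans (hf₁.var _ rfl))
        ((hfv .hlen rfl (by decide)).trans (hf₁.var _ rfl))
        ((hfv .scale rfl (by decide)).trans (hf₁.var _ rfl))
        ((hfv .off rfl (by decide)).trans (hf₁.var _ rfl))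
        ((hfv .shift rfl (by decide)).trans (hf₁.var _ rfl))
    have hw₂ : ApproxOn P (2 ^ k) (σ₂.arr .twRe) (σ₂.arr .twIm) (fun z => ω ^ z) τ := by
      rw [hfa .twRe rfl, hfa .twIm rfl, hf₁.arr .twRe rfl, hf₁.arr .twIm rfl]; exact hw
    have hZl : ∀ x < 2 ^ k, ‖backward (starRingEnd ℂ ω) k f l x‖ ≤ 2 ^ k * Z₀ := fun x hx =>
      (norm_backward_le (ω := starRingEnd ℂ ω) (by rwa [RCLike.norm_conj]) hZ hl.le hx).trans (mul_le_mul_of_nonneg_right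
        (pow_le_pow_right₀ (by norm_num) hl.le) hZ0)
    have hOl : 8 * (P * (2 ^ k * Z₀) + stageError E Y l) < O :=
      lt_of_le_of_lt (by linarith [stageError_le hE hY0 hl.le]) hO
    refine (Triple.seq (t₁ := 2 ^ (k - 1) * 105 + 3) (t₂ := 8) ((ditCode_spec hg₂ (by rwa [hprod])
      hm₂ hst₂ (by positivity) (by positivity) ?_).mono (by rw [hprod]) fun _ h _ => h)
      fun σ₃ hσ₃ hf₃ => ?_).mono (by omega) fun _ h _ => h
    · intro x hx _
      rw [hprod, ← h2k] at hx
      exact dit_products hpos hτP hω hw₂ hprod' hap hZl hOl hx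
    · refine Triple.of_wp ?_ (by decide)
      have h3m : σ₃.var .m = (2 ^ l : ℕ) := by rw [hf₃.var .m rfl, hm₂]
      have h3s : σ₃.var .st = (2 ^ (k - 1 - l) : ℕ) := by rw [hf₃.var .st rfl, hst₂]
      have hmlt : 2 ^ (k - 1 - l) < W := by
        have : 2 ^ (k - 1 - l) ≤ 2 ^ (k - 1) := Nat.pow_le_pow_right (by omega) (by omega)
        have := hs.len
        omega
      have h2W : 2 < W := by
        have := hs.len
        have : 1 ≤ 2 ^ (k - 1) := Nat.one_le_two_pow
        omega
      simp [h3m, h3s]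
      refine ⟨⟨by exact_mod_cast hmlt, by exact_mod_cast h2W⟩, fun hl1 => ?_, by ring, fun x hx => ?_⟩
      · rw [show k - 1 - l = k - 1 - (l + 1) + 1 by omega, pow_succ]; simp
      · obtain ⟨h1, h2⟩ := hσ₃ x (by rw [hprod, ← h2k]; exact hx)
        rw [h1, h2]
        exact (approxOn_ditStage hpos hτP hω (by omega) hw₂ hprod' hap hZl hx).mono
          (stageError_succ E Y hY0 l)
  · intro σ₂ h _ _ _ x hx
    exact (h.2.2 x hx).mono (stageError_le hE hY0 le_rfl)

end ArrayLang

/-! ### Convolution with a fixed kernel -/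

namespace ArrayLang

open Stmt Finset FFT

variable {W : ℕ} {sz : Arr → ℕ}

section

open Var

/-- Loads the reversed vector number `j`, multiplied by the factorials. -/
def loadCode : Stmt :=
  forTo i len (.ite (.lt i n)
    (assign x (n - 1 - i) ;;
     put .sigRe i (.get .vec (j * n + x) * .get .fact x % q * scale))
    (put .sigRe i 0) ;; put .sigIm i 0)

/-- Loads the kernel. -/
def loadKernelCode : Stmt :=
  forTo i len (.ite (.lt i n) (put .sigRe i (.get .ker i * scale)) (put .sigRe i 0) ;;
    put .sigIm i 0)

/-- Saves the transform of the kernel. -/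
def saveKernelCode : Stmt :=
  forTo i len (put .kerRe i (.get .sigRe i) ;; put .kerIm i (.get .sigIm i))

/-- Multiplies the transforms of the signal and of the kernel. -/
def pointwiseCode : Stmt :=
  forTo i len ((assign c (.get .sigRe i) ;; assign d (.get .sigIm i) ;;
    assign a (.get .kerRe i) ;; assign b (.get .kerIm i)) ;;
    mulCode ;; put .sigRe i u ;; put .sigIm i v)

/-- Rounds the result and stores it in the vector number `j`. -/
def storeCode : Stmt :=
  forTo i n (put .vec (j * n + i) ((.get .sigRe (n - 1 - i) + half) / total % q))

end

/-- Reversing the vector turns the correlation into a convolution, and the positions from `n` on are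
the zero padding. Reducing modulo `q` before the transform keeps the size of the signal, and thus
the required precision, bounded by `q`. -/
theorem loadCode_spec {σ : St} {n N q j : ℕ} {P : ℤ} {V : ℕ → ℤ} {F : ℕ → ℤ}
    (hlen : σ.var .len = N) (hn : σ.var .n = n) (hq : σ.var .q = q) (hj : σ.var .j = j)
    (hP : σ.var .scale = P) (hN : N < W) (hnN : n ≤ N)
    (hV : ∀ i < n, σ.arr .vec (j * n + i : ℕ) = V i ∧ 0 ≤ V i ∧ V i < q)
    (hF : ∀ i < n, σ.arr .fact i = F i ∧ 0 ≤ F i ∧ F i < q) (hq0 : 0 < q) (hqW : q * q < W)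
    (hsr : sz .sigRe = N) (hsi : sz .sigIm = N) (hsf : sz .fact = n) (hsv : (j + 1) * n ≤ sz .vec) :
    Triple W sz loadCode σ (N * 40 + 3) fun σ' => ∀ x : ℕ, x < N →
      σ'.arr .sigRe x = (if x < n then V (n - 1 - x) * F (n - 1 - x) % q else 0) * P ∧
      σ'.arr .sigIm x = 0 := by
  refine Triple.forTo (tb := 35) (fun i σ' => ∀ x : ℕ, x < i →
      σ'.arr .sigRe x = (if x < n then V (n - 1 - x) * F (n - 1 - x) % q else 0) * P ∧
      σ'.arr .sigIm x = 0) hlen hN rfl rfl (by decide) (by simp) ?_ (by omega)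
    (fun _ h _ _ _ => h)
  intro i hi σ₁ hinv hi₁ hfv hfa
  have hn₁ := (hfv .n rfl (by decide)).trans hn
  have hj₁ := (hfv .j rfl (by decide)).trans hj
  have hq₁ := (hfv .q rfl (by decide)).trans hq
  have hP₁ := (hfv .scale rfl (by decide)).trans hP
  have hv₁ := hfa .vec rfl
  have hf₁ := hfa .fact rfl
  have hnW : (n : ℤ) < W := by exact_mod_cast hnN.trans_lt hN
  have hiW : (i : ℤ) < W := by exact_mod_cast hi.trans hN
  have hqW' : (q : ℤ) < W := by
    have : q ≤ q * q := Nat.le_mul_self q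
    exact_mod_cast this.trans_lt hqW
  have post : ∀ σ₂ : St, σ₂.arr .sigIm = Function.update (σ₁.arr .sigIm) i 0 →
      σ₂.arr .sigRe = Function.update (σ₁.arr .sigRe) i
        ((if i < n then V (n - 1 - i) * F (n - 1 - i) % q else 0) * P) →
      ∀ x : ℕ, x < i + 1 →
      σ₂.arr .sigRe x = (if x < n then V (n - 1 - x) * F (n - 1 - x) % q else 0) * P ∧
      σ₂.arr .sigIm x = 0 := by
    intro σ₂ h1 h2 x hx
    rw [h1, h2]
    rcases eq_or_ne x i with rfl | hxi
    · simp
    · simpa [Function.update_apply, hxi] using hinv x (by omega)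
  refine Triple.of_wp ?_ (by decide)
  by_cases hin : i < n
  · have e : (n : ℤ) - 1 - i = (n - 1 - i : ℕ) := by omega
    have e' : (j : ℤ) * n + (n - 1 - i : ℕ) = (j * n + (n - 1 - i) : ℕ) := by push_cast; rfl
    obtain ⟨hv1, hv2, hv3⟩ := hV (n - 1 - i) (by omega)
    obtain ⟨hf1, hf2, hf3⟩ := hF (n - 1 - i) (by omega)
    have hprod : V (n - 1 - i) * F (n - 1 - i) < W := by
      refine lt_of_le_of_lt (mul_le_mul hv3.le hf3.le hf2 (by positivity)) ?_
      exact_mod_cast hqW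
    have hsz : j * n + (n - 1 - i) < sz .vec := by
      rw [add_mul] at hsv; omega
    have hsz' : ((j * n + (n - 1 - i) : ℕ) : ℤ) < sz .vec := by exact_mod_cast hsz
    have h0 : (0 : ℤ) ≤ (j * n + (n - 1 - i) : ℕ) := Int.natCast_nonneg _
    have h1 : (n - 1 - i : ℕ) < n := by omega
    simp only [Stmt.wp_seq, Stmt.wp_ite, Stmt.wp_assign, Stmt.wp_put, Test.ok_lt, Expr.val_var,
      Expr.ok_var, hi₁, hn₁, Test.holds_lt, Expr.val_zero, Expr.ok_zero]
    refine ⟨⟨trivial, trivial, by omega, by omega⟩, fun _ => ?_, fun h => by omega⟩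
    simp only [hi₁, hn₁, hj₁, hq₁, hP₁, hv₁, hf₁, e, e', Expr.val_sub, Expr.val_one, Expr.val_mul,
      Expr.val_mod, Expr.val_get, Expr.val_add, St.set_var, St.set_arr, St.put_var, Expr.ok_sub,
      Expr.val_var, hv1, hf1, Expr.ok_mul, Expr.ok_mod, Expr.ok_get, Expr.ok_add, Expr.ok_var,
      Expr.ok_one, reduceCtorEq, if_false, if_true, hsr, hsi, hsf]
    have hok : 0 ≤ V (n - 1 - i) * F (n - 1 - i) := by positivity
    have hiN : (i : ℤ) < N := by exact_mod_cast hi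
    have hi0 : (0 : ℤ) ≤ i := Int.natCast_nonneg _
    refine ⟨by simp, by simp, ?_, ⟨hi0, hiN⟩, by simp, trivial, ⟨hi0, hiN⟩, post _ ?_ ?_⟩
    · simp only [true_and, and_true]
      exact ⟨⟨⟨h0, hsz'⟩, by omega, by omega⟩, ⟨hok, hprod⟩, by omega, hqW'⟩
    · simp [St.put]
    · simp [St.put, hin]
  · simp only [Stmt.wp_seq, Stmt.wp_ite, Stmt.wp_put, Test.ok_lt, Expr.val_var,
      Expr.ok_var, hi₁, hn₁, Test.holds_lt, Expr.val_zero, Expr.ok_zero, hsr, hsi, St.put_var]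
    refine ⟨⟨trivial, trivial, by omega, by omega⟩, fun h => by omega, fun _ => ⟨trivial, trivial,
      by omega, trivial, trivial, by omega, post _ ?_ ?_⟩⟩
    · simp [St.put]
    · simp [St.put, hin]

theorem pointwiseCode_spec {σ : St} {N : ℕ} {P O : ℤ} (hg : Globals σ N P O)
    (hs : Sizes W sz N P O) (hkr : sz .kerRe = 2 * N) (hki : sz .kerIm = 2 * N)
    (hb : ∀ x : ℕ, x < 2 * N →
      |σ.arr .sigRe x * σ.arr .kerRe x - σ.arr .sigIm x * σ.arr .kerIm x| < O * P ∧
      |σ.arr .sigRe x * σ.arr .kerIm x + σ.arr .sigIm x * σ.arr .kerRe x| < O * P) :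
    Triple W sz pointwiseCode σ (2 * N * 60 + 3) fun σ' => ∀ x : ℕ, x < 2 * N →
      σ'.arr .sigRe x = (σ.arr .sigRe x * σ.arr .kerRe x - σ.arr .sigIm x * σ.arr .kerIm x) / P ∧
      σ'.arr .sigIm x = (σ.arr .sigRe x * σ.arr .kerIm x + σ.arr .sigIm x * σ.arr .kerRe x) / P := by
  obtain ⟨L, hL⟩ : ∃ L, L = 2 * N := ⟨_, rfl⟩
  have hsr := hs.sigRe
  have hsi := hs.sigIm
  have hlen := hg.len
  have hlW := hs.len
  rw [← hL] at hb hkr hki hsr hsi hlen hlW ⊢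
  refine Triple.forTo (tb := 55) (fun i σ' => ∀ x : ℕ, x < L →
      σ'.arr .sigRe x = (if x < i then
        (σ.arr .sigRe x * σ.arr .kerRe x - σ.arr .sigIm x * σ.arr .kerIm x) / P
        else σ.arr .sigRe x) ∧
      σ'.arr .sigIm x = (if x < i then
        (σ.arr .sigRe x * σ.arr .kerIm x + σ.arr .sigIm x * σ.arr .kerRe x) / P
        else σ.arr .sigIm x)) hlen hlW rfl rfl (by decide) (by simp) ?_ (by omega)
    (fun _ h _ _ _ x hx => by simpa [hx] using h x hx)
  intro i hi σ₁ hinv hi₁ hfv hfa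
  have hi' := hinv i hi
  simp only [lt_irrefl, if_false] at hi'
  have hk1 := hfa .kerRe rfl
  have hk2 := hfa .kerIm rfl
  have hbi := hb i hi
  refine (Triple.seq (t₁ := 16) (P := fun σ₂ => σ₂.var .c = σ.arr .sigRe i ∧
    σ₂.var .d = σ.arr .sigIm i ∧ σ₂.var .a = σ.arr .kerRe i ∧ σ₂.var .b = σ.arr .kerIm i)
    (Triple.of_wp ?_ (by decide)) fun σ₂ ⟨hc₂, hd₂, ha₂, hb₂⟩ hf₂ => ?_ :
      Triple W sz _ σ₁ (16 + (28 + 8)) _).mono (by omega) fun _ h _ => h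
  · simp [hi₁, hi', hk1, hk2, hsr, hsi, hkr, hki, hi]
  refine (mulCode_spec ha₂ hb₂ hc₂ hd₂ ?_ ?_ ?_ hs.pos hs.lt hs.shift hbi.1 hbi.2).seq
    fun σ₃ ⟨hu₃, hv₃⟩ hf₃ => ?_
  · rw [hf₂.var .scale rfl, hfv .scale rfl (by decide), hg.scale]
  · rw [hf₂.var .off rfl, hfv .off rfl (by decide), hg.off]
  · rw [hf₂.var .shift rfl, hfv .shift rfl (by decide), hg.shift]
  have hi₃ : σ₃.var .i = (i : ℕ) := by rw [hf₃.var .i rfl, hf₂.var .i rfl, hi₁]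
  have hr₃ : σ₃.arr .sigRe = σ₁.arr .sigRe := by rw [hf₃.arr .sigRe rfl, hf₂.arr .sigRe rfl]
  have him₃ : σ₃.arr .sigIm = σ₁.arr .sigIm := by rw [hf₃.arr .sigIm rfl, hf₂.arr .sigIm rfl]
  refine Triple.of_wp ?_ (by decide)
  simp [hi₃, hu₃, hv₃, hsr, hsi, hr₃, him₃, hi]
  intro x hx
  by_cases hxi : x = i
  · subst hxi; simp
  · have h3 : x ≤ i ↔ x < i := by omega
    simp only [hxi, hinv x hx, h3, if_false, and_self]

/-- Adding `H`, half of `T`, before the floor division rounds to the nearest integer; reading at `n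
- 1 - i` reverses back, so that the value of order `i` lands at position `i`. -/
theorem storeCode_spec {σ : St} {n N q j : ℕ} {T H : ℤ} {c : ℕ → ℕ}
    (hn : σ.var .n = n) (hq : σ.var .q = q) (hj : σ.var .j = j)
    (hH : σ.var .half = H) (hT : σ.var .total = T) (hnW : n < W) (hnN : n ≤ N) (hq0 : 0 < q)
    (hqW : q < W) (hT0 : 0 < T) (hTW : T < W)
    (hc : ∀ i < n, (σ.arr .sigRe i + H) / T = c i ∧ 0 ≤ σ.arr .sigRe i + H ∧
      σ.arr .sigRe i + H < W)
    (hsr : sz .sigRe = N) (hsv : (j + 1) * n ≤ sz .vec) :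
    Triple W sz storeCode σ (n * 40 + 3) fun σ' => ∀ x : ℕ,
      σ'.arr .vec x = if j * n ≤ x ∧ x < (j + 1) * n then ((c (n - 1 - (x - j * n)) % q : ℕ) : ℤ)
        else σ.arr .vec x := by
  refine Triple.forTo (tb := 35) (fun i σ' => ∀ x : ℕ,
      σ'.arr .vec x = if j * n ≤ x ∧ x < j * n + i then ((c (n - 1 - (x - j * n)) % q : ℕ) : ℤ)
        else σ.arr .vec x) hn hnW rfl rfl (by decide) ?_ ?_ (by omega) ?_
  · intro x
    rw [if_neg (by omega)]; rfl
  · intro i hi σ₁ hinv hi₁ hfv hfa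
    have hn₁ := (hfv .n rfl (by decide)).trans hn
    have hj₁ := (hfv .j rfl (by decide)).trans hj
    have hq₁ := (hfv .q rfl (by decide)).trans hq
    have hH₁ := (hfv .half rfl (by decide)).trans hH
    have hT₁ := (hfv .total rfl (by decide)).trans hT
    have hs₁ := hfa .sigRe rfl
    have e : (n : ℤ) - 1 - i = (n - 1 - i : ℕ) := by omega
    have hci := hc (n - 1 - i) (by omega)
    have hcW : (c (n - 1 - i) : ℤ) < W := by
      rw [← hci.1]
      exact (Int.ediv_le_self _ hci.2.1).trans_lt hci.2.2
    refine Triple.of_wp ?_ (by decide)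
    simp [hi₁, hn₁, hj₁, hq₁, hH₁, hT₁, hs₁, hsr, e, hci.1]
    have hsz : j * n + i < sz .vec := by
      rw [add_mul] at hsv; omega
    have hsz' : (j : ℤ) * n + i < sz .vec := by exact_mod_cast hsz
    refine ⟨⟨by omega, by exact_mod_cast hcW, hq0, hqW⟩, ⟨by positivity, hsz'⟩, fun x => ?_⟩
    by_cases hx : x = j * n + i
    · subst hx
      rw [if_pos (by push_cast; rfl), if_pos (by omega), Nat.add_sub_cancel_left]
    · rw [if_neg (by exact_mod_cast hx), hinv x]
      congr 1
      simp only [eq_iff_iff]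
      omega
  · intro σ' h _ _ _ x
    rw [h x, show j * n + n = (j + 1) * n by ring]

end ArrayLang

/-! ### Parameters, word size and error budget -/

namespace ArrayLang

open Stmt Finset FFT

variable {W : ℕ} {sz : Arr → ℕ}

/-- Relations between the parameters of the algorithm: `n` is the dimension, `q` the modulus,
`2 ^ k` the length of the transforms. -/
structure Dims (W : ℕ) (sz : Arr → ℕ) (n q g k : ℕ) : Prop where
  two_le : 2 ≤ k
  pos : 1 ≤ n
  le : 2 * n ≤ 2 ^ k
  q_gt : n < q
  q_le : q ≤ (2 ^ k) ^ g
  word : (2 ^ k) ^ (6 * g + 40) ≤ W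
  input : sz .input = 3 * (n * n)
  vec : sz .vec = 4 * (n * n)
  fact : sz .fact = n
  ker : sz .ker = n
  twRe : sz .twRe = 2 ^ k
  twIm : sz .twIm = 2 ^ k
  sigRe : sz .sigRe = 2 ^ k
  sigIm : sz .sigIm = 2 ^ k
  kerRe : sz .kerRe = 2 ^ k
  kerIm : sz .kerIm = 2 ^ k

/-- The number of units per `1` in the fixed-point arithmetic. -/
def scaleOf (g k : ℕ) : ℕ := (2 ^ k) ^ (2 * g + 16)

/-- The values of the global variables. -/
structure Init (σ : St) (N T Q g k : ℕ) : Prop where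
  n : σ.var .n = N
  t : σ.var .t = T
  nn : σ.var .nn = (N * N : ℕ)
  q : σ.var .q = Q
  len : σ.var .len = (2 ^ k : ℕ)
  hlen : σ.var .hlen = (2 ^ (k - 1) : ℕ)
  lg : σ.var .lg = k
  scale : σ.var .scale = scaleOf g k
  off : σ.var .off = ((2 ^ k) ^ (4 * g + 22) : ℕ)
  shift : σ.var .shift = ((2 ^ k) ^ (4 * g + 22) * scaleOf g k : ℕ)
  half : σ.var .half = (scaleOf g k / 2 * 2 ^ k : ℕ)
  total : σ.var .total = (scaleOf g k * 2 ^ k : ℕ)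
  vecs : σ.var .vecs = (4 * N : ℕ)
  cols : σ.var .cols = (2 * N : ℕ)
  iters : σ.var .iters = ((2 * g + 16) * k + 1 : ℕ)

def globalVars : List Var :=
  [.n, .t, .nn, .q, .len, .hlen, .lg, .scale, .off, .shift, .half, .total, .vecs, .cols, .iters]

theorem Init.of_eq {σ σ' : St} {n t q g k : ℕ} (h : Init σ n t q g k)
    (hv : ∀ x ∈ globalVars, σ'.var x = σ.var x) : Init σ' n t q g k := by
  simp only [globalVars, List.forall_mem_cons, List.not_mem_nil, false_imp_iff, implies_true,
    and_true] at hv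
  obtain ⟨h1, h2, h3, h4, h5, h6, h7, h8, h9, h10, h11, h12, h13, h14, h15⟩ := hv
  exact ⟨h1.trans h.n, h2.trans h.t, h3.trans h.nn, h4.trans h.q, h5.trans h.len, h6.trans h.hlen,
    h7.trans h.lg, h8.trans h.scale, h9.trans h.off, h10.trans h.shift, h11.trans h.half,
    h12.trans h.total, h13.trans h.vecs, h14.trans h.cols, h15.trans h.iters⟩

theorem Init.frame {σ σ' : St} {n t q g k : ℕ} (h : Init σ n t q g k) {S : Stmt}
    (hf : Frame S σ σ') (hS : ∀ x ∈ globalVars, S.writes x = false := by decide) :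
    Init σ' n t q g k :=
  h.of_eq fun x hx => hf.var x (hS x hx)

theorem Init.loop {σ σ' : St} {n t q g k : ℕ} (h : Init σ n t q g k) {S : Stmt} {x : Var}
    (hf : ∀ z, S.writes z = false → z ≠ x → σ'.var z = σ.var z)
    (hS : ∀ z ∈ globalVars, S.writes z = false ∧ z ≠ x := by decide) :
    Init σ' n t q g k :=
  h.of_eq fun z hz => hf z (hS z hz).1 (hS z hz).2

/-- Numerical constants are paid for with spare powers of `N ≥ 4`; all size estimates below are
instances of this. -/
theorem monomial_le {N X : ℝ} (hN : 4 ≤ N) (hX : 1 ≤ X) {c : ℝ} {a b a' b' : ℕ} (e : ℕ)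
    (hc : c ≤ 4 ^ e) (ha : a + e ≤ a') (hb : b ≤ b') : c * N ^ a * X ^ b ≤ N ^ a' * X ^ b' := by
  have h1 : c * N ^ a ≤ N ^ a' := by
    calc c * N ^ a ≤ N ^ e * N ^ a :=
          mul_le_mul_of_nonneg_right (hc.trans (pow_le_pow_left₀ (by norm_num) hN e)) (by positivity)
      _ = N ^ (a + e) := by rw [← pow_add, add_comm]
      _ ≤ N ^ a' := pow_le_pow_right₀ (by linarith) ha
  exact mul_le_mul h1 (pow_le_pow_right₀ hX hb) (by positivity) (by positivity)

variable {g k : ℕ}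

theorem scaleOf_eq : scaleOf g k = (2 ^ k) ^ 16 * ((2 ^ k) ^ g) ^ 2 := by
  rw [scaleOf, ← pow_mul (2 ^ k) g, ← pow_add]; congr 1; ring

theorem off_eq : (2 ^ k) ^ (4 * g + 22) = (2 ^ k) ^ 22 * ((2 ^ k) ^ g) ^ 4 := by
  rw [← pow_mul (2 ^ k) g, ← pow_add]; congr 1; ring

theorem scaleOf_pos : 0 < scaleOf g k := by rw [scaleOf]; positivity

namespace Dims

variable {n q g k : ℕ}

theorem four_le (h : Dims W sz n q g k) : 4 ≤ 2 ^ k := by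
  have := Nat.pow_le_pow_right (n := 2) (by omega) h.two_le
  simpa using this

theorem eq_two_mul (h : Dims W sz n q g k) : 2 ^ k = 2 * 2 ^ (k - 1) := by
  rw [← pow_succ']; congr 1; have := h.two_le; omega

theorem n_le (h : Dims W sz n q g k) : n ≤ 2 ^ (k - 1) := by have := h.eq_two_mul; have := h.le; omega

/-- With `N = 2 ^ k` and `X = N ^ g`, the word-size condition reads `N ^ 40 * X ^ 6 ≤ W`. -/
theorem word_le (h : Dims W sz n q g k) {c a b : ℕ} (e : ℕ) (hc : c ≤ 4 ^ e) (ha : a + e ≤ 40) (hb : b ≤ 6) :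
    c * (2 ^ k) ^ a * ((2 ^ k) ^ g) ^ b ≤ W := by
  have hN : (4 : ℝ) ≤ (2 ^ k : ℕ) := by exact_mod_cast h.four_le
  have hX : (1 : ℝ) ≤ ((2 ^ k) ^ g : ℕ) := by exact_mod_cast Nat.one_le_pow _ _ (by positivity)
  have := monomial_le hN hX (c := c) e (by exact_mod_cast hc) ha hb
  refine le_trans (by exact_mod_cast this) ((le_of_eq ?_).trans h.word)
  rw [← pow_mul (2 ^ k) g, ← pow_add]; congr 1; ring

theorem len_lt (h : Dims W sz n q g k) : 2 ^ k < W := by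
  have h1 := h.word_le (c := 4) (a := 1) (b := 0) 1 (by norm_num) (by norm_num) (by norm_num)
  have := h.four_le
  simp only [pow_one, pow_zero, mul_one] at h1
  omega

theorem q_lt (h : Dims W sz n q g k) : q * q < W := by
  have h1 := h.word_le (c := 4) (a := 0) (b := 2) 1 (by norm_num) (by norm_num) (by norm_num)
  have h2 := Nat.mul_le_mul h.q_le h.q_le
  have := Nat.one_le_pow g (2 ^ k) (by positivity)
  nlinarith

theorem scale_lt (h : Dims W sz n q g k) : scaleOf g k < W := by
  have h1 := h.word_le (c := 4) (a := 16) (b := 2) 1 (by norm_num) (by norm_num) (by norm_num)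
  have h2 : 0 < (2 ^ k) ^ 16 * ((2 ^ k) ^ g) ^ 2 := by positivity
  rw [scaleOf_eq]
  nlinarith

theorem even_scale (h : Dims W sz n q g k) : 2 ∣ scaleOf g k := by
  have : 2 ∣ 2 ^ k := dvd_pow_self _ (by have := h.two_le; omega)
  exact this.trans (dvd_pow_self _ (by omega))

theorem sizes (h : Dims W sz n q g k) : Sizes W sz (2 ^ (k - 1)) (scaleOf g k) ((2 ^ k) ^ (4 * g + 22) : ℕ) where
  pos := by exact_mod_cast scaleOf_pos
  lt := by exact_mod_cast h.scale_lt
  -- The most demanding use of the word size: offset times scale is `N ^ 22 * X ^ 4 * (N ^ 16 * X ^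
  -- 2) = N ^ 38 * X ^ 6`.
  shift := by
    have h1 := h.word_le (c := 2) (a := 38) (b := 6) 1 (by norm_num) (by norm_num) (by norm_num)
    have : 2 * ((2 ^ k) ^ (4 * g + 22) * scaleOf g k) ≤ W := by
      refine (le_of_eq ?_).trans h1
      rw [scaleOf_eq, off_eq]; ring
    exact_mod_cast this
  len := by rw [← h.eq_two_mul]; exact h.len_lt
  sigRe := by rw [← h.eq_two_mul, h.sigRe]
  sigIm := by rw [← h.eq_two_mul, h.sigIm]
  twRe := by rw [← h.eq_two_mul, h.twRe]
  twIm := by rw [← h.eq_two_mul, h.twIm]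

theorem globals (h : Dims W sz n q g k) {σ : St} {t : ℕ} (hi : Init σ n t q g k) :
    Globals σ (2 ^ (k - 1)) (scaleOf g k) ((2 ^ k) ^ (4 * g + 22) : ℕ) where
  len := by rw [← h.eq_two_mul, hi.len]
  hlen := hi.hlen
  scale := hi.scale
  off := hi.off
  shift := by rw [hi.shift]; push_cast; rfl

end Dims

/-- Real bounds used in the error analysis; `X` bounds the entries of the vectors. -/
structure Budget (N X P O : ℝ) : Prop where
  N_ge : 4 ≤ N
  X_ge : 1 ≤ X
  P_eq : P = N ^ 16 * X ^ 2
  O_eq : O = N ^ 22 * X ^ 4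

theorem Dims.budget {n q g k : ℕ} (h : Dims W sz n q g k) :
    Budget (2 ^ k) ((2 ^ k) ^ g) (scaleOf g k) ((2 ^ k) ^ (4 * g + 22) : ℕ) where
  N_ge := by exact_mod_cast h.four_le
  X_ge := by exact_mod_cast Nat.one_le_pow g (2 ^ k) (by positivity)
  P_eq := by rw [scaleOf_eq]; push_cast; rfl
  O_eq := by rw [off_eq]; push_cast; rfl

namespace Budget

variable {N X P O : ℝ}

theorem le (h : Budget N X P O) {c : ℝ} {a b a' b' : ℕ} (e : ℕ) (hc : c ≤ 4 ^ e) (ha : a + e ≤ a') (hb : b ≤ b') :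
    c * N ^ a * X ^ b ≤ N ^ a' * X ^ b' := monomial_le h.N_ge h.X_ge e hc ha hb

theorem pos (h : Budget N X P O) (a b : ℕ) : 0 < N ^ a * X ^ b := by
  have := h.N_ge
  have := h.X_ge
  positivity

/-- The input is exact, the intermediate values are at most `N * X`, the twiddle error is `N ^ 6`,
and `N ^ 2 = 4 ^ k` is the amplification over `k` stages. -/
theorem forward_error (h : Budget N X P O) : N ^ 2 * (0 + (2 * (N * X) * N ^ 6 + 2)) ≤ N ^ 10 * X ^ 1 := by
  have h1 := h.le (c := 2) (a := 2) (b := 0) (a' := 9) (b' := 1) 1 (by norm_num) (by norm_num) (by norm_num)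
  have h2 := h.le (c := 4) (a := 9) (b := 1) (a' := 10) (b' := 1) 1 (by norm_num) (by norm_num) (by norm_num)
  have := h.pos 9 1
  ring_nf at h1 h2 this ⊢
  linarith

theorem forward_off (h : Budget N X P O) {E : ℝ} (hE : E ≤ N ^ 10 * X ^ 1) : 8 * (P * (N * X) + E) < O := by
  have h1 := h.le (c := 8) (a := 17) (b := 3) (a' := 19) (b' := 3) 2 (by norm_num) (by norm_num) (by norm_num)
  have h2 := h.le (c := 8) (a := 10) (b := 1) (a' := 19) (b' := 3) 2 (by norm_num) (by norm_num) (by norm_num)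
  have h3 := h.le (c := 4) (a := 19) (b := 3) (a' := 22) (b' := 4) 1 (by norm_num) (by norm_num) (by norm_num)
  have h4 := h.pos 19 3
  rw [h.P_eq, h.O_eq]
  ring_nf at h1 h2 h3 h4 hE ⊢
  linarith

theorem tau_le (h : Budget N X P O) : N ^ 6 ≤ P := by
  have h1 := h.le (c := 1) (a := 6) (b := 0) (a' := 16) (b' := 2) 0 (by norm_num) (by norm_num) (by norm_num)
  rw [h.P_eq]; linarith

theorem le_P (h : Budget N X P O) : N ^ 10 * X ^ 1 ≤ P := by
  have h1 := h.le (c := 1) (a := 10) (b := 1) (a' := 16) (b' := 2) 0 (by norm_num) (by norm_num) (by norm_num)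
  rw [h.P_eq]; linarith

theorem P_pos (h : Budget N X P O) : 0 < P := by rw [h.P_eq]; exact h.pos 16 2

/-- Both factors are transforms, of size at most `N * X` and with error at most `N ^ 10 * X`. -/
theorem product_error (h : Budget N X P O) {z z' E : ℝ} (hE0 : 0 ≤ E) (hE : E ≤ N ^ 10 * X ^ 1)
    (hz : z ≤ N * X) (hz' : z' ≤ N * X) :
    E * (z' + E / P) + z * E + 2 ≤ N ^ 12 * X ^ 2 := by
  have h1 : E / P ≤ 1 := (div_le_one h.P_pos).2 (hE.trans h.le_P)
  have h2 : 1 ≤ N * X := by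
    have := h.le (c := 1) (a := 0) (b := 0) (a' := 1) (b' := 1) 0 (by norm_num) (by norm_num) (by norm_num)
    ring_nf at this ⊢; linarith
  have h3 : E * (z' + E / P) ≤ N ^ 10 * X ^ 1 * (2 * (N * X)) :=
    (mul_le_mul_of_nonneg_left (by linarith : z' + E / P ≤ 2 * (N * X)) hE0).trans
      (mul_le_mul_of_nonneg_right hE (by linarith))
  have h4 : z * E ≤ N * X * (N ^ 10 * X ^ 1) :=
    (mul_le_mul_of_nonneg_right hz hE0).trans (mul_le_mul_of_nonneg_left hE (by linarith))
  have h5 := h.le (c := 2) (a := 0) (b := 0) (a' := 11) (b' := 2) 1 (by norm_num) (by norm_num) (by norm_num)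
  have h6 := h.le (c := 4) (a := 11) (b := 2) (a' := 12) (b' := 2) 1 (by norm_num) (by norm_num) (by norm_num)
  ring_nf at h3 h4 h5 h6 ⊢
  linarith

theorem product_lt (h : Budget N X P O) {a b c d E : ℝ} (hE : E ≤ N ^ 10 * X ^ 1)
    (ha : |a| ≤ P * (N * X) + E) (hb : |b| ≤ P * (N * X) + E)
    (hc : |c| ≤ P * (N * X) + E) (hd : |d| ≤ P * (N * X) + E) :
    |a * b| + |c * d| < O * P := by
  have hNX : 1 ≤ N * X := by
    have := h.le (c := 1) (a := 0) (b := 0) (a' := 1) (b' := 1) 0 (by norm_num) (by norm_num) (by norm_num)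
    ring_nf at this ⊢; linarith
  have hP := h.P_pos
  have hB : P * (N * X) + E ≤ 2 * (P * (N * X)) := by
    have := hE.trans h.le_P
    nlinarith
  have h1 : |a * b| ≤ (2 * (P * (N * X))) * (2 * (P * (N * X))) := by
    rw [abs_mul]
    exact mul_le_mul (ha.trans hB) (hb.trans hB) (abs_nonneg _) (by positivity)
  have h2 : |c * d| ≤ (2 * (P * (N * X))) * (2 * (P * (N * X))) := by
    rw [abs_mul]
    exact mul_le_mul (hc.trans hB) (hd.trans hB) (abs_nonneg _) (by positivity)
  have h3 : 8 * (P * (N * X) ^ 2) < O := by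
    have h1 := h.le (c := 8) (a := 18) (b := 4) (a' := 20) (b' := 4) 2 (by norm_num) (by norm_num) (by norm_num)
    have h2 := h.le (c := 4) (a := 20) (b := 4) (a' := 22) (b' := 4) 1 (by norm_num) (by norm_num) (by norm_num)
    have h3 := h.pos 20 4
    rw [h.P_eq, h.O_eq]
    ring_nf at h1 h2 h3 ⊢
    linarith
  nlinarith [mul_lt_mul_of_pos_right h3 hP]

/-- The inverse transform starts with error `N ^ 12 * X ^ 2` on values of size up to `(N * X) ^ 2`.
-/
theorem backward_error (h : Budget N X P O) :
    N ^ 2 * (N ^ 12 * X ^ 2 + (2 * (N * (N * X * (N * X))) * N ^ 6 + 2)) ≤ N ^ 15 * X ^ 2 := by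
  have h1 := h.le (c := 2) (a := 2) (b := 0) (a' := 14) (b' := 2) 1 (by norm_num) (by norm_num) (by norm_num)
  have h2 := h.le (c := 2) (a := 11) (b := 2) (a' := 14) (b' := 2) 1 (by norm_num) (by norm_num) (by norm_num)
  have h3 := h.le (c := 4) (a := 14) (b := 2) (a' := 15) (b' := 2) 1 (by norm_num) (by norm_num) (by norm_num)
  have := h.pos 14 2
  ring_nf at h1 h2 h3 this ⊢
  linarith

theorem backward_off (h : Budget N X P O) {E : ℝ} (hE : E ≤ N ^ 15 * X ^ 2) :
    8 * (P * (N * (N * X * (N * X))) + E) < O := by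
  have h1 := h.le (c := 8) (a := 19) (b := 4) (a' := 21) (b' := 4) 2 (by norm_num) (by norm_num) (by norm_num)
  have h2 := h.le (c := 8) (a := 15) (b := 2) (a' := 21) (b' := 4) 2 (by norm_num) (by norm_num) (by norm_num)
  have h3 := h.le (c := 4) (a := 21) (b := 4) (a' := 22) (b' := 4) 1 (by norm_num) (by norm_num) (by norm_num)
  have h4 := h.pos 21 4
  rw [h.P_eq, h.O_eq]
  ring_nf at h1 h2 h3 h4 hE ⊢
  linarith

/-- The unnormalised inverse represents each integer in multiples of `P * N`, so an error below half
of that is harmless. -/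
theorem round_error (h : Budget N X P O) {E : ℝ} (hE : E ≤ N ^ 15 * X ^ 2) : E < P * N / 2 := by
  have h1 := h.le (c := 4) (a := 15) (b := 2) (a' := 17) (b' := 2) 1 (by norm_num) (by norm_num) (by norm_num)
  have h2 := h.pos 15 2
  rw [h.P_eq]
  ring_nf at h1 h2 hE ⊢
  linarith

end Budget

end ArrayLang

/-! ### One exact convolution by the approximate transform -/

namespace ArrayLang

open Stmt Finset FFT

variable {W : ℕ} {sz : Arr → ℕ}

/-- Convolves the vector number `j` with the kernel. -/
def convCode : Stmt :=
  loadCode ;; forwardCode ;; pointwiseCode ;; backwardCode ;; storeCode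

/-- The entrywise product of `v` and `f` modulo `q`, reversed. -/
def revProd (n q : ℕ) (v f : ℕ → ℕ) (i : ℕ) : ℕ :=
  if i < n then v (n - 1 - i) * f (n - 1 - i) % q else 0

/-- The tables used by the convolutions: twiddle factors and the transform of the kernel `h`. -/
structure Tables (σ : St) (g k : ℕ) (h : ℕ → ℕ) : Prop where
  tw : ApproxOn (scaleOf g k : ℤ) (2 ^ k) (σ.arr .twRe) (σ.arr .twIm) (fun z => root k ^ z)
    ((2 ^ k) ^ 6)
  ker : ApproxOn (scaleOf g k : ℤ) (2 ^ k) (σ.arr .kerRe) (σ.arr .kerIm)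
    (forward (root k) k (fun i => (h i : ℂ)) k) ((2 ^ k) ^ 10 * ((2 ^ k) ^ g) ^ 1)

theorem Tables.of_eq {σ σ' : St} {g k : ℕ} {h : ℕ → ℕ} (H : Tables σ g k h)
    (h1 : σ'.arr .twRe = σ.arr .twRe) (h2 : σ'.arr .twIm = σ.arr .twIm)
    (h3 : σ'.arr .kerRe = σ.arr .kerRe) (h4 : σ'.arr .kerIm = σ.arr .kerIm) : Tables σ' g k h :=
  ⟨by rw [h1, h2]; exact H.tw, by rw [h3, h4]; exact H.ker⟩

theorem conv_le {a h : ℕ → ℕ} {A s : ℕ} (ha : ∀ i, a i ≤ A) (hh : ∀ i, h i ≤ A) :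
    conv a h s ≤ (s + 1) * (A * A) := by
  refine (sum_le_sum fun i _ => Nat.mul_le_mul (ha i) (hh (s - i))).trans ?_
  simp

theorem Dims.round_lt {n q g k : ℕ} (hd : Dims W sz n q g k) {c : ℕ}
    (hc : c ≤ 2 ^ k * ((2 ^ k) ^ g * (2 ^ k) ^ g)) :
    scaleOf g k * 2 ^ k * (c + 1) ≤ W := by
  have h1 := hd.word_le (c := 2) (a := 18) (b := 4) 1 (by norm_num) (by norm_num) (by norm_num)
  have h2 : 1 ≤ 2 ^ k * ((2 ^ k) ^ g * (2 ^ k) ^ g) := Nat.one_le_iff_ne_zero.2 (by positivity)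
  refine le_trans (Nat.mul_le_mul_left _ (by omega : c + 1 ≤ 2 * (2 ^ k * ((2 ^ k) ^ g * (2 ^ k) ^ g)))) ?_
  rw [scaleOf_eq]
  refine (le_of_eq ?_).trans h1
  ring

/-- The forward transform of a vector of residues. -/
theorem forwardCode_spec' {σ : St} {n t q g k : ℕ} {a : ℕ → ℕ} (hd : Dims W sz n q g k)
    (hi : Init σ n t q g k)
    (htw : ApproxOn (scaleOf g k : ℤ) (2 ^ k) (σ.arr .twRe) (σ.arr .twIm) (fun z => root k ^ z)
      ((2 ^ k) ^ 6))
    (ha : ∀ x < 2 ^ k, a x ≤ (2 ^ k) ^ g)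
    (hs : ∀ x : ℕ, x < 2 ^ k → σ.arr .sigRe x = a x * scaleOf g k ∧ σ.arr .sigIm x = 0) :
    Triple W sz forwardCode σ (k * (2 ^ (k - 1) * 107 + 20) + 10) fun σ' =>
      ApproxOn (scaleOf g k : ℤ) (2 ^ k) (σ'.arr .sigRe) (σ'.arr .sigIm)
        (forward (root k) k (fun i => (a i : ℂ)) k) ((2 ^ k) ^ 10 * ((2 ^ k) ^ g) ^ 1) := by
  have hb := hd.budget
  have h4 : (4 : ℝ) ^ k = (2 ^ k) ^ 2 := by rw [← pow_mul, mul_comm, pow_mul]; norm_num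
  have he := hb.forward_error
  refine (forwardCode_spec (P := scaleOf g k) (O := ((2 ^ k) ^ (4 * g + 22) : ℕ)) (ω := root k)
    (f := fun i => (a i : ℂ)) (E := 0) (Z₀ := (2 ^ k) ^ g) (τ := (2 ^ k) ^ 6)
    (by have := hd.two_le; omega) (hd.globals hi) hd.sizes hi.lg ?_ (norm_root k) htw ?_ ?_ ?_).mono
    le_rfl fun σ' h _ x hx => (h x hx).mono (by rw [h4]; exact he)
  · exact_mod_cast hb.tau_le
  · intro x hx
    rw [(hs x hx).1, (hs x hx).2]
    have := approx_exact ((scaleOf g k : ℤ) : ℝ) (a x) rfl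
    exact_mod_cast this
  · intro x hx
    rw [Complex.norm_natCast]
    exact_mod_cast ha x hx
  · have := hb.forward_off he
    rw [h4]
    exact_mod_cast this

/-- The exact inverse transform is `2 ^ k` times an integer convolution, so rounding recovers it;
the same inequalities keep the dividend inside a word. -/
theorem Dims.round {n q g k : ℕ} (hd : Dims W sz n q g k) {a h : ℕ → ℕ}
    (ha : ∀ i, a i ≤ (2 ^ k) ^ g) (hh : ∀ i, h i ≤ (2 ^ k) ^ g) (ha0 : ∀ i, n ≤ i → a i = 0)
    (hh0 : ∀ i, n ≤ i → h i = 0) {x y : ℤ} {i : ℕ} (hi : i < n) {E : ℝ}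
    (hE : E ≤ (2 ^ k) ^ 15 * ((2 ^ k) ^ g) ^ 2)
    (hx : Approx (scaleOf g k : ℤ) x y (backward (starRingEnd ℂ (root k)) k (fun x =>
      forward (root k) k (fun i => (a i : ℂ)) k x * forward (root k) k (fun i => (h i : ℂ)) k x)
      k i) E) :
    (x + scaleOf g k / 2 * (2 ^ k : ℕ)) / (scaleOf g k * 2 ^ k) = conv a h i ∧
      0 ≤ x + scaleOf g k / 2 * (2 ^ k : ℕ) ∧ x + scaleOf g k / 2 * (2 ^ k : ℕ) < W := by
  have hk := hd.two_le
  have hi2 : i < 2 ^ k := by have := hd.le; omega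
  rw [backward_mul_forward (by omega) (root_pow k (by omega)) (root_mul_conj k)
    (fun i hi => by simp [ha0 i (hd.n_le.trans hi)])
    (fun i hi => by simp [hh0 i (hd.n_le.trans hi)]) (fun _ _ => rfl) hi2] at hx
  have hcast : conv (fun i => (a i : ℂ)) (fun i => (h i : ℂ)) i = ((conv a h i : ℕ) : ℤ) := by
    simp [conv]
  have h7 := hd.round_lt (c := conv a h i) ((conv_le ha hh).trans
    (Nat.mul_le_mul_right _ (by omega)))
  have hE' := hd.budget.round_error hE
  have hev : (2 : ℤ) ∣ scaleOf g k := by exact_mod_cast hd.even_scale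
  have hpos : (0 : ℤ) < scaleOf g k := by exact_mod_cast scaleOf_pos
  rw [hcast] at hx
  generalize scaleOf g k = P at *
  have hM : (2 ^ k : ℂ) = ((2 ^ k : ℕ) : ℂ) := by push_cast; rfl
  have hM' : (2 ^ k : ℝ) = ((2 ^ k : ℕ) : ℝ) := by push_cast; rfl
  have hM'' : (2 ^ k : ℤ) = ((2 ^ k : ℕ) : ℤ) := by push_cast; rfl
  have hM0 : 0 < 2 ^ k := by positivity
  rw [hM] at hx
  rw [hM', ← Int.cast_natCast (R := ℝ) P] at hE'
  rw [hM'']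
  generalize 2 ^ k = M at *
  obtain ⟨h6, h6', h6''⟩ := hx.round rfl hpos hM0 hE' hev
  refine ⟨h6, le_trans (by positivity) h6', lt_of_lt_of_le h6'' ?_⟩
  exact_mod_cast h7

/-- The error is followed through the chain `0`, `N ^ 10 * X`, `N ^ 12 * X ^ 2`, `N ^ 15 * X ^ 2`
for loading, forward transform, product and inverse. The residue is taken of an exact integer, so
nothing is lost modulo `q`. -/
theorem convCode_spec {σ : St} {n t q g k j : ℕ} {v f h : ℕ → ℕ} (hd : Dims W sz n q g k)
    (hi : Init σ n t q g k) (hT : Tables σ g k h) (hj : σ.var .j = j) (hj' : j < 4 * n)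
    (hv : ∀ i < n, σ.arr .vec (j * n + i : ℕ) = v i ∧ v i < q)
    (hf : ∀ i < n, σ.arr .fact i = f i ∧ f i < q)
    (hh : ∀ i, h i ≤ (2 ^ k) ^ g) (hh0 : ∀ i, n ≤ i → h i = 0) :
    Triple W sz convCode σ (200 * (2 ^ k * k)) fun σ' => ∀ x : ℕ,
      σ'.arr .vec x = if j * n ≤ x ∧ x < (j + 1) * n then
        ((conv (revProd n q v f) h (n - 1 - (x - j * n)) % q : ℕ) : ℤ) else σ.arr .vec x := by
  have hb := hd.budget
  have h4 : (4 : ℝ) ^ k = (2 ^ k) ^ 2 := by rw [← pow_mul, mul_comm, pow_mul]; norm_num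
  have hk := hd.two_le
  have hN := hd.four_le
  have h2N := hd.eq_two_mul
  have hq0 : 0 < q := by have := hd.q_gt; omega
  have hnN : n ≤ 2 ^ k := by have := hd.le; omega
  have hsv : (j + 1) * n ≤ sz .vec := by
    rw [hd.vec, ← mul_assoc]; exact Nat.mul_le_mul_right _ hj'
  set a := revProd n q v f with ha
  have haq : ∀ i, a i ≤ (2 ^ k) ^ g := by
    intro i
    rw [ha, revProd]
    split_ifs
    · exact (Nat.mod_lt _ hq0).le.trans hd.q_le
    · exact Nat.zero_le _
  have ha0 : ∀ i, n ≤ i → a i = 0 := fun i hi => by rw [ha, revProd, if_neg (by omega)]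
  have hZ : ∀ b : ℕ → ℕ, (∀ i, b i ≤ (2 ^ k) ^ g) → ∀ x < 2 ^ k,
      ‖forward (root k) k (fun i => (b i : ℂ)) k x‖ ≤ 2 ^ k * (2 ^ k) ^ g := by
    intro b hb x hx
    refine norm_forward_le (norm_root k) (fun x _ => ?_) le_rfl hx
    rw [Complex.norm_natCast]
    exact_mod_cast hb x
  have hNX : (0 : ℝ) ≤ 2 ^ k * (2 ^ k) ^ g := by positivity
  obtain ⟨E, hE⟩ : ∃ E : ℝ, E = (2 ^ k) ^ 10 * ((2 ^ k) ^ g) ^ 1 := ⟨_, rfl⟩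
  have hE0 : 0 ≤ E := by rw [hE]; positivity
  refine (Triple.seq (t₂ := (k * (2 ^ (k - 1) * 107 + 20) + 10) + ((2 * 2 ^ (k - 1) * 60 + 3) +
      ((k * (2 ^ (k - 1) * 105 + 20) + 10) + (n * 40 + 3))))
    (loadCode_spec (V := fun i => v i) (F := fun i => f i) (P := scaleOf g k) hi.len hi.n hi.q hj
      hi.scale hd.len_lt hnN
    (fun i hi => ⟨(hv i hi).1, by positivity, by exact_mod_cast (hv i hi).2⟩)
    (fun i hi => ⟨(hf i hi).1, by positivity, by exact_mod_cast (hf i hi).2⟩) hq0 hd.q_lt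
    hd.sigRe hd.sigIm hd.fact hsv) fun σ₁ h₁ hf₁ => ?_).mono ?_ fun _ h _ => h
  swap
  · rw [h2N]
    obtain ⟨k, rfl⟩ := Nat.exists_eq_add_of_le hk
    obtain ⟨M, hM⟩ : ∃ M, M = 2 ^ (2 + k - 1) := ⟨_, rfl⟩
    rw [← hM] at h2N ⊢
    have : 2 ≤ M := by omega
    have : n ≤ M := hM ▸ hd.n_le
    nlinarith
  have hi₁ := hi.frame hf₁
  refine Triple.seq (forwardCode_spec' (a := a) hd hi₁ ?_ (fun x _ => haq x) ?_) fun σ₂ h₂ hf₂ => ?_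
  · rw [hf₁.arr .twRe rfl, hf₁.arr .twIm rfl]; exact hT.tw
  · intro x hx
    rw [(h₁ x hx).1, (h₁ x hx).2, ha, revProd]
    refine ⟨?_, rfl⟩
    split_ifs <;> push_cast <;> rfl
  have hi₂ := hi₁.frame hf₂
  have hT₂ : Tables σ₂ g k h := hT.of_eq (by rw [hf₂.arr .twRe rfl, hf₁.arr .twRe rfl])
    (by rw [hf₂.arr .twIm rfl, hf₁.arr .twIm rfl]) (by rw [hf₂.arr .kerRe rfl, hf₁.arr .kerRe rfl])
    (by rw [hf₂.arr .kerIm rfl, hf₁.arr .kerIm rfl])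
  have hker := hT₂.ker
  rw [← hE] at h₂ hker
  have hPc : ((scaleOf g k : ℤ) : ℝ) = (scaleOf g k : ℝ) := by push_cast; rfl
  refine Triple.seq (pointwiseCode_spec (hd.globals hi₂) hd.sizes (h2N ▸ hd.kerRe) (h2N ▸ hd.kerIm)
    ?_) fun σ₃ h₃ hf₃ => ?_
  · intro x hx
    rw [← h2N] at hx
    have hP0 : (0 : ℝ) ≤ ((scaleOf g k : ℤ) : ℝ) := by rw [hPc]; positivity
    have hle : ∀ {b : ℕ → ℕ}, (∀ i, b i ≤ (2 ^ k) ^ g) → ((scaleOf g k : ℤ) : ℝ) *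
        ‖forward (root k) k (fun i => (b i : ℂ)) k x‖ + E ≤
        (scaleOf g k : ℝ) * (2 ^ k * (2 ^ k) ^ g) + E := by
      intro b hb
      rw [hPc]
      exact add_le_add (mul_le_mul_of_nonneg_left (hZ b hb x hx) (by positivity)) le_rfl
    have b1 := ((h₂ x hx).abs_re_le hP0).trans (hle haq)
    have b2 := ((h₂ x hx).abs_im_le hP0).trans (hle haq)
    have b3 := ((hker x hx).abs_re_le hP0).trans (hle hh)
    have b4 := ((hker x hx).abs_im_le hP0).trans (hle hh)
    have l1 := hb.product_lt hE.le b1 b3 b2 b4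
    have l2 := hb.product_lt hE.le b1 b4 b2 b3
    constructor
    · have := (abs_sub _ _).trans_lt l1
      exact_mod_cast this
    · have := (abs_add_le _ _).trans_lt l2
      exact_mod_cast this
  have hi₃ := hi₂.frame hf₃
  -- `F` is the exact pointwise product; the computed signal is only compared with it.
  let F : ℕ → ℂ := fun x => forward (root k) k (fun i => (a i : ℂ)) k x *
    forward (root k) k (fun i => (h i : ℂ)) k x
  have hap : ApproxOn (scaleOf g k : ℤ) (2 ^ k) (σ₃.arr .sigRe) (σ₃.arr .sigIm) F
      ((2 ^ k) ^ 12 * ((2 ^ k) ^ g) ^ 2) := by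
    intro x hx
    have h3 := h₃ x (by omega)
    rw [h3.1, h3.2]
    refine ((h₂ x hx).mul rfl (by exact_mod_cast scaleOf_pos) (hker x hx)).mono ?_
    rw [hPc]
    exact hb.product_error hE0 hE.le (hZ a haq x hx) (hZ h hh x hx)
  have he := hb.backward_error
  refine Triple.seq (backwardCode_spec (P := scaleOf g k) (O := ((2 ^ k) ^ (4 * g + 22) : ℕ))
    (ω := root k) (f := F) (E := (2 ^ k) ^ 12 * ((2 ^ k) ^ g) ^ 2)
    (Z₀ := 2 ^ k * (2 ^ k) ^ g * (2 ^ k * (2 ^ k) ^ g)) (τ := (2 ^ k) ^ 6) (by omega)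
    (hd.globals hi₃) hd.sizes hi₃.lg ?_ (norm_root k) ?_ hap ?_ ?_) fun σ₄ h₄ hf₄ => ?_
  · exact_mod_cast hb.tau_le
  · rw [hf₃.arr .twRe rfl, hf₃.arr .twIm rfl]; exact hT₂.tw
  · intro x hx
    rw [norm_mul]
    exact mul_le_mul (hZ a haq x hx) (hZ h hh x hx) (norm_nonneg _) hNX
  · have := hb.backward_off he
    rw [h4]
    exact_mod_cast this
  have hi₄ := hi₃.frame hf₄
  refine (storeCode_spec (N := 2 ^ k) (j := j) (c := conv a h) (T := scaleOf g k * 2 ^ k)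
    (H := scaleOf g k / 2 * (2 ^ k : ℕ)) hi₄.n hi₄.q
    ?_ ?_ ?_ (hnN.trans_lt hd.len_lt) hnN hq0 ?_ ?_ ?_ ?_ hd.sigRe hsv).mono le_rfl
    fun σ' h5 hf₅ x => ?_
  · rw [hf₄.var .j rfl, hf₃.var .j rfl, hf₂.var .j rfl, hf₁.var .j rfl, hj]
  · rw [hi₄.half]; push_cast; rfl
  · rw [hi₄.total]; push_cast; rfl
  · have := hd.q_lt; nlinarith
  · exact_mod_cast Nat.mul_pos (scaleOf_pos (g := g) (k := k)) (by positivity : 0 < 2 ^ k)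
  · have h1 := hd.round_lt (c := 1) (Nat.one_le_iff_ne_zero.2 (by positivity))
    have h2 := Nat.mul_pos (scaleOf_pos (g := g) (k := k)) (by positivity : 0 < 2 ^ k)
    have : scaleOf g k * 2 ^ k < W := by omega
    exact_mod_cast this
  · intro i hi
    have hi2 : i < 2 ^ k := by omega
    have h5 := h₄ i hi2
    exact hd.round haq hh ha0 hh0 hi he (h4 ▸ h5)
  · rw [h5 x]
    have : σ₄.arr .vec = σ.arr .vec := by
      rw [hf₄.arr .vec rfl, hf₃.arr .vec rfl, hf₂.arr .vec rfl, hf₁.arr .vec rfl]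
    rw [this]

end ArrayLang

/-! ### Tables of factorials and the integer square root -/

namespace ArrayLang

open Stmt Finset FFT MMVerification

variable {W : ℕ} {sz : Arr → ℕ}

section

open Var

/-- Tabulates the factorials modulo `q`. -/
def factCode : Stmt :=
  assign x 1 ;; forTo i n (put .fact i x ;; assign x (x * (i + 1) % q))

/-- Tabulates the kernel modulo `q`. -/
def kernelCode : Stmt :=
  assign x 1 ;; forTo i n (assign y (n - 1 - i) ;; put .ker y x ;; assign x (x * y % q))

/-- Leaves the integer square root of `z` in `a`. -/
def sqrtCode : Stmt :=
  (assign a 0 ;; assign b scale) ;;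
  forTo i iters (assign c (a + b) ;; .ite (.lt z (c * c)) .skip (assign a c) ;; assign b (b / 2))

/-- Leaves a primitive root of unity of order `len` in `(x, y)`. -/
def rootCode : Stmt :=
  (assign x 0 ;; assign y scale ;; assign m (lg - 2)) ;;
  forTo l m (assign z (scale / 2 * (scale + x)) ;; sqrtCode ;;
    (assign y (y * scale / (2 * a)) ;; assign x a))

/-- Tabulates the powers of `(x, y)`. -/
def powersCode : Stmt :=
  (assign a x ;; assign b y ;; assign c scale ;; assign d 0) ;;
  forTo i len ((put .twRe i c ;; put .twIm i d) ;; mulCode ;; (assign c u ;; assign d v))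

end

theorem factCode_spec {σ : St} {n q : ℕ} (hn1 : 1 ≤ n) (hn : σ.var .n = n) (hq : σ.var .q = q) (hq1 : n < q)
    (hqW : q * q < W) (hs : sz .fact = n) :
    Triple W sz factCode σ (n * 25 + 10) fun σ' => ∀ i : ℕ, i < n →
      σ'.arr .fact i = (i.factorial % q : ℕ) := by
  have hqq : q ≤ q * q := Nat.le_mul_self q
  refine (Triple.seq (t₁ := 2) (t₂ := n * (12 + 5) + 3) (P := fun σ' => σ'.var .x = 1)
    (Triple.of_wp (by simp)) fun σ₁ h₁ hf₁ => ?_).mono (by omega) fun _ h _ => h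
  refine Triple.forTo (tb := 12) (fun i σ' => σ'.var .x = (i.factorial % q : ℕ) ∧
    ∀ j : ℕ, j < i → σ'.arr .fact j = (j.factorial % q : ℕ)) ((hf₁.var .n rfl).trans hn)
    (by omega) rfl rfl (by decide) ?_ ?_ le_rfl (fun _ h _ _ _ => h.2)
  · refine ⟨?_, by simp⟩
    simp [h₁, Nat.mod_eq_of_lt (show 1 < q by omega)]
  · intro i hi σ₂ ⟨hx, hinv⟩ hi₂ hfv _
    have hq₂ : σ₂.var .q = q := by rw [hfv .q rfl (by decide), hf₁.var .q rfl, hq]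
    refine Triple.of_wp ?_ (by decide)
    simp only [wp_seq, wp_put, wp_assign, Expr.ok_var, Expr.val_var, hi₂, hx, hs, Expr.ok_mod,
      Expr.ok_mul, Expr.ok_add, Expr.ok_one, Expr.val_mul, Expr.val_add, Expr.val_one, St.put_var,
      hq₂, Expr.val_mod, true_and]
    have h1 : i.factorial % q < q := Nat.mod_lt _ (by omega)
    have h2 : i.factorial % q * (i + 1) ≤ q * q := Nat.mul_le_mul h1.le (by omega)
    have h2' : i.factorial % q * (i + 1) < W := by omega
    refine ⟨⟨by omega, by omega⟩, ⟨⟨by positivity, by exact_mod_cast h2'⟩, by omega, by omega⟩, ?_,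
      fun j hj => ?_⟩
    · simp only [St.set_var, reduceCtorEq, if_false, if_true]
      rw [Nat.factorial_succ]
      push_cast
      rw [mul_comm]
      simp [Int.mul_emod]
    · rcases eq_or_ne j i with rfl | h
      · simp
      · simpa [h] using hinv j (by omega)

/-- Filling the table downwards from `kernel n (n - 1) = 1` needs only multiplications, so no
inverse modulo `q` is computed. -/
theorem kernel_pred {n m : ℕ} (hm : m + 1 < n) : kernel n m = kernel n (m + 1) * (m + 1) := by
  simp only [kernel]
  rw [Nat.factorial_succ]
  have h : (m + 1) * m.factorial ∣ (n - 1).factorial := by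
    rw [← Nat.factorial_succ]; exact Nat.factorial_dvd_factorial (by omega)
  obtain ⟨e, he⟩ := h
  rw [he, Nat.mul_div_cancel_left _ (by positivity), mul_comm (m + 1), mul_assoc,
    Nat.mul_div_cancel_left _ (by positivity), mul_comm]

theorem kernelCode_spec {σ : St} {n q : ℕ} (hn : σ.var .n = n) (hq : σ.var .q = q) (hq1 : n < q)
    (hqW : q * q < W) (hs : sz .ker = n) :
    Triple W sz kernelCode σ (n * 25 + 10) fun σ' => ∀ i : ℕ, i < n →
      σ'.arr .ker i = (kernel n i % q : ℕ) := by
  have hqq : q ≤ q * q := Nat.le_mul_self q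
  refine (Triple.seq (t₁ := 2) (t₂ := n * (17 + 5) + 3) (P := fun σ' => σ'.var .x = 1)
    (Triple.of_wp (by simp)) fun σ₁ h₁ hf₁ => ?_).mono (by omega) fun _ h _ => h
  -- After the last entry the running product becomes `0` and matches no table entry, hence the
  -- guard `i < n`.
  refine Triple.forTo (tb := 17) (fun i σ' => (i < n → σ'.var .x = (kernel n (n - 1 - i) % q : ℕ)) ∧
    ∀ j : ℕ, j < n → n ≤ j + i → σ'.arr .ker j = (kernel n j % q : ℕ)) ((hf₁.var .n rfl).trans hn)
    (by omega) rfl rfl (by decide) ?_ ?_ le_rfl (fun _ h _ _ _ i hi => h.2 i hi (by omega))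
  · refine ⟨fun hn0 => ?_, fun j hj hj' => by omega⟩
    simp [h₁, Nat.mod_eq_of_lt (show 1 < q by omega), kernel, Nat.div_self (Nat.factorial_pos _)]
  · intro i hi σ₂ ⟨hx, hinv⟩ hi₂ hfv _
    have hq₂ : σ₂.var .q = q := by rw [hfv .q rfl (by decide), hf₁.var .q rfl, hq]
    have hn₂ : σ₂.var .n = n := by rw [hfv .n rfl (by decide), hf₁.var .n rfl, hn]
    have hx := hx hi
    have e : (n : ℤ) - 1 - i = (n - 1 - i : ℕ) := by omega
    obtain ⟨m, hm⟩ : ∃ m, m = n - 1 - i := ⟨_, rfl⟩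
    rw [← hm] at e hx
    have hmn : m < n := by omega
    refine Triple.of_wp ?_ (by decide)
    simp only [wp_seq, wp_put, wp_assign, Expr.ok_var, Expr.val_var, hi₂, hx, hs, Expr.ok_mod,
      Expr.ok_mul, Expr.ok_sub, Expr.ok_one, Expr.val_mul, Expr.val_sub, Expr.val_one, St.put_var,
      hq₂, hn₂, Expr.val_mod, true_and, e, St.set_var, if_true, if_false, reduceCtorEq]
    have h1 : kernel n m % q < q := Nat.mod_lt _ (by omega)
    have h2 : kernel n m % q * m ≤ q * q := Nat.mul_le_mul h1.le (by omega)
    have h2' : kernel n m % q * m < W := by omega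
    refine ⟨⟨by omega, by omega⟩, ⟨⟨by positivity, by exact_mod_cast h2'⟩, by omega, by omega⟩,
      fun hi' => ?_, fun j hj hj' => ?_⟩
    · obtain ⟨m, rfl⟩ := Nat.exists_eq_add_of_lt (show 0 < m by omega)
      have e2 : n - 1 - (i + 1) = m := by omega
      simp only [zero_add] at *
      rw [e2, kernel_pred (m := m) (by omega)]
      push_cast
      simp [Int.mul_emod]
    · rcases eq_or_ne j m with rfl | h
      · simp
      · simpa [h] using hinv j hj (by omega)

/-- Binary digits of the root are found from the top: `X < (2 * 2 ^ K) ^ 2` leaves `K + 1` digits.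
-/
theorem sqrtCode_spec {σ : St} {X : ℤ} {K : ℕ} (hz : σ.var .z = X) (hs : σ.var .scale = (2 ^ K : ℕ))
    (hi : σ.var .iters = (K + 1 : ℕ)) (hX : 0 ≤ X) (hXK : X < 4 * (2 ^ K * 2 ^ K))
    (hW : 16 * (2 ^ K * 2 ^ K) ≤ W) :
    Triple W sz sqrtCode σ ((K + 1) * 25 + 10) fun σ' =>
      0 ≤ σ'.var .a ∧ σ'.var .a * σ'.var .a ≤ X ∧ X < (σ'.var .a + 1) * (σ'.var .a + 1) := by
  have hK : K < 2 ^ K := Nat.lt_two_pow_self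
  have hKK : 2 ^ K ≤ 2 ^ K * 2 ^ K := Nat.le_mul_self _
  have hWi : (16 * (2 ^ K * 2 ^ K) : ℤ) ≤ W := by exact_mod_cast hW
  have hKi : (1 : ℤ) ≤ 2 ^ K := by exact_mod_cast Nat.one_le_two_pow
  refine (Triple.seq (t₁ := 4) (t₂ := (K + 1) * (19 + 5) + 3)
    (P := fun σ' => σ'.var .a = 0 ∧ σ'.var .b = (2 ^ K : ℕ))
    (Triple.of_wp (by simp [hs])) fun σ₁ ⟨h₁, h₁'⟩ hf₁ => ?_).mono (by omega) fun _ h _ => h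
  -- The root lies in an interval of length `2 ^ (K + 1 - i)`. The step is written as half of this
  -- length because it ends as `1 / 2 = 0`.
  refine Triple.forTo (tb := 19) (fun i σ' => 0 ≤ σ'.var .a ∧ σ'.var .a * σ'.var .a ≤ X ∧
      X < (σ'.var .a + 2 ^ (K + 1 - i)) * (σ'.var .a + 2 ^ (K + 1 - i)) ∧
      σ'.var .b = 2 ^ (K + 1 - i) / 2)
    ((hf₁.var .iters rfl).trans hi) (by omega) rfl rfl (by decide) ?_ ?_ le_rfl ?_
  · simp only [St.set_var, reduceCtorEq, if_false, h₁, h₁', Nat.sub_zero, zero_add]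
    refine ⟨le_rfl, by omega, ?_, ?_⟩
    · rw [pow_succ]; linarith
    · rw [pow_succ]; simp
  · intro i hi σ₂ ⟨h1, h2, h3, h4⟩ hi₂ hfv _
    have hz₂ : σ₂.var .z = X := by rw [hfv .z rfl (by decide), hf₁.var .z rfl, hz]
    have e : K + 1 - i = K - i + 1 := by omega
    have e' : K + 1 - (i + 1) = K - i := by omega
    have hB : (2 : ℤ) ^ (K - i) ≤ 2 ^ K := pow_le_pow_right₀ (by norm_num) (by omega)
    have hB0 : (1 : ℤ) ≤ 2 ^ (K - i) := one_le_pow₀ (by norm_num)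
    rw [e, pow_succ] at h3 h4
    rw [Int.mul_ediv_cancel _ two_ne_zero] at h4
    obtain ⟨r, hr⟩ : ∃ r, r = σ₂.var .a := ⟨_, rfl⟩
    obtain ⟨B, hBd⟩ : ∃ B : ℤ, B = 2 ^ (K - i) := ⟨_, rfl⟩
    obtain ⟨P, hP⟩ : ∃ P : ℤ, P = 2 ^ K := ⟨_, rfl⟩
    rw [← hr] at h1 h2 h3
    rw [← hBd] at h3 h4 hB hB0
    rw [← hP] at hB hWi hXK hKi
    have hPP : P ≤ P * P := by nlinarith only [hKi]
    have hrP : r < 2 * P := lt_of_not_ge fun h => by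
      have := mul_self_le_mul_self (by omega : 0 ≤ 2 * P) h
      linarith
    have hW1 : (r + B) * (r + B) < W := by
      have := mul_self_le_mul_self (by omega : 0 ≤ r + B) (by omega : r + B ≤ 3 * P)
      linarith
    have hW2 : X < W := by linarith
    have hBW : B < W := by linarith
    refine Triple.of_wp ?_ (by decide)
    simp only [wp_seq, wp_ite, wp_skip, wp_assign, Test.ok_lt, Test.holds_lt, Expr.val_var,
      Expr.ok_var, Expr.ok_mul, Expr.ok_add, Expr.val_mul, Expr.val_add, St.set_var, if_true,
      if_false, reduceCtorEq, ← hr, h4, hz₂, Expr.ok_div, Expr.ok_two, Expr.val_two, true_and,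
      e', ← hBd, Expr.val_div]
    have h0 : 0 ≤ (r + B) * (r + B) := mul_self_nonneg _
    exact ⟨⟨⟨hX, hW2⟩, h0, hW1⟩, fun hlt => ⟨⟨⟨by omega, hBW⟩, by omega, by omega⟩, h1, h2, hlt, trivial⟩,
      fun hlt => ⟨⟨⟨by omega, hBW⟩, by omega, by omega⟩, by omega, by omega, by linarith, trivial⟩⟩
  · intro σ₂ ⟨h1, h2, h3, _⟩ _ _ _
    rw [Nat.sub_self, pow_zero] at h3
    exact ⟨h1, h2, h3⟩

end ArrayLang

/-! ### Roots of unity in fixed-point arithmetic -/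

namespace ArrayLang

open Stmt Finset FFT MMVerification

variable {W : ℕ} {sz : Arr → ℕ}

theorem scaleOf_eq_two_pow {g k : ℕ} : scaleOf g k = 2 ^ ((2 * g + 16) * k) := by
  rw [scaleOf, ← pow_mul, mul_comm]

theorem Dims.scale_sq {n q g k : ℕ} (hd : Dims W sz n q g k) :
    16 * (scaleOf g k * scaleOf g k) ≤ W := by
  have := hd.word_le (c := 16) (a := 32) (b := 4) 2 (by norm_num) (by norm_num) (by norm_num)
  rw [scaleOf_eq]
  refine (le_of_eq ?_).trans this
  ring

theorem Dims.lg_le_scale {n q g k : ℕ} (hd : Dims W sz n q g k) :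
    10 * k ≤ scaleOf g k ∧ 3 * k ^ 2 ≤ scaleOf g k := by
  have h1 : k ≤ 2 ^ k := Nat.lt_two_pow_self.le
  have h2 : (2 ^ k) ^ 4 ≤ scaleOf g k := by
    rw [scaleOf]; exact Nat.pow_le_pow_right (by positivity) (by omega)
  have h3 := hd.four_le
  obtain ⟨N, hN⟩ : ∃ N, N = 2 ^ k := ⟨_, rfl⟩
  rw [← hN] at h1 h2 h3
  have h4 : 16 * (N * N) ≤ N ^ 4 := by nlinarith [Nat.mul_le_mul h3 h3, mul_self_nonneg (N * N)]
  have h5 : k ^ 2 ≤ N * N := by rw [pow_two]; exact Nat.mul_le_mul h1 h1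
  constructor <;> nlinarith

theorem rootCode_spec {σ : St} {n t q g k : ℕ} (hd : Dims W sz n q g k)
    (hi : Init σ n t q g k) :
    Triple W sz rootCode σ (k * (((2 * g + 16) * k + 1) * 25 + 35) + 15) fun σ' =>
      RootApprox (scaleOf g k) k (σ'.var .x) (σ'.var .y) := by
  have hk := hd.two_le
  have hkW : k < W := Nat.lt_two_pow_self.trans hd.len_lt
  obtain ⟨hl1, hl2⟩ := hd.lg_le_scale
  have hP0 := scaleOf_pos (g := g) (k := k)
  have hev : (2 : ℤ) ∣ scaleOf g k := by exact_mod_cast hd.even_scale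
  have hPW : (scaleOf g k : ℤ) < W := by exact_mod_cast hd.scale_lt
  have hPPW : (16 * (scaleOf g k * scaleOf g k) : ℤ) ≤ W := by exact_mod_cast hd.scale_sq
  refine (Triple.seq (t₁ := 8) (t₂ := k * (((2 * g + 16) * k + 1) * 25 + 35) + 3)
    (P := fun σ' => σ'.var .x = 0 ∧ σ'.var .y = scaleOf g k ∧ σ'.var .m = (k - 2 : ℕ))
    (Triple.of_wp ?_ (by decide)) fun σ₁ ⟨h₁, h₁', h₁''⟩ hf₁ => ?_).mono (by omega) fun _ h _ => h
  · simp [hi.scale, hi.lg]; omega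
  have hi₁ := hi.frame hf₁
  -- The start is the exactly known angle `2π / 2 ^ 2`, so `k - 2` halvings reach order `2 ^ k`.
  refine Triple.forTo (tb := ((2 * g + 16) * k + 1) * 25 + 30) (fun l σ' =>
      RootApprox (scaleOf g k) (l + 2) (σ'.var .x) (σ'.var .y)) h₁'' (by omega) rfl rfl
      (by decide) ?_ ?_ (Nat.add_le_add_right (Nat.mul_le_mul (by omega) (by omega)) _) ?_
  · simp only [St.set_var, reduceCtorEq, if_false, h₁, h₁', zero_add]
    exact rootApprox_two (by positivity)
  · intro l hl σ₂ h₂ _ hfv _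
    have hi₂ := hi₁.loop hfv
    have hxle := h₂.re_le (by positivity)
    have hyle := h₂.im_le (by positivity)
    have hx0 := h₂.re_nonneg
    have hy0 := h₂.im_nonneg
    have hl3 : 3 * (l + 2) ^ 2 ≤ 3 * k ^ 2 := by
      have := Nat.pow_le_pow_left (show l + 2 ≤ k by omega) 2; omega
    have hyle2 : σ₂.var .y ≤ 2 * scaleOf g k := by
      have : ((3 * (l + 2) ^ 2 : ℕ) : ℤ) ≤ scaleOf g k := by exact_mod_cast hl3.trans hl2
      push_cast at this hyle
      linarith
    obtain ⟨X, hX⟩ : ∃ X : ℤ, X = (scaleOf g k : ℤ) / 2 * (scaleOf g k + σ₂.var .x) := ⟨_, rfl⟩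
    have hK := scaleOf_eq_two_pow (g := g) (k := k)
    obtain ⟨P, hP⟩ : ∃ P, P = scaleOf g k := ⟨_, rfl⟩
    rw [← hP] at hl1 hl2 hP0 hev hPW hPPW h₂ hxle hyle2 hX hK
    have hX0 : 0 ≤ X := by rw [hX]; positivity
    have hXP : X < 4 * (P * P) := by
      have h1 : (P : ℤ) / 2 ≤ P := Int.ediv_le_self _ (by positivity)
      have h2 : (P : ℤ) + σ₂.var .x ≤ 3 * P := by push_cast at hxle; omega
      have h3 := mul_le_mul h1 h2 (by omega) (by positivity)
      have h4 : 0 < (P : ℤ) * P := by positivity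
      rw [hX]; linarith
    refine (Triple.seq (t₁ := 8) (t₂ := (((2 * g + 16) * k + 1) * 25 + 10) + 10)
      (P := fun σ₃ => σ₃.var .z = X) (Triple.of_wp ?_ (by decide)) fun σ₃ h₃ hf₃ => ?_).mono
      (by omega) fun _ h _ => h
    · simp [hi₂.scale, ← hP, hX]; omega
    have hi₃ := hi₂.frame hf₃
    refine Triple.seq (sqrtCode_spec (K := (2 * g + 16) * k) h₃ ?_ hi₃.iters hX0 ?_ ?_)
      fun σ₄ ⟨h4, h4', h4''⟩ hf₄ => ?_
    · rw [hi₃.scale, ← hP, hK]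
    · rw [hK] at hXP; exact_mod_cast hXP
    · rw [← hK, hP]; exact hd.scale_sq
    have hi₄ := hi₃.frame hf₄
    rw [hX] at h4' h4''
    obtain ⟨hr1, hr2⟩ := h₂.half (by omega) (by push_cast; omega) hev h4 h4' h4''
    have hy₄ : σ₄.var .y = σ₂.var .y := by rw [hf₄.var .y rfl, hf₃.var .y rfl]
    have hr4 := hr2.re_le (by positivity)
    have hyP : σ₂.var .y * P ≤ 2 * P * P := mul_le_mul_of_nonneg_right hyle2 (by positivity)
    refine Triple.of_wp ?_ (by decide)
    have e : l + 1 + 2 = l + 2 + 1 := by omega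
    simp only [wp_seq, wp_assign, Expr.val_var, Expr.ok_var, Expr.ok_div, Expr.ok_mul, Expr.val_mul,
      Expr.val_div, Expr.val_two, Expr.ok_two, St.set_var, if_true, if_false, reduceCtorEq, true_and,
      hi₄.scale, hy₄, ← hP, e]
    refine ⟨⟨⟨by positivity, by linarith⟩, by omega, ?_⟩, hr2⟩
    push_cast at hr4
    have : (P : ℤ) ≤ P * P := le_mul_of_one_le_left (by positivity) (by omega)
    omega
  · intro σ₂ h _ _ _
    rwa [Nat.sub_add_cancel hk] at h

/-- The primitive root has error at most `k + 3 * k ^ 2`, so the `j`-th power has error at most `j *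
N ^ 4 ≤ N ^ 5`, within the tolerance `N ^ 6` of the tables. -/
theorem powersCode_spec {σ : St} {n t q g k : ℕ} (hd : Dims W sz n q g k)
    (hi : Init σ n t q g k) (hr : RootApprox (scaleOf g k) k (σ.var .x) (σ.var .y)) :
    Triple W sz powersCode σ (2 ^ k * 50 + 20) fun σ' =>
      ApproxOn (scaleOf g k : ℤ) (2 ^ k) (σ'.arr .twRe) (σ'.arr .twIm) (fun z => root k ^ z)
      ((2 ^ k) ^ 6) := by
  have hb := hd.budget
  have hN := hb.N_ge
  have hkN : (k : ℝ) ≤ 2 ^ k := by exact_mod_cast (Nat.lt_two_pow_self (n := k)).le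
  have hF := hr.approx
  set F : ℝ := k + 3 * k ^ 2 with hFdef
  have hF0 : 0 ≤ F := by positivity
  obtain ⟨N, hNd⟩ : ∃ N : ℝ, N = 2 ^ k := ⟨_, rfl⟩
  have hF3 : F + 3 ≤ N ^ 4 := by
    rw [← hNd] at hN hkN
    have h1 : (k : ℝ) ^ 2 ≤ N ^ 2 := pow_le_pow_left₀ (by positivity) hkN 2
    have h2 : 16 * N ^ 2 ≤ N ^ 4 := by nlinarith [mul_le_mul hN hN (by norm_num) (by linarith), sq_nonneg N]
    nlinarith
  have hFP : ∀ j : ℕ, j ≤ 2 ^ k → (j : ℝ) * N ^ 4 ≤ N ^ 5 := by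
    intro j hj
    have : (j : ℝ) ≤ N := by rw [hNd]; exact_mod_cast hj
    calc (j : ℝ) * N ^ 4 ≤ N * N ^ 4 := mul_le_mul_of_nonneg_right this (by positivity)
      _ = N ^ 5 := by ring
  have h9 : N ^ 9 ≤ (scaleOf g k : ℝ) := by
    have h1 := hb.le (c := 1) (a := 9) (b := 0) (a' := 16) (b' := 2) 0 (by norm_num) (by norm_num) (by norm_num)
    rw [hb.P_eq, hNd]; linarith
  have h10 : N ^ 5 ≤ (2 ^ k) ^ 10 * ((2 ^ k) ^ g) ^ 1 := by
    have h1 := hb.le (c := 1) (a := 5) (b := 0) (a' := 10) (b' := 1) 0 (by norm_num) (by norm_num) (by norm_num)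
    rw [hNd]; linarith
  have h10' : N ^ 4 ≤ N ^ 5 := pow_le_pow_right₀ (by rw [hNd]; linarith) (by norm_num)
  have h56 : N ^ 5 ≤ N ^ 6 := pow_le_pow_right₀ (by rw [hNd]; linarith) (by norm_num)
  have hPc : ((scaleOf g k : ℤ) : ℝ) = (scaleOf g k : ℝ) := by push_cast; rfl
  refine (Triple.seq (t₁ := 8) (t₂ := 2 ^ k * 50 + 3)
    (P := fun σ' => σ'.var .a = σ.var .x ∧ σ'.var .b = σ.var .y ∧ σ'.var .c = scaleOf g k ∧
      σ'.var .d = 0) (Triple.of_wp ?_ (by decide)) fun σ₁ ⟨ha₁, hb₁, hc₁, hd₁⟩ hf₁ => ?_).mono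
      (by omega) fun _ h _ => h
  · simp [hi.scale]
  have hi₁ := hi.frame hf₁
  refine Triple.forTo (tb := 45) (fun i σ' =>
      Approx (scaleOf g k : ℤ) (σ'.var .c) (σ'.var .d) (root k ^ i) (i * N ^ 4) ∧
      ApproxOn (scaleOf g k : ℤ) i (σ'.arr .twRe) (σ'.arr .twIm) (fun z => root k ^ z)
      ((2 ^ k) ^ 6)) hi₁.len hd.len_lt rfl rfl (by decide) ?_ ?_ (by omega) (fun _ h _ _ _ => h.2)
  · refine ⟨?_, fun x hx => by omega⟩
    simp only [St.set_var, reduceCtorEq, if_false, hc₁, hd₁, Nat.cast_zero, zero_mul, pow_zero]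
    simpa using approx_exact ((scaleOf g k : ℤ) : ℝ) 1 rfl
  · intro i hi' σ₂ ⟨hap, hon⟩ hi₂ hfv _
    have hii := hi₁.loop hfv
    have ha₂ := (hfv .a rfl (by decide)).trans ha₁
    have hb₂ := (hfv .b rfl (by decide)).trans hb₁
    have hi'N : (i : ℤ) < (2 ^ k : ℕ) := by exact_mod_cast hi'
    refine (Triple.seq (t₁ := 8) (t₂ := 28 + 8) (P := fun σ₃ => σ₃.var .c = σ₂.var .c ∧
      σ₃.var .d = σ₂.var .d ∧ ApproxOn (scaleOf g k : ℤ) (i + 1) (σ₃.arr .twRe) (σ₃.arr .twIm)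
        (fun z => root k ^ z) ((2 ^ k) ^ 6)) (Triple.of_wp ?_ (by decide))
      fun σ₃ ⟨hc₃, hd₃, hon₃⟩ hf₃ => ?_).mono (by omega) fun _ h _ => h
    · simp only [wp_seq, wp_put, Expr.val_var, Expr.ok_var, hi₂, hd.twRe, hd.twIm, St.put_var,
        true_and]
      refine ⟨⟨by positivity, hi'N⟩, ⟨by positivity, hi'N⟩, fun x hx => ?_⟩
      rcases eq_or_ne x i with rfl | h
      · simp only [St.put_arr, reduceCtorEq, false_and, true_and, if_false, if_true]
        exact hap.mono ((hFP x hi'.le).trans (hNd ▸ h56))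
      · have := hon x (by omega)
        simpa [h] using this
    have hi₃ := hii.frame hf₃
    have hE0 : (0 : ℝ) ≤ N ^ 5 := by rw [hNd]; positivity
    have hbd : ∀ {x y : ℤ} {z : ℂ} {E : ℝ}, Approx (scaleOf g k : ℤ) x y z E → ‖z‖ = 1 → E ≤ N ^ 5 →
        |(x : ℝ)| ≤ scaleOf g k * (2 ^ k * (2 ^ k) ^ g) + N ^ 5 ∧
        |(y : ℝ)| ≤ scaleOf g k * (2 ^ k * (2 ^ k) ^ g) + N ^ 5 := by
      intro x y z E h hz hE
      have hP0 : (0 : ℝ) ≤ ((scaleOf g k : ℤ) : ℝ) := by rw [hPc]; positivity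
      have h1 : (1 : ℝ) ≤ 2 ^ k * (2 ^ k) ^ g := by
        have := hb.le (c := 1) (a := 0) (b := 0) (a' := 1) (b' := 1) 0 (by norm_num) (by norm_num) (by norm_num)
        linarith
      have h2 : ((scaleOf g k : ℤ) : ℝ) * ‖z‖ + E ≤ scaleOf g k * (2 ^ k * (2 ^ k) ^ g) + N ^ 5 := by
        rw [hz, hPc]
        exact add_le_add (mul_le_mul_of_nonneg_left h1 (by positivity)) hE
      exact ⟨(h.abs_re_le hP0).trans h2, (h.abs_im_le hP0).trans h2⟩
    obtain ⟨c1, c2⟩ := hbd hap (by rw [norm_pow, norm_root, one_pow]) (hFP i hi'.le)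
    obtain ⟨c3, c4⟩ := hbd hF (norm_root k) (by linarith)
    have l1 := (abs_sub _ _).trans_lt (hb.product_lt h10 c1 c3 c2 c4)
    have l2 := (abs_add_le _ _).trans_lt (hb.product_lt h10 c1 c4 c2 c3)
    have hs := hd.sizes
    refine Triple.seq (mulCode_spec (O := ((2 ^ k) ^ (4 * g + 22) : ℕ)) ((hf₃.var .a rfl).trans ha₂)
      ((hf₃.var .b rfl).trans hb₂) hc₃ hd₃ hi₃.scale
      hi₃.off ?_ hs.pos hs.lt hs.shift ?_ ?_) fun σ₄ ⟨hu, hv⟩ hf₄ => ?_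
    · rw [hi₃.shift]; push_cast; rfl
    · exact_mod_cast l1
    · exact_mod_cast l2
    refine Triple.of_wp ?_ (by decide)
    simp only [wp_seq, wp_assign, Expr.val_var, Expr.ok_var, true_and, St.set_var, St.set_arr,
      reduceCtorEq, if_true, if_false, hu, hv, hf₄.arr .twRe rfl, hf₄.arr .twIm rfl]
    refine ⟨hap.mul_root hs.pos hF hF3 ?_, hon₃⟩
    rw [hPc]
    refine le_trans (mul_le_mul (hFP i hi'.le) (by linarith : F ≤ N ^ 4) hF0 hE0) ?_
    rw [← pow_add]; exact h9

end ArrayLang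

/-! ### Precomputation and the transforms of all vectors -/

namespace ArrayLang

open Stmt Finset FFT MMVerification

variable {W : ℕ} {sz : Arr → ℕ}

/-- The kernel of the convolutions. -/
def residueKernel (n q i : ℕ) : ℕ := if i < n then kernel n i % q else 0

theorem loadKernelCode_spec {σ : St} {n t q g k : ℕ} (hd : Dims W sz n q g k)
    (hi : Init σ n t q g k) (hk : ∀ i : ℕ, i < n → σ.arr .ker i = (kernel n i % q : ℕ)) :
    Triple W sz loadKernelCode σ (2 ^ k * 25 + 3) fun σ' => ∀ x : ℕ, x < 2 ^ k →
      σ'.arr .sigRe x = residueKernel n q x * scaleOf g k ∧ σ'.arr .sigIm x = 0 := by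
  refine Triple.forTo (tb := 20) (fun i σ' => ∀ x : ℕ, x < i →
      σ'.arr .sigRe x = residueKernel n q x * scaleOf g k ∧ σ'.arr .sigIm x = 0) hi.len
      hd.len_lt rfl rfl (by decide) (by simp) ?_ (by omega) (fun _ h _ _ _ => h)
  intro i hiN σ₁ hinv hi₁ hfv hfa
  have hi' := hi.loop hfv
  have hker := hfa .ker rfl
  have hnW : (n : ℤ) < W := by
    have := hd.len_lt
    have := hd.le
    omega
  have hiW : (i : ℤ) < W := by exact_mod_cast hiN.trans hd.len_lt
  have hiN' : (i : ℤ) < (2 ^ k : ℕ) := by exact_mod_cast hiN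
  have post : ∀ σ₂ : St, σ₂.arr .sigIm = Function.update (σ₁.arr .sigIm) i 0 →
      σ₂.arr .sigRe = Function.update (σ₁.arr .sigRe) i (residueKernel n q i * scaleOf g k) →
      ∀ x : ℕ, x < i + 1 →
      σ₂.arr .sigRe x = residueKernel n q x * scaleOf g k ∧ σ₂.arr .sigIm x = 0 := by
    intro σ₂ h1 h2 x hx
    rw [h1, h2]
    rcases eq_or_ne x i with rfl | hxi
    · simp
    · simpa [Function.update_apply, hxi] using hinv x (by omega)
  refine Triple.of_wp ?_ (by decide)
  simp only [wp_seq, wp_ite, wp_put, Test.ok_lt, Expr.val_var, Expr.ok_var, hi₁, hi'.n,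
    Test.holds_lt, Expr.val_zero, Expr.ok_zero, Expr.ok_mul, Expr.ok_get, Expr.val_mul,
    Expr.val_get, St.put_var, hd.sigRe, hd.sigIm, hd.ker, true_and, hi'.scale, hker, and_true]
  refine ⟨⟨⟨by omega, hiW⟩, by omega, hnW⟩, fun hlt => ⟨⟨by omega, hlt⟩, ⟨by omega, hiN'⟩,
    ⟨by omega, hiN'⟩, post _ ?_ ?_⟩, fun hlt => ⟨⟨by omega, hiN'⟩, ⟨by omega, hiN'⟩, post _ ?_ ?_⟩⟩
  · simp [St.put]
  · have : i < n := by exact_mod_cast hlt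
    simp [St.put, residueKernel, this, hk i this]
  · simp [St.put]
  · have : ¬ i < n := by exact_mod_cast hlt
    simp [St.put, residueKernel, this]

theorem saveKernelCode_spec {σ : St} {n t q g k : ℕ} (hd : Dims W sz n q g k)
    (hi : Init σ n t q g k) :
    Triple W sz saveKernelCode σ (2 ^ k * 20 + 3) fun σ' => ∀ x : ℕ, x < 2 ^ k →
      σ'.arr .kerRe x = σ.arr .sigRe x ∧ σ'.arr .kerIm x = σ.arr .sigIm x := by
  refine Triple.forTo (tb := 15) (fun i σ' => ∀ x : ℕ, x < i →
      σ'.arr .kerRe x = σ.arr .sigRe x ∧ σ'.arr .kerIm x = σ.arr .sigIm x) hi.len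
      hd.len_lt rfl rfl (by decide) (by simp) ?_ (by omega) (fun _ h _ _ _ => h)
  intro i hiN σ₁ hinv hi₁ hfv hfa
  have hr := hfa .sigRe rfl
  have him := hfa .sigIm rfl
  have hiN' : (i : ℤ) < (2 ^ k : ℕ) := by exact_mod_cast hiN
  refine Triple.of_wp ?_ (by decide)
  simp only [wp_seq, wp_put, Expr.val_var, Expr.ok_var, hi₁, Expr.ok_get, Expr.val_get, St.put_var,
    hd.sigRe, hd.sigIm, hd.kerRe, hd.kerIm, true_and]
  refine ⟨⟨by omega, hiN'⟩, ⟨by omega, hiN'⟩, ⟨by omega, hiN'⟩, ⟨by omega, hiN'⟩, fun x hx => ?_⟩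
  rcases eq_or_ne x i with rfl | hxi
  · simp [hr, him]
  · simpa [hxi] using hinv x (by omega)

/-- Computes all tables. -/
def tableCode : Stmt :=
  factCode ;; kernelCode ;; rootCode ;; powersCode ;; loadKernelCode ;; forwardCode ;; saveKernelCode

theorem tableCode_spec {σ : St} {n t q g k : ℕ} (hd : Dims W sz n q g k) (hi : Init σ n t q g k) :
    Triple W sz tableCode σ ((100 * g + 2000) * (2 ^ k * k)) fun σ' =>
      Tables σ' g k (residueKernel n q) ∧
      ∀ i : ℕ, i < n → σ'.arr .fact i = (i.factorial % q : ℕ) := by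
  have hq0 : 0 < q := by have := hd.q_gt; omega
  refine (Triple.seq (t₂ := (n * 25 + 10) + ((k * (((2 * g + 16) * k + 1) * 25 + 35) + 15) +
      ((2 ^ k * 50 + 20) + ((2 ^ k * 25 + 3) + ((k * (2 ^ (k - 1) * 107 + 20) + 10) +
        (2 ^ k * 20 + 3))))))
    (factCode_spec hd.pos hi.n hi.q hd.q_gt hd.q_lt hd.fact) fun σ₁ h₁ hf₁ => ?_).mono ?_
      fun _ h _ => h
  swap
  · have h1 := hd.le
    have h2 := hd.two_le
    have h3 := hd.four_le
    have h4 : k ≤ 2 ^ k := Nat.lt_two_pow_self.le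
    have h5 := hd.eq_two_mul
    have h6 := Nat.mul_le_mul_right k h4
    obtain ⟨M, hM⟩ : ∃ M, M = 2 ^ (k - 1) := ⟨_, rfl⟩
    rw [← hM] at h5 ⊢
    obtain ⟨N, hN⟩ : ∃ N, N = 2 ^ k := ⟨_, rfl⟩
    rw [← hN] at h1 h3 h5 h6 ⊢
    -- Every term is compared with `N * k`; the square roots contribute `g * k ^ 2`, absorbed by `k
    -- ≤ N`.
    have h7 : 2 * N ≤ N * k := by rw [mul_comm]; exact Nat.mul_le_mul_left _ h2
    have h8 : k * M * 2 = N * k := by rw [h5]; ring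
    have h9 : g * (k * k) ≤ g * (N * k) := Nat.mul_le_mul_left _ h6
    have h10 : k * 4 ≤ N * k := by rw [mul_comm]; exact Nat.mul_le_mul_right _ h3
    have e : n * 25 + 10 + (n * 25 + 10 + ((k * (((2 * g + 16) * k + 1) * 25 + 35) + 15) +
      ((N * 50 + 20) + ((N * 25 + 3) + ((k * (M * 107 + 20) + 10) + (N * 20 + 3)))))) =
      50 * n + 71 + 50 * (g * (k * k)) + 400 * (k * k) + 80 * k + 95 * N + 107 * (k * M) := by ring
    rw [e]
    have e' : (100 * g + 2000) * (N * k) = 100 * (g * (N * k)) + 2000 * (N * k) := by ring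
    rw [e']
    omega
  have hi₁ := hi.frame hf₁
  refine Triple.seq (kernelCode_spec hi₁.n hi₁.q hd.q_gt hd.q_lt hd.ker) fun σ₂ h₂ hf₂ => ?_
  have hi₂ := hi₁.frame hf₂
  refine Triple.seq (rootCode_spec hd hi₂) fun σ₃ h₃ hf₃ => ?_
  have hi₃ := hi₂.frame hf₃
  refine Triple.seq (powersCode_spec hd hi₃ h₃) fun σ₄ h₄ hf₄ => ?_
  have hi₄ := hi₃.frame hf₄
  refine Triple.seq (loadKernelCode_spec hd hi₄ (by rwa [hf₄.arr .ker rfl, hf₃.arr .ker rfl]))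
    fun σ₅ h₅ hf₅ => ?_
  have hi₅ := hi₄.frame hf₅
  refine Triple.seq (forwardCode_spec' hd hi₅ (by rwa [hf₅.arr .twRe rfl, hf₅.arr .twIm rfl])
    (fun x _ => ?_) h₅) fun σ₆ h₆ hf₆ => ?_
  · rw [residueKernel]
    split_ifs
    · exact (Nat.mod_lt _ hq0).le.trans hd.q_le
    · exact Nat.zero_le _
  refine (saveKernelCode_spec hd (hi₅.frame hf₆)).mono le_rfl fun σ₇ h₇ hf₇ => ⟨⟨?_, ?_⟩, ?_⟩
  · rwa [hf₇.arr .twRe rfl, hf₇.arr .twIm rfl, hf₆.arr .twRe rfl, hf₆.arr .twIm rfl,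
      hf₅.arr .twRe rfl, hf₅.arr .twIm rfl]
  · intro x hx
    rw [(h₇ x hx).1, (h₇ x hx).2]
    exact h₆ x hx
  · rwa [hf₇.arr .fact rfl, hf₆.arr .fact rfl, hf₅.arr .fact rfl, hf₄.arr .fact rfl,
      hf₃.arr .fact rfl, hf₂.arr .fact rfl]

section

open Var

/-- Transforms all vectors. -/
def transformCode : Stmt := forTo j vecs convCode

end

/-- In the convolution at `n - 1 - s`, summing backwards pairs the original entry `s + i` with the
kernel at `i`; the reductions modulo `q` disappear in `ZMod q`. -/
theorem conv_residueKernel {n q s : ℕ} (v : ℕ → ℕ) (hs : s < n) :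
    ((conv (revProd n q v fun i => i.factorial % q) (residueKernel n q) (n - 1 - s) % q : ℕ) :
      ZMod q) = momentTransform n (fun i => (v i : ZMod q)) s := by
  rw [ZMod.natCast_mod, conv, momentTransform, ← sum_range_reflect, Nat.cast_sum]
  refine sum_congr (by congr 1; omega) fun i hi => ?_
  have hi := mem_range.1 hi
  rw [revProd, if_pos (by omega), residueKernel, if_pos (by omega)]
  have e1 : n - 1 - (n - 1 - s + 1 - 1 - i) = s + i := by omega
  have e2 : n - 1 - s - (n - 1 - s + 1 - 1 - i) = i := by omega
  rw [e1, e2]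
  simp

/-- The result of transforming the vector `v`. -/
def transformed (n q : ℕ) (v : ℕ → ℕ) (s : ℕ) : ℕ :=
  conv (revProd n q v fun i => i.factorial % q) (residueKernel n q) (n - 1 - s) % q

theorem transformCode_spec {σ : St} {n t q g k : ℕ} {v : ℕ → ℕ → ℕ} (hd : Dims W sz n q g k)
    (hi : Init σ n t q g k) (hT : Tables σ g k (residueKernel n q))
    (hv : ∀ j < 4 * n, ∀ i < n, σ.arr .vec (j * n + i : ℕ) = v j i ∧ v j i < q)
    (hf : ∀ i : ℕ, i < n → σ.arr .fact i = (i.factorial % q : ℕ)) :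
    Triple W sz transformCode σ (4 * n * (200 * (2 ^ k * k) + 5) + 3) fun σ' =>
      ∀ j < 4 * n, ∀ i < n, σ'.arr .vec (j * n + i : ℕ) = transformed n q (v j) i := by
  have hq0 : 0 < q := by have := hd.q_gt; omega
  have hW : 4 * n < W := by
    have h1 := hd.word_le (c := 4) (a := 1) (b := 0) 1 (by norm_num) (by norm_num) (by norm_num)
    have := hd.le
    have := hd.four_le
    simp only [pow_one, pow_zero, mul_one] at h1
    omega
  -- Each vector is overwritten by its own transform, and the segments of different vectors are
  -- disjoint.
  refine Triple.forTo (tb := 200 * (2 ^ k * k)) (fun m σ' => ∀ j < 4 * n, ∀ i < n,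
    σ'.arr .vec (j * n + i : ℕ) = if j < m then (transformed n q (v j) i : ℤ) else v j i) hi.vecs hW rfl
    rfl (by decide) ?_ ?_ le_rfl ?_
  · intro j hj i hi
    simpa using (hv j hj i hi).1
  · intro m hm σ₁ hinv hj₁ hfv hfa
    have hi₁ := hi.loop hfv
    refine (convCode_spec (v := v m) hd hi₁ (hT.of_eq (hfa _ rfl) (hfa _ rfl) (hfa _ rfl) (hfa _ rfl))
      hj₁ hm (fun i hi => ⟨by simpa using hinv m hm i hi, (hv m hm i hi).2⟩)
      (fun i hi => ⟨by rw [hfa .fact rfl, hf i hi], Nat.mod_lt _ hq0⟩) ?_ ?_).mono le_rfl ?_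
    · intro i
      rw [residueKernel]
      split_ifs
      · exact (Nat.mod_lt _ hq0).le.trans hd.q_le
      · exact Nat.zero_le _
    · intro i hi
      rw [residueKernel, if_neg (by omega)]
    · intro σ₂ h₂ _ j hj i hi
      rw [St.set_arr, h₂]
      have hiff : (m * n ≤ j * n + i ∧ j * n + i < (m + 1) * n) ↔ j = m := by
        constructor
        · rintro ⟨h1, h2⟩
          have h3 : m < j + 1 := by
            by_contra! h
            have := Nat.mul_le_mul_right n h
            rw [add_mul] at this
            omega
          have h4 : j < m + 1 := by
            by_contra! h
            have := Nat.mul_le_mul_right n h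
            omega
          omega
        · rintro rfl
          rw [add_mul]
          omega
      simp only [hiff]
      rcases eq_or_ne j m with rfl | hjm
      · rw [if_pos rfl, if_pos (by omega), Nat.add_sub_cancel_left]
        rfl
      · rw [if_neg hjm, hinv j hj i hi]
        have : j < m + 1 ↔ j < m := by omega
        simp only [this]
  · intro σ₁ h _ _ _ j hj i hi
    rw [h j hj i hi, if_pos hj]

end ArrayLang

/-! ### Setting up the vectors and checking the moments -/

namespace ArrayLang

open Stmt Finset FFT MMVerification

variable {W : ℕ} {sz : Arr → ℕ}

section

open Var

/-- Writes the columns of `[A | -C]` and the rows of `[B; 1]` as vectors of residues. -/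
def vectorCode : Stmt :=
  forTo l nn ((assign i (l / n) ;; assign j (l % n) ;; assign x (j * n + i)) ;;
    put .vec x ((.get .input l + q) % q) ;;
    put .vec (nn + x) ((q - .get .input (2 * nn + l)) % q) ;;
    put .vec (2 * nn + l) ((.get .input (nn + l) + q) % q) ;;
    .ite (.eq i j) (put .vec (3 * nn + l) 1) (put .vec (3 * nn + l) 0))

/-- One of the values to be compared with zero, into `a`. -/
def dotCode : Stmt :=
  assign a 0 ;;
  forTo l cols (assign a ((a + .get .vec (l * n + i) * .get .vec ((cols + l) * n + j)) % q))

/-- Compares all necessary values with zero. -/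
def verifyCode : Stmt :=
  assign res 1 ;;
  forTo i n ((assign bound (t / (i + 1)) ;; .ite (.lt n bound) (assign bound n) .skip) ;;
    forTo j bound (dotCode ;; .ite (.eq a 0) .skip (assign res 0)))

end

theorem pair_eq_iff {n i j i' j' : ℕ} (hj : j < n) (hj' : j' < n) :
    i * n + j = i' * n + j' ↔ i = i' ∧ j = j' := by
  refine ⟨fun h => ?_, fun ⟨h1, h2⟩ => by rw [h1, h2]⟩
  have hn : 0 < n := by omega
  have h1 : (i * n + j) / n = i := by
    rw [mul_comm, Nat.mul_add_div hn, Nat.div_eq_of_lt hj, add_zero]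
  have h2 : (i' * n + j') / n = i' := by
    rw [mul_comm, Nat.mul_add_div hn, Nat.div_eq_of_lt hj', add_zero]
  have : i = i' := by rw [← h1, h, h2]
  subst this
  exact ⟨rfl, by omega⟩

theorem pair_lt {n i j : ℕ} (hi : i < n) (hj : j < n) : i * n + j < n * n := by
  have := Nat.mul_le_mul_right n hi
  rw [Nat.succ_mul] at this
  omega

/-- The contents of the four blocks of vectors at positions `x`, `y`. -/
def Blocks (n q : ℕ) (inp vec : ℤ → ℤ) (i j : ℕ) : Prop :=
  vec (j * n + i : ℕ) = inp (i * n + j : ℕ) % q ∧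
  vec (n * n + (j * n + i) : ℕ) = -inp (2 * (n * n) + (i * n + j) : ℕ) % q ∧
  vec (2 * (n * n) + (i * n + j) : ℕ) = inp (n * n + (i * n + j) : ℕ) % q ∧
  vec (3 * (n * n) + (i * n + j) : ℕ) = if i = j then 1 else 0

/-- Input entries may be negative but are at most `q` in absolute value, so adding `q` or
subtracting from `q` makes the dividend nonnegative. `A` and `C` are transposed, since their columns
are needed as contiguous vectors. -/
theorem vectorCode_spec {σ : St} {n t q g k : ℕ} (hd : Dims W sz n q g k)
    (hi : Init σ n t q g k) (hin : ∀ x : ℕ, x < 3 * (n * n) → |σ.arr .input x| ≤ q) :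
    Triple W sz vectorCode σ (n * n * 80 + 3) fun σ' => ∀ i < n, ∀ j < n,
      Blocks n q (σ.arr .input) (σ'.arr .vec) i j := by
  have hq0 : (0 : ℤ) < q := by have := hd.q_gt; omega
  have hqW : q * 4 < W := by
    have h1 := hd.word_le (c := 4) (a := 1) (b := 1) 1 (by norm_num) (by norm_num) (by norm_num)
    have := hd.q_le
    have := hd.four_le
    simp only [pow_one] at h1
    nlinarith
  have hn2 : n * n < W := by
    have := hd.q_lt
    have := Nat.mul_le_mul hd.q_gt.le hd.q_gt.le
    omega
  have hnn : n ≤ n * n := Nat.le_mul_self n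
  refine Triple.forTo (tb := 75) (fun m σ' => ∀ i < n, ∀ j < n, i * n + j < m →
    Blocks n q (σ.arr .input) (σ'.arr .vec) i j) hi.nn hn2 rfl rfl (by decide) (by simp) ?_
    (by omega) (fun σ' h _ _ _ i hi j hj => h i hi j hj (pair_lt hi hj))
  intro m hm σ₁ hinv hl hfv hfa
  have hi₁ := hi.loop hfv
  have hinp := hfa .input rfl
  have hn0 : 0 < n := hd.pos
  obtain ⟨I, hI⟩ : ∃ I, I = m / n := ⟨_, rfl⟩
  obtain ⟨J, hJ⟩ : ∃ J, J = m % n := ⟨_, rfl⟩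
  have hIn : I < n := hI ▸ Nat.div_lt_of_lt_mul hm
  have hJn : J < n := hJ ▸ Nat.mod_lt _ hn0
  have hm' : m = I * n + J := by rw [hI, hJ, mul_comm, Nat.div_add_mod]
  obtain ⟨Y, hY⟩ : ∃ Y, Y = J * n + I := ⟨_, rfl⟩
  have hYn : Y < n * n := hY ▸ pair_lt hJn hIn
  refine (Triple.seq (t₁ := 15) (t₂ := 60) (P := fun σ₂ => σ₂.var .i = I ∧ σ₂.var .j = J ∧
    σ₂.var .x = Y) (Triple.of_wp ?_ (by decide)) fun σ₂ ⟨h1, h2, h3⟩ hf₂ => ?_).mono (by omega)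
    fun _ h _ => h
  · simp only [wp_seq, wp_assign, Expr.val_var, Expr.ok_var, Expr.ok_div, Expr.ok_mod, Expr.ok_mul,
      Expr.ok_add, Expr.val_add, Expr.val_mul, Expr.val_div, Expr.val_mod, St.set_var, if_true,
      if_false, reduceCtorEq, true_and, hl, hi₁.n]
    rw [hI, hJ, hY, hI, hJ]
    push_cast
    simp only [and_true]
    omega
  have hi₂ := hi₁.frame hf₂
  have hl₂ : σ₂.var .l = m := (hf₂.var .l rfl).trans hl
  have hin₂ : σ₂.arr .input = σ.arr .input := (hf₂.arr .input rfl).trans hinp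
  have hv₂ : σ₂.arr .vec = σ₁.arr .vec := hf₂.arr .vec rfl
  have b1 := abs_le.1 (hin m (by omega))
  have b2 := abs_le.1 (hin (2 * (n * n) + m) (by omega))
  have b3 := abs_le.1 (hin (n * n + m) (by omega))
  have post : ∀ σ₃ : St, σ₃.arr .vec = Function.update (Function.update (Function.update
      (Function.update (σ₁.arr .vec) Y (σ.arr .input m % q))
      (n * n + Y : ℕ) (-σ.arr .input (2 * (n * n) + m : ℕ) % q))
      (2 * (n * n) + m : ℕ) (σ.arr .input (n * n + m : ℕ) % q))
      (3 * (n * n) + m : ℕ) (if I = J then 1 else 0) →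
      ∀ i < n, ∀ j < n, i * n + j < m + 1 → Blocks n q (σ.arr .input) (σ₃.arr .vec) i j := by
    intro σ₃ h i hi j hj hij
    have hlt1 := pair_lt hi hj
    have hlt2 := pair_lt hj hi
    by_cases hE : i = I ∧ j = J
    · obtain ⟨rfl, rfl⟩ := hE
      rw [Blocks, h, ← hm', ← hY]
      simp only [Function.update_apply, Nat.cast_inj]
      refine ⟨?_, ?_, ?_, ?_⟩
      · rw [if_neg (by omega), if_neg (by omega), if_neg (by omega), if_pos trivial]
      · rw [if_neg (by omega), if_neg (by omega), if_pos trivial]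
      · rw [if_neg (by omega), if_pos trivial]
      · rw [if_pos trivial]
    · have hne1 : i * n + j ≠ m := by rw [hm', Ne, pair_eq_iff hj hJn]; exact hE
      have hne2 : j * n + i ≠ Y := by rw [hY, Ne, pair_eq_iff hi hIn]; tauto
      have hinv' := hinv i hi j hj (by omega)
      rw [Blocks] at hinv' ⊢
      rw [h]
      generalize i * n + j = b at *
      generalize j * n + i = a at *
      simp only [Function.update_apply, Nat.cast_inj]
      -- The offsets `0`, `n * n`, `2 * (n * n)`, `3 * (n * n)` separate the blocks, so none of the
      -- four stores hits any of the four older cells.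
      rw [if_neg (by omega), if_neg (by omega), if_neg (by omega), if_neg (by omega),
        if_neg (by omega), if_neg (by omega), if_neg (by omega), if_neg (by omega),
        if_neg (by omega), if_neg (by omega), if_neg (by omega), if_neg (by omega),
        if_neg (by omega), if_neg (by omega), if_neg (by omega), if_neg (by omega)]
      exact hinv'
  have e0 : ((n * n : ℕ) : ℤ) + Y = (n * n + Y : ℕ) := by push_cast; rfl
  have e1 : 2 * ((n * n : ℕ) : ℤ) + m = (2 * (n * n) + m : ℕ) := by push_cast; rfl
  have e2 : ((n * n : ℕ) : ℤ) + m = (n * n + m : ℕ) := by push_cast; rfl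
  have e3 : 3 * ((n * n : ℕ) : ℤ) + m = (3 * (n * n) + m : ℕ) := by push_cast; rfl
  have e4 : ((q : ℤ) - σ.arr .input (2 * (n * n) + m : ℕ)) % q
      = -σ.arr .input (2 * (n * n) + m : ℕ) % q := by
    rw [sub_eq_add_neg, Int.add_emod_left]
  have hqW' : (q : ℤ) * 4 < W := by exact_mod_cast hqW
  refine Triple.of_wp ?_ (by decide)
  simp only [wp_seq, wp_put, wp_ite, Expr.val_var, Expr.ok_var, Expr.ok_mod, Expr.ok_get,
      Expr.ok_add, Expr.val_add, Expr.val_mul, Expr.val_get, Expr.val_mod, Expr.ok_mul, Expr.ok_sub,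
      Expr.val_sub, Expr.ok_two, Expr.val_two, Expr.ok_three, Expr.val_three, Expr.ok_one,
      Expr.val_one, Expr.ok_zero, Expr.val_zero, Test.ok_eq, Test.holds_eq, St.put_var,
      St.put_arr, reduceCtorEq, false_and, if_false, true_and, hl₂, h1, h2, h3,
      hi₂.nn, hi₂.q, hin₂, hd.vec, hd.input, e0, e1, e2, e3, e4, Int.add_emod_right, and_true]
  refine ⟨⟨⟨by omega, by omega⟩, ⟨by omega, by omega⟩, by omega, by omega⟩, ⟨by omega, by omega⟩,
    ⟨⟨by omega, by omega⟩, ⟨by omega, by omega⟩, by omega, by omega⟩, ⟨by omega, by omega⟩,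
    ⟨⟨by omega, by omega⟩, ⟨by omega, by omega⟩, by omega, by omega⟩, ⟨by omega, by omega⟩,
    ⟨⟨by omega, by omega⟩, by omega, by omega⟩, fun h => ⟨⟨by omega, by omega⟩, post _ ?_⟩,
    fun h => ⟨⟨by omega, by omega⟩, post _ ?_⟩⟩
  · simp [St.put, hv₂, Nat.cast_inj.1 h]
  · have : ¬ I = J := fun h' => h (by rw [h'])
    simp [St.put, hv₂, this]

theorem dotCode_spec {σ : St} {n t q g k i j : ℕ} {V : ℕ → ℕ → ℕ} (hd : Dims W sz n q g k)
    (hi : Init σ n t q g k) (hV : ∀ l < 4 * n, ∀ i < n, σ.arr .vec (l * n + i : ℕ) = V l i)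
    (hVq : ∀ l < 4 * n, ∀ i < n, V l i < q)
    (hvi : σ.var .i = i) (hvj : σ.var .j = j) (hin : i < n) (hjn : j < n) :
    Triple W sz dotCode σ (2 * n * 30 + 5) fun σ' =>
      σ'.var .a = ((∑ l ∈ range (2 * n), V l i * V (2 * n + l) j) % q : ℕ) := by
  have hq0 : 0 < q := by have := hd.q_gt; omega
  have h2n : 2 * n < W := by
    have := hd.len_lt
    have := hd.le
    omega
  -- Room for a residue plus a product of two residues; reducing at every step keeps the accumulator
  -- below `q`.
  have hqq : 2 * (q * q) ≤ W := by
    have h1 := hd.word_le (c := 4) (a := 0) (b := 2) 1 (by norm_num) (by norm_num) (by norm_num)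
    have h2 := Nat.mul_le_mul hd.q_le hd.q_le
    simp only [pow_zero, mul_one, pow_two] at h1
    omega
  have hqq' : q ≤ q * q := Nat.le_mul_self q
  refine (Triple.seq (t₁ := 2) (t₂ := 2 * n * 30 + 3) (P := fun σ' => σ'.var .a = 0)
    (Triple.of_wp (by simp)) fun σ₁ h₁ hf₁ => ?_).mono (by omega) fun _ h _ => h
  have hi₁ := hi.frame hf₁
  refine Triple.forTo (tb := 25) (fun m σ' =>
      σ'.var .a = ((∑ l ∈ range m, V l i * V (2 * n + l) j) % q : ℕ)) hi₁.cols h2n rfl rfl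
      (by decide) (by simp [h₁]) ?_ (by omega) (fun _ h _ _ _ => h)
  intro l hl σ₂ ha hl₂ hfv hfa
  have hi₂ := hi₁.loop hfv
  have hvi₂ : σ₂.var .i = i := by rw [hfv .i rfl (by decide), hf₁.var .i rfl, hvi]
  have hvj₂ : σ₂.var .j = j := by rw [hfv .j rfl (by decide), hf₁.var .j rfl, hvj]
  have hvec : σ₂.arr .vec = σ.arr .vec := by rw [hfa .vec rfl, hf₁.arr .vec rfl]
  obtain ⟨S, hS⟩ : ∃ S, S = ∑ l ∈ range l, V l i * V (2 * n + l) j := ⟨_, rfl⟩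
  rw [← hS] at ha
  have e1 : (l : ℤ) * n + i = (l * n + i : ℕ) := by push_cast; rfl
  have e2 : ((2 * n : ℕ) + (l : ℤ)) * n + j = ((2 * n + l) * n + j : ℕ) := by push_cast; rfl
  have s1 : l * n + i < 4 * (n * n) := by
    have := Nat.mul_le_mul_right n (show l + 1 ≤ 4 * n by omega)
    rw [add_mul, mul_assoc] at this
    omega
  have s2 : (2 * n + l) * n + j < 4 * (n * n) := by
    have := Nat.mul_le_mul_right n (show 2 * n + l + 1 ≤ 4 * n by omega)
    rw [add_mul, mul_assoc] at this
    omega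
  have v1 := hV l (by omega) i hin
  have v2 := hV (2 * n + l) (by omega) j hjn
  have q1 := hVq l (by omega) i hin
  have q2 := hVq (2 * n + l) (by omega) j hjn
  have hlt : S % q + V l i * V (2 * n + l) j < W := by
    have h1 : S % q < q := Nat.mod_lt _ hq0
    have h2 := Nat.mul_le_mul q1.le q2.le
    omega
  have hlt' : ((S % q : ℕ) : ℤ) + V l i * V (2 * n + l) j < W := by exact_mod_cast hlt
  refine Triple.of_wp ?_ (by decide)
  simp only [wp_assign, Expr.val_var, Expr.ok_var, Expr.ok_mod, Expr.ok_get,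
      Expr.ok_add, Expr.val_add, Expr.val_mul, Expr.val_get, Expr.val_mod, Expr.ok_mul,
      St.set_var, reduceCtorEq, if_false, if_true, true_and, hl₂, hi₂.n, hi₂.cols, hi₂.q, hvi₂,
      hvj₂, e1, e2, hvec, v1, v2, ha, hd.vec]
  refine ⟨⟨⟨⟨by omega, by omega⟩, by omega, by omega⟩, ⟨by positivity, hlt'⟩, by omega, by omega⟩, ?_⟩
  rw [sum_range_succ, ← hS]
  push_cast
  simp

/-- This harmonic sum bounds the number of pairs `(s, u)` with `(s + 1) * (u + 1) ≤ t` and is the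
source of the logarithm in the term `t * n`. -/
theorem sum_div_le (n t : ℕ) : ∑ s ∈ range n, t / (s + 1) ≤ t * (Nat.log 2 n + 2) := by
  rcases Nat.eq_zero_or_pos n with rfl | hn
  · simp
  have h1 : ((∑ s ∈ range n, t / (s + 1) : ℕ) : ℝ) ≤ t * (harmonic n : ℚ) := by
    rw [harmonic, Rat.cast_sum, mul_sum, Nat.cast_sum]
    refine sum_le_sum fun s _ => ?_
    refine Nat.cast_div_le.trans (le_of_eq ?_)
    push_cast
    rw [div_eq_mul_inv]
  have h2 := harmonic_le_one_add_log n
  have h3 : Real.log n ≤ Nat.log 2 n + 1 := by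
    have h4 : n < 2 ^ (Nat.log 2 n + 1) := Nat.lt_pow_succ_log_self (by norm_num) n
    have h5 : Real.log n ≤ Real.log ((2 : ℝ) ^ (Nat.log 2 n + 1)) :=
      Real.log_le_log (by exact_mod_cast hn) (by exact_mod_cast h4.le)
    rw [Real.log_pow] at h5
    have h6 : Real.log 2 ≤ 1 := by linarith [Real.log_two_lt_d9]
    have h7 : ((Nat.log 2 n + 1 : ℕ) : ℝ) * Real.log 2 ≤ (Nat.log 2 n + 1 : ℕ) * 1 :=
      mul_le_mul_of_nonneg_left h6 (by positivity)
    push_cast at h5 h7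
    linarith
  have h4 : (t : ℝ) * (harmonic n : ℚ) ≤ t * (Nat.log 2 n + 2) :=
    mul_le_mul_of_nonneg_left (by linarith) (by positivity)
  exact_mod_cast h1.trans h4

theorem verifyCode_spec {σ : St} {n t q g k : ℕ} {V : ℕ → ℕ → ℕ} (hd : Dims W sz n q g k)
    (hi : Init σ n t q g k) (hV : ∀ l < 4 * n, ∀ i < n, σ.arr .vec (l * n + i : ℕ) = V l i)
    (hVq : ∀ l < 4 * n, ∀ i < n, V l i < q) (ht : t ≤ n ^ 2) :
    Triple W sz verifyCode σ (t * (Nat.log 2 n + 2) * (n * 60 + 20) + n * 30 + 5) fun σ' =>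
      (σ'.var .res = 0 ∨ σ'.var .res = 1) ∧ (σ'.var .res = 1 ↔ ∀ s < n, ∀ u < n,
        (s + 1) * (u + 1) ≤ t → (∑ l ∈ range (2 * n), V l s * V (2 * n + l) u) % q = 0) := by
  have hq0 : 0 < q := by have := hd.q_gt; omega
  have htW : t < W := by
    have h1 := hd.q_lt
    have h2 := Nat.mul_le_mul hd.q_gt.le hd.q_gt.le
    rw [pow_two] at ht
    omega
  have hnW : n < W := by
    have := hd.len_lt
    have := hd.le
    omega
  have hqW : q < W := (Nat.le_mul_self q).trans_lt hd.q_lt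
  let D (s u : ℕ) : ℕ := (∑ l ∈ range (2 * n), V l s * V (2 * n + l) u) % q
  refine (Triple.seq (t₁ := 2) (t₂ := t * (Nat.log 2 n + 2) * (n * 60 + 20) + n * 30 + 3)
    (P := fun σ' => σ'.var .res = 1)
    (Triple.of_wp (by simp)) fun σ₁ h₁ hf₁ => ?_).mono (by omega) fun _ h _ => h
  have hi₁ := hi.frame hf₁
  -- The time bound must depend on `s`: a uniform bound per iteration would lose the harmonic
  -- saving.
  refine Triple.forTo' (tb := fun s => 25 + t / (s + 1) * (n * 60 + 20)) (fun s σ' =>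
      (σ'.var .res = 0 ∨ σ'.var .res = 1) ∧ (σ'.var .res = 1 ↔ ∀ s' < s, ∀ u < n,
        (s' + 1) * (u + 1) ≤ t → D s' u = 0)) hi₁.n hnW rfl rfl
      (by decide) (by simp [h₁]) ?_ ?_ (fun _ h _ _ _ => h)
  · intro s hs σ₂ ⟨hr, hr'⟩ hs₂ hfv hfa
    have hi₂ := hi₁.loop hfv
    obtain ⟨Q, hQ⟩ : ∃ Q, Q = t / (s + 1) := ⟨_, rfl⟩
    have htd : Q ≤ t := hQ ▸ Nat.div_le_self _ _
    have hsW : (s : ℤ) + 1 < W := by have := hd.len_lt; have := hd.le; omega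
    refine (Triple.seq (t₁ := 22) (t₂ := min Q n * (n * 60 + 20) + 3)
      (P := fun σ₃ => σ₃.var .bound = (min Q n : ℕ))
      (Triple.of_wp ?_ (by decide)) fun σ₃ h₃ hf₃ => ?_).mono ?_ fun _ h _ => h
    · have e : (t : ℤ) / (s + 1) = (Q : ℕ) := by rw [hQ]; push_cast; rfl
      simp only [wp_seq, wp_assign, wp_ite, wp_skip, Expr.val_var, Expr.ok_var, Expr.ok_div,
        Expr.ok_add, Expr.val_div, Expr.val_add, Expr.val_one, Expr.ok_one, Test.ok_lt,
        Test.holds_lt, St.set_var, reduceCtorEq, if_true, if_false, true_and, hi₂.t, hs₂, hi₂.n, e]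
      refine ⟨⟨⟨by omega, by omega⟩, by omega, by omega⟩, ⟨⟨by omega, by omega⟩, by omega, by omega⟩,
        fun h => ?_, fun h => ?_⟩
      · rw [min_eq_right (by omega)]
      · rw [min_eq_left (by omega)]
    · have hi₃ := hi₂.frame hf₃
      have hr₃ : σ₃.var .res = σ₂.var .res := hf₃.var .res rfl
      refine Triple.forTo (tb := n * 60 + 15) (fun u σ' =>
          (σ'.var .res = 0 ∨ σ'.var .res = 1) ∧ (σ'.var .res = 1 ↔ (∀ s' < s, ∀ u < n,
          (s' + 1) * (u + 1) ≤ t → D s' u = 0) ∧ ∀ u' < u, D s u' = 0)) h₃ (by omega)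
          rfl rfl (by decide)
          ⟨by simpa [hr₃] using hr, by simpa [hr₃] using hr'⟩ ?_ (le_of_eq (by ring)) ?_
      · intro u hu σ₄ ⟨h4, h4'⟩ hu₄ hfv₄ hfa₄
        have hi₄ := hi₃.loop hfv₄
        have hvec : σ₄.arr .vec = σ.arr .vec := by
          rw [hfa₄ .vec rfl, hf₃.arr .vec rfl, hfa .vec rfl, hf₁.arr .vec rfl]
        refine (Triple.seq (t₂ := 8) (dotCode_spec (i := s) (j := u) hd hi₄ (by rwa [hvec]) hVq ?_ hu₄
          hs (by omega)) fun σ₅ h₅ hf₅ => Triple.of_wp ?_ (by decide)).mono (by omega) fun _ h _ => h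
        · rw [hfv₄ .i rfl (by decide), hf₃.var .i rfl, hs₂]
        · have hr₅ : σ₅.var .res = σ₄.var .res := hf₅.var .res rfl
          have hDq : D s u < q := Nat.mod_lt _ hq0
          change σ₅.var .a = (D s u : ℕ) at h₅
          have hstep : (∀ u' < u + 1, D s u' = 0) ↔ (∀ u' < u, D s u' = 0) ∧ D s u = 0 := by
            constructor
            · exact fun h => ⟨fun u' hu' => h u' (by omega), h u (by omega)⟩
            · rintro ⟨h, h'⟩ u' hu'
              rcases Nat.lt_succ_iff_lt_or_eq.1 hu' with h'' | rfl
              · exact h u' h''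
              · exact h'
          simp only [wp_ite, wp_skip, wp_assign, Expr.val_var, Expr.ok_var, Test.ok_eq,
            Test.holds_eq, Expr.val_zero, Expr.ok_zero, St.set_var, reduceCtorEq, if_true, if_false,
            true_and, h₅, hr₅, hstep]
          refine ⟨⟨⟨by omega, by omega⟩, by omega, by omega⟩, fun h => ⟨h4, ?_⟩, fun h => ⟨.inl trivial, ?_⟩⟩
          · rw [h4']
            have : D s u = 0 := by exact_mod_cast h
            tauto
          · have : D s u ≠ 0 := by exact_mod_cast h
            refine iff_of_false (by norm_num) fun h => this h.2.2
      · intro σ₄ ⟨h4, h4'⟩ _ _ _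
        refine ⟨by simpa using h4, ?_⟩
        rw [St.set_var, if_neg (by decide), h4']
        constructor
        · rintro ⟨h, h'⟩ s' hs' u hu hsu
          rcases Nat.lt_succ_iff_lt_or_eq.1 hs' with h'' | rfl
          · exact h s' h'' u hu hsu
          · refine h' u (lt_min ?_ hu)
            rw [hQ, ← Nat.succ_le_iff, Nat.le_div_iff_mul_le (by omega), mul_comm]
            exact hsu
        · intro h
          refine ⟨fun s' hs' => h s' (by omega), fun u hu => ?_⟩
          refine h s (by omega) u (by omega) ?_
          rw [mul_comm, ← Nat.le_div_iff_mul_le (by omega), ← hQ]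
          omega
    · have := Nat.mul_le_mul_right (n * 60 + 20) (min_le_left Q n)
      rw [hQ] at this ⊢
      omega
  · rw [sum_congr rfl (g := fun s => 30 + t / (s + 1) * (n * 60 + 20)) (fun _ _ => by ring),
      sum_add_distrib, ← sum_mul]
    have := Nat.mul_le_mul_right (n * 60 + 20) (sum_div_le n t)
    simp only [sum_const, card_range, smul_eq_mul]
    omega

end ArrayLang

/-! ### Correctness of the main computation -/

namespace ArrayLang

open Stmt Finset FFT MMVerification

variable {W : ℕ} {sz : Arr → ℕ}

/-- The algorithm, up to the computation of the parameters. -/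
def mainCode : Stmt := vectorCode ;; tableCode ;; transformCode ;; verifyCode

theorem workVec_of_blocks {n q : ℕ} (hq : 1 < q) (A B C : Matrix (Fin n) (Fin n) ℤ)
    {inp vec : ℤ → ℤ}
    (hA : ∀ x : ℕ, x < n * n → inp x = rowMajor A x)
    (hB : ∀ x : ℕ, x < n * n → inp (n * n + x : ℕ) = rowMajor B x)
    (hC : ∀ x : ℕ, x < n * n → inp (2 * (n * n) + x : ℕ) = rowMajor C x)
    (h : ∀ i < n, ∀ j < n, Blocks n q inp vec i j) {j i : ℕ} (hj : j < 4 * n) (hi : i < n) :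
    vec (j * n + i : ℕ) = workVec A B C j i % q := by
  rw [workVec]
  split_ifs with h1 h2 h3 h4
  · rw [(h i hi j h1).1, hA _ (pair_lt hi h1)]
  · obtain ⟨b, rfl⟩ := Nat.exists_eq_add_of_le (not_lt.1 h1)
    have hb : b < n := by omega
    rw [add_mul, add_assoc, (h i hi b hb).2.1, hC _ (pair_lt hi hb), Nat.add_sub_cancel_left]
  · obtain ⟨b, rfl⟩ := Nat.exists_eq_add_of_le (not_lt.1 h2)
    have hb : b < n := by omega
    rw [add_mul, add_assoc, mul_assoc, (h b hb i hi).2.2.1, hB _ (pair_lt hb hi),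
      Nat.add_sub_cancel_left]
  · obtain ⟨b, rfl⟩ := Nat.exists_eq_add_of_le (not_lt.1 h3)
    have hb : b < n := by omega
    rw [Nat.add_sub_cancel_left] at h4
    rw [add_mul, add_assoc, mul_assoc, (h b hb i hi).2.2.2, if_pos h4,
      Int.emod_eq_of_lt (by norm_num) (by exact_mod_cast hq)]
  · obtain ⟨b, rfl⟩ := Nat.exists_eq_add_of_le (not_lt.1 h3)
    have hb : b < n := by omega
    rw [Nat.add_sub_cancel_left] at h4
    rw [add_mul, add_assoc, mul_assoc, (h b hb i hi).2.2.2, if_neg h4, Int.zero_emod]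

theorem mainCode_spec {σ : St} {n t q g k : ℕ} (hd : Dims W sz n q g k)
    (hi : Init σ n t q g k) (ht : t ≤ n ^ 2) (A B C : Matrix (Fin n) (Fin n) ℤ)
    (hin : ∀ x : ℕ, x < 3 * (n * n) → |σ.arr .input x| ≤ q)
    (hA : ∀ x : ℕ, x < n * n → σ.arr .input x = rowMajor A x)
    (hB : ∀ x : ℕ, x < n * n → σ.arr .input (n * n + x : ℕ) = rowMajor B x)
    (hC : ∀ x : ℕ, x < n * n → σ.arr .input (2 * (n * n) + x : ℕ) = rowMajor C x) :
    Triple W sz mainCode σ ((n * n * 80 + 3) + ((100 * g + 2000) * (2 ^ k * k) +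
      ((4 * n * (200 * (2 ^ k * k) + 5) + 3) +
        (t * (Nat.log 2 n + 2) * (n * 60 + 20) + n * 30 + 5)))) fun σ' =>
      (σ'.var .res = 0 ∨ σ'.var .res = 1) ∧ (σ'.var .res = 1 ↔ ∀ s < n, ∀ u < n,
        (s + 1) * (u + 1) ≤ t → checkValue A B C (ZMod q) s u = 0) := by
  have hq1 : 1 < q := by have := hd.q_gt; have := hd.pos; omega
  have hq0 : (0 : ℤ) < q := by omega
  -- Natural representatives of the residues: the transforms are specified over `ℕ`, the moments
  -- over `ZMod q`.
  let v (j i : ℕ) : ℕ := (workVec A B C j i % q).toNat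
  have hv : ∀ j i, (v j i : ℤ) = workVec A B C j i % q := fun j i =>
    Int.toNat_of_nonneg (Int.emod_nonneg _ hq0.ne')
  have hvq : ∀ j i, v j i < q := fun j i => by
    have := Int.emod_lt_of_pos (workVec A B C j i) hq0
    rw [← hv] at this
    exact_mod_cast this
  have hvz : ∀ j i, (v j i : ZMod q) = (workVec A B C j i : ZMod q) := fun j i => by
    have := congrArg (Int.cast : ℤ → ZMod q) (hv j i)
    rw [ZMod.intCast_mod] at this
    exact_mod_cast this
  refine Triple.seq (vectorCode_spec hd hi hin) fun σ₁ h₁ hf₁ => ?_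
  have hi₁ := hi.frame hf₁
  refine Triple.seq (tableCode_spec hd hi₁) fun σ₂ ⟨h₂, h₂'⟩ hf₂ => ?_
  have hi₂ := hi₁.frame hf₂
  refine Triple.seq (transformCode_spec (v := v) hd hi₂ h₂ (fun j hj i hi => ⟨?_, hvq j i⟩) h₂')
    fun σ₃ h₃ hf₃ => ?_
  · rw [hf₂.arr .vec rfl, hv]
    exact workVec_of_blocks hq1 A B C hA hB hC h₁ hj hi
  have hi₃ := hi₂.frame hf₃
  refine (verifyCode_spec hd hi₃ h₃ (fun l _ i _ => Nat.mod_lt _ (by omega)) ht).mono le_rfl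
    fun σ₄ ⟨h₄, h₄'⟩ _ => ⟨h₄, h₄'.trans ?_⟩
  refine forall₂_congr fun s hs => forall₂_congr fun u hu => forall_congr' fun _ => ?_
  rw [← Nat.dvd_iff_mod_eq_zero, ← ZMod.natCast_eq_zero_iff, checkValue]
  push_cast
  simp only [transformed, conv_residueKernel _ hs, conv_residueKernel _ hu, hvz]

end ArrayLang

/-! ### Choosing the prime and the transform length -/

namespace ArrayLang

open Stmt Finset FFT MMVerification

variable {W : ℕ} {sz : Arr → ℕ}

section

open Var

/-- Leaves in `a` whether `x` is prime. -/
def trialDivisionCode : Stmt :=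
  assign a 1 ;;
  forTo i x (.ite (.lt 1 i) (.ite (.eq (x % i) 0) (assign a 0) .skip) .skip)

/-- Leaves in `p` a prime number between `n` and `2 * n`. -/
def primeCode : Stmt :=
  assign p 0 ;;
  forTo j n (assign x (n + j + 1) ;; trialDivisionCode ;; .ite (.eq a 1) (assign p x) .skip)

/-- Leaves in `len` a power of two between `2 * n` and `4 * n`, and in `lg` its exponent. -/
def lengthCode : Stmt :=
  (assign len 4 ;; assign lg 2) ;;
  forTo i n (.ite (.lt len (2 * n)) (assign len (2 * len) ;; assign lg (lg + 1)) .skip)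

/-- Computes the other global variables from `n`, `p`, `len` and `lg`. -/
def derivedCode (g : ℕ) : Stmt :=
  assign nn (n * n) ;; assign q (Expr.pow p g) ;; assign hlen (len / 2) ;;
  assign scale (Expr.pow len (2 * g + 16)) ;; assign off (Expr.pow len (4 * g + 22)) ;;
  assign shift (off * scale) ;; assign half (scale / 2 * len) ;; assign total (scale * len) ;;
  assign vecs (4 * n) ;; assign cols (2 * n) ;; assign iters (.const (2 * g + 16) * lg + 1)

/-- Computes the addresses of the arrays. -/
def addressCode : Stmt :=
  assign u (3 * nn) ;; assign v (u + 4 * nn) ;; assign l (v + n) ;; assign m (l + n) ;;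
  assign st (m + len) ;; assign x (st + len) ;; assign y (x + len) ;; assign z (y + len) ;;
  assign a (z + len)

/-- Computes all parameters. -/
def paramCode (g : ℕ) : Stmt := primeCode ;; lengthCode ;; derivedCode g ;; addressCode

end

theorem trialDivisionCode_spec {σ : St} {x : ℕ} (hx : σ.var .x = x) (hx2 : 2 ≤ x) (hxW : x < W) :
    Triple W sz trialDivisionCode σ (x * 20 + 5) fun σ' =>
      (σ'.var .a = 0 ∨ σ'.var .a = 1) ∧ (σ'.var .a = 1 ↔ x.Prime) := by
  refine (Triple.seq (t₁ := 2) (t₂ := x * 20 + 3) (P := fun σ' => σ'.var .a = 1)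
    (Triple.of_wp (by simp)) fun σ₁ h₁ hf₁ => ?_).mono (by omega) fun _ h _ => h
  refine Triple.forTo (tb := 15) (fun i σ' => (σ'.var .a = 0 ∨ σ'.var .a = 1) ∧
    (σ'.var .a = 1 ↔ ∀ d < i, 1 < d → ¬ d ∣ x)) ((hf₁.var .x rfl).trans hx) hxW rfl rfl (by decide)
    (by simp [h₁]) ?_ (by omega) ?_
  · intro i hi σ₂ ⟨h2, h2'⟩ hi₂ hfv _
    have hx₂ : σ₂.var .x = x := by rw [hfv .x rfl (by decide), hf₁.var .x rfl, hx]
    have hstep : (∀ d < i + 1, 1 < d → ¬ d ∣ x) ↔ (∀ d < i, 1 < d → ¬ d ∣ x) ∧ (1 < i → ¬ i ∣ x) := by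
      constructor
      · exact fun h => ⟨fun d hd => h d (by omega), h i (by omega)⟩
      · rintro ⟨h, h'⟩ d hd
        rcases Nat.lt_succ_iff_lt_or_eq.1 hd with h'' | rfl
        · exact h d h''
        · exact h'
    have hdvd : (x : ℤ) % i = 0 ↔ i ∣ x := by
      rw [← Int.dvd_iff_emod_eq_zero]; exact Int.natCast_dvd_natCast
    refine Triple.of_wp ?_ (by decide)
    simp only [wp_ite, wp_skip, wp_assign, Expr.val_var, Expr.ok_var, Test.ok_eq, Test.ok_lt,
      Test.holds_eq, Test.holds_lt, Expr.val_zero, Expr.ok_zero, Expr.val_one, Expr.ok_one,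
      Expr.ok_mod, Expr.val_mod, St.set_var, reduceCtorEq, if_true, if_false, true_and, hi₂, hx₂,
      hstep, hdvd]
    have hiW : (i : ℤ) < W := by omega
    have hxW' : (x : ℤ) < W := by exact_mod_cast hxW
    refine ⟨⟨⟨by norm_num, by omega⟩, by omega, hiW⟩, fun h1 => ⟨⟨⟨⟨by omega, hxW'⟩, by omega, hiW⟩,
      ⟨Int.emod_nonneg _ (by omega), (Int.emod_lt_of_pos _ (by omega)).trans hiW⟩, by omega,
      by omega⟩, fun h => ⟨.inl trivial, ?_⟩, fun h => ⟨h2, ?_⟩⟩, fun h1 => ⟨h2, ?_⟩⟩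
    · exact iff_of_false (by norm_num) fun h' => h'.2 (by exact_mod_cast h1) h
    · rw [h2']; tauto
    · rw [h2']
      have : ¬ 1 < i := by exact_mod_cast h1
      tauto
  · intro σ₂ ⟨h2, h2'⟩ _ _ _
    refine ⟨h2, h2'.trans ?_⟩
    rw [Nat.prime_def_lt]
    constructor
    · refine fun h => ⟨hx2, fun m hm hmx => ?_⟩
      by_contra hne
      have : m ≠ 0 := by rintro rfl; rw [zero_dvd_iff] at hmx; omega
      exact h m hm (by omega) hmx
    · intro h d hd h1 hdx
      have := h.2 d hd hdx
      omega

/-- Bertrand's postulate guarantees a hit. Full trial division of all `n` candidates costs `O(n ^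
2)`, which is affordable. -/
theorem primeCode_spec {σ : St} {n : ℕ} (hn : σ.var .n = n) (hn1 : 1 ≤ n) (hW : 2 * n + 2 < W) :
    Triple W sz primeCode σ (n * n * 40 + n * 50 + 5) fun σ' =>
      ∃ p : ℕ, σ'.var .p = p ∧ p.Prime ∧ n < p ∧ p ≤ 2 * n := by
  refine (Triple.seq (t₁ := 2) (t₂ := n * (n * 40 + 50) + 3) (P := fun σ' => σ'.var .p = 0)
    (Triple.of_wp (by simp)) fun σ₁ h₁ hf₁ => ?_).mono
    (by rw [mul_add, ← mul_assoc]; omega) fun _ h _ => h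
  -- The value `0` means that no prime has been found so far; later primes simply overwrite earlier
  -- ones.
  refine Triple.forTo (tb := n * 40 + 45) (fun j σ' => ∃ p : ℕ, σ'.var .p = p ∧
    (p ≠ 0 → p.Prime ∧ n < p ∧ p ≤ n + j) ∧ (p = 0 → ∀ r, n < r → r ≤ n + j → ¬ r.Prime))
    ((hf₁.var .n rfl).trans hn) (by omega) rfl rfl (by decide) ?_ ?_ (le_of_eq (by ring)) ?_
  · exact ⟨0, by simp [h₁], by simp, fun _ r h h' => by omega⟩
  · rintro j hj σ₂ ⟨p, hp, hp1, hp2⟩ hj₂ hfv _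
    have hn₂ : σ₂.var .n = n := by rw [hfv .n rfl (by decide), hf₁.var .n rfl, hn]
    refine (Triple.seq (t₁ := 6) (t₂ := ((n + j + 1) * 20 + 5) + 8)
      (P := fun σ₃ => σ₃.var .x = (n + j + 1 : ℕ)) (Triple.of_wp (by simp [hn₂, hj₂]))
      fun σ₃ hx₃ hf₃ => ?_).mono (by omega) fun _ h _ => h
    refine Triple.seq (trialDivisionCode_spec hx₃ (by omega) (by omega)) fun σ₄ ⟨h₄, h₄'⟩ hf₄ => ?_
    have hp₄ : σ₄.var .p = p := by rw [hf₄.var .p rfl, hf₃.var .p rfl, hp]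
    have hx₄ : σ₄.var .x = (n + j + 1 : ℕ) := by rw [hf₄.var .x rfl, hx₃]
    refine Triple.of_wp ?_ (by decide)
    simp only [wp_ite, wp_skip, wp_assign, Expr.val_var, Expr.ok_var, Test.ok_eq,
      Test.holds_eq, Expr.val_one, Expr.ok_one, St.set_var, reduceCtorEq, if_true, if_false,
      true_and, hx₄, hp₄, h₄']
    refine ⟨⟨by omega, by omega⟩, fun h => ⟨_, rfl, fun _ => ⟨h, by omega, by omega⟩, by simp⟩,
      fun h => ⟨p, rfl, fun h' => ?_, fun h' r hr hr' => ?_⟩⟩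
    · obtain ⟨h5, h6, h7⟩ := hp1 h'
      exact ⟨h5, h6, by omega⟩
    · rcases eq_or_ne r (n + j + 1) with rfl | hne
      · exact h
      · exact hp2 h' r hr (by omega)
  · rintro σ₂ ⟨p, hp, hp1, hp2⟩ _ _ _
    obtain ⟨r, hr, hr1, hr2⟩ := Nat.exists_prime_lt_and_le_two_mul n (by omega)
    have hp0 : p ≠ 0 := fun h => hp2 h r hr1 (by omega) hr
    obtain ⟨h1, h2, h3⟩ := hp1 hp0
    exact ⟨p, hp, h1, h2, by omega⟩

theorem lengthCode_spec {σ : St} {n : ℕ} (hn : σ.var .n = n) (hn1 : 1 ≤ n) (hW : 4 * n < W) :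
    Triple W sz lengthCode σ (n * 25 + 10) fun σ' =>
      ∃ k : ℕ, 2 ≤ k ∧ σ'.var .lg = k ∧ σ'.var .len = (2 ^ k : ℕ) ∧ 2 * n ≤ 2 ^ k ∧
        2 ^ k ≤ 4 * n := by
  refine (Triple.seq (t₁ := 4) (t₂ := n * 25 + 3) (P := fun σ' => σ'.var .len = 4 ∧ σ'.var .lg = 2)
    (Triple.of_wp (by simp)) fun σ₁ ⟨h₁, h₁'⟩ hf₁ => ?_).mono (by omega) fun _ h _ => h
  -- Either the target is reached or every iteration so far has doubled the length; since `2 * n ≤ 2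
  -- ^ (n + 2)`, `n` iterations are enough.
  refine Triple.forTo (tb := 20) (fun i σ' => ∃ k : ℕ, 2 ≤ k ∧ σ'.var .lg = k ∧
      σ'.var .len = (2 ^ k : ℕ) ∧ (2 * n ≤ 2 ^ k ∨ i + 2 ≤ k) ∧ 2 ^ k ≤ 4 * n)
    ((hf₁.var .n rfl).trans hn) (by omega) rfl rfl (by decide) ?_ ?_ (by omega) ?_
  · exact ⟨2, le_rfl, by simp [h₁'], by simp [h₁], by simp, by norm_num; omega⟩
  · rintro i hi σ₂ ⟨k, hk, hlg, hlen, hor, hle⟩ hi₂ hfv _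
    have hn₂ : σ₂.var .n = n := by rw [hfv .n rfl (by decide), hf₁.var .n rfl, hn]
    refine Triple.of_wp ?_ (by decide)
    simp only [wp_ite, wp_seq, wp_skip, wp_assign, Expr.val_var, Expr.ok_var, Test.ok_lt,
      Test.holds_lt, Expr.val_one, Expr.ok_one, Expr.val_two, Expr.ok_two, Expr.ok_mul,
      Expr.val_mul, Expr.ok_add, Expr.val_add, St.set_var, reduceCtorEq, if_true, if_false,
      true_and, hlg, hlen, hn₂]
    refine ⟨⟨⟨by positivity, by omega⟩, by omega, by omega⟩, fun h => ⟨k + 1, by omega, by simp,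
      by push_cast; ring, ?_, ?_⟩, fun h => ⟨k, hk, rfl, rfl, ?_, hle⟩⟩
    · right
      rcases hor with h' | h'
      · omega
      · omega
    · rw [pow_succ]; omega
    · left; omega
  · rintro σ₂ ⟨k, hk, hlg, hlen, hor, hle⟩ _ _ _
    refine ⟨k, hk, hlg, hlen, ?_, hle⟩
    rcases hor with h | h
    · exact h
    · have h1 : n < 2 ^ n := Nat.lt_two_pow_self
      have h2 : 2 ^ (n + 2) ≤ 2 ^ k := Nat.pow_le_pow_right (by norm_num) h
      rw [pow_add] at h2
      omega

end ArrayLang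

/-! ### Derived parameters and memory layout -/

namespace ArrayLang

open Stmt Finset FFT MMVerification

variable {W : ℕ} {sz : Arr → ℕ}

theorem paramCode_spec {σ : St} {n t g : ℕ} (hn : σ.var .n = n) (ht : σ.var .t = t) (hn1 : 1 ≤ n)
    (hg : 1 ≤ g) (hW : (4 * n) ^ (6 * g + 40) ≤ W) :
    Triple W sz (paramCode g) σ ((n * n * 40 + n * 50 + 5) + ((n * 25 + 10) +
      ((derivedCode g).time + 50))) fun σ' =>
      ∃ p k : ℕ, p.Prime ∧ n < p ∧ 2 ≤ k ∧ 2 * n ≤ 2 ^ k ∧ 2 ^ k ≤ 4 * n ∧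
        p ^ g ≤ (2 ^ k) ^ g ∧ Init σ' n t (p ^ g) g k ∧
        σ'.var .u = (3 * (n * n) : ℕ) ∧ σ'.var .v = (7 * (n * n) : ℕ) ∧
        σ'.var .l = (7 * (n * n) + n : ℕ) ∧ σ'.var .m = (7 * (n * n) + 2 * n : ℕ) ∧
        σ'.var .st = (7 * (n * n) + 2 * n + 2 ^ k : ℕ) ∧
        σ'.var .x = (7 * (n * n) + 2 * n + 2 * 2 ^ k : ℕ) ∧
        σ'.var .y = (7 * (n * n) + 2 * n + 3 * 2 ^ k : ℕ) ∧
        σ'.var .z = (7 * (n * n) + 2 * n + 4 * 2 ^ k : ℕ) ∧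
        σ'.var .a = (7 * (n * n) + 2 * n + 5 * 2 ^ k : ℕ) := by
  have h4 : 4 * n * (4 * n) ≤ W := by
    refine le_trans ?_ hW
    rw [← pow_two]
    exact Nat.pow_le_pow_right (by omega) (by omega)
  have hnn : n ≤ n * n := Nat.le_mul_self n
  have e4 : 4 * n * (4 * n) = 16 * (n * n) := by ring
  refine Triple.seq (primeCode_spec hn hn1 (by omega)) fun σ₁ ⟨p, hp, hp1, hp2, hp3⟩ hf₁ => ?_
  have hn₁ : σ₁.var .n = n := (hf₁.var .n rfl).trans hn
  refine Triple.seq (lengthCode_spec hn₁ hn1 (by omega))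
    fun σ₂ ⟨k, hk, hlg, hlen, hk1, hk2⟩ hf₂ => ?_
  have hn₂ : σ₂.var .n = n := (hf₂.var .n rfl).trans hn₁
  have ht₂ : σ₂.var .t = t := by rw [hf₂.var .t rfl, hf₁.var .t rfl, ht]
  have hp₂ : σ₂.var .p = p := (hf₂.var .p rfl).trans hp
  have hword : (2 ^ k) ^ (2 * g + 16) < W := by
    have h1 : 1 < 2 ^ k := Nat.one_lt_two_pow (by omega)
    calc (2 ^ k) ^ (2 * g + 16) < (2 ^ k) ^ (6 * g + 40) := Nat.pow_lt_pow_right h1 (by omega)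
      _ ≤ (4 * n) ^ (6 * g + 40) := Nat.pow_le_pow_left hk2 _
      _ ≤ W := hW
  have hlenW : ((2 ^ k : ℕ) : ℤ) < W := by
    have : 2 ^ k < W := by
      refine lt_of_le_of_lt ?_ hword
      exact Nat.le_self_pow (by omega) _
    exact_mod_cast this
  have hW2 : (2 : ℤ) < W := by
    have : 2 ^ 1 ≤ 2 ^ k := Nat.pow_le_pow_right (by norm_num) (by omega)
    omega
  have hhalf : ((2 ^ k : ℕ) : ℤ) / 2 = (2 ^ (k - 1) : ℕ) := by
    have : 2 ^ k = 2 * 2 ^ (k - 1) := by rw [← pow_succ']; congr 1; omega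
    rw [this]; push_cast
    exact Int.mul_ediv_cancel_left _ two_ne_zero
  refine Triple.seq (P := fun σ₃ => Init σ₃ n t (p ^ g) g k) (Triple.of_wp ?_ le_rfl)
    fun σ₃ h₃ hf₃ => ?_
  · simp only [derivedCode, wp_seq, wp_assign, Expr.ok_var, Expr.ok_mul, Expr.ok_div, Expr.ok_add,
      Expr.pow_ok, Expr.pow_val, Expr.val_var, Expr.val_mul, Expr.val_add, Expr.val_div,
      Expr.val_two, Expr.ok_two, Expr.val_four, Expr.ok_four, Expr.val_one, Expr.ok_one, St.set_var,
      reduceCtorEq, if_true, if_false, true_and, hn₂, hlg, hlen, hp₂, hhalf]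
    refine ⟨⟨⟨by positivity, hlenW⟩, by norm_num, hW2⟩,
      ⟨⟨⟨by positivity, by exact_mod_cast hword⟩, by norm_num, hW2⟩, trivial⟩,
      ⟨⟨trivial, trivial⟩, trivial⟩, ?_⟩
    constructor <;>
      simp [hn₂, ht₂, hlg, hlen, scaleOf, Expr.val]
  have h := h₃
  refine Triple.of_wp ?_ (by decide)
  simp only [addressCode, wp_seq, wp_assign, Expr.ok_var, Expr.ok_mul, Expr.ok_add, Expr.val_var,
    Expr.val_mul, Expr.val_add, Expr.val_three, Expr.ok_three, Expr.val_four, Expr.ok_four,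
    St.set_var, reduceCtorEq, if_true, if_false, true_and, h.nn, h.n, h.len]
  refine ⟨p, k, hp1, hp2, hk, hk1, hk2, Nat.pow_le_pow_left (by omega) _, h.of_eq ?_, ?_⟩
  · simp [globalVars]
  · refine ⟨?_, ?_, ?_, ?_, ?_, ?_, ?_, ?_, ?_⟩ <;> push_cast <;> ring

/-- The placement of the arrays for the computation of the parameters. -/
def inputLayout (w n : ℕ) (h : 3 * (n * n) ≤ 2 ^ w) : Layout w where
  base _ := 0
  size
    | .input => 3 * (n * n)
    | _ => 0
  le a := by cases a <;> simp [h]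
  disjoint a b i j hi hj _ := by cases a <;> cases b <;> simp at hi hj ⊢

/-- The placement of the arrays for the main computation. -/
def mainLayout (w n N : ℕ) (h : 7 * (n * n) + 2 * n + 6 * N ≤ 2 ^ w) : Layout w where
  base
    | .input => 0
    | .vec => 3 * (n * n)
    | .fact => 7 * (n * n)
    | .ker => 7 * (n * n) + n
    | .twRe => 7 * (n * n) + 2 * n
    | .twIm => 7 * (n * n) + 2 * n + N
    | .sigRe => 7 * (n * n) + 2 * n + 2 * N
    | .sigIm => 7 * (n * n) + 2 * n + 3 * N
    | .kerRe => 7 * (n * n) + 2 * n + 4 * N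
    | .kerIm => 7 * (n * n) + 2 * n + 5 * N
  size
    | .input => 3 * (n * n)
    | .vec => 4 * (n * n)
    | .fact | .ker => n
    | _ => N
  le a := by cases a <;> simp only <;> omega
  disjoint a b i j hi hj hij := by
    cases a <;> cases b <;> first | rfl | (exfalso; simp only at hi hj hij; omega)

/-- Loads the base registers of the arrays. -/
def baseCode : WordRAM.Program :=
  .seq (.instr (.move Arr.vec.reg Var.u.reg)) <| .seq (.instr (.move Arr.fact.reg Var.v.reg)) <|
  .seq (.instr (.move Arr.ker.reg Var.l.reg)) <| .seq (.instr (.move Arr.twRe.reg Var.m.reg)) <|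
  .seq (.instr (.move Arr.twIm.reg Var.st.reg)) <| .seq (.instr (.move Arr.sigRe.reg Var.x.reg)) <|
  .seq (.instr (.move Arr.sigIm.reg Var.y.reg)) <| .seq (.instr (.move Arr.kerRe.reg Var.z.reg)) <|
  .instr (.move Arr.kerIm.reg Var.a.reg)

theorem Arr.reg_inj {a b : Arr} : a.reg = b.reg ↔ a = b := by
  cases a <;> cases b <;> decide

theorem baseCode_spec {w : ℕ} (τ : WordRAM.State w) : ∃ τ', WordRAM.Exec baseCode τ τ' 9 ∧
    τ'.mem = τ.mem ∧ (∀ x : Var, τ'.reg x.reg = τ.reg x.reg) ∧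
    ∀ a : Arr, τ'.reg a.reg = match a with
      | .input => τ.reg Arr.input.reg
      | .vec => τ.reg Var.u.reg
      | .fact => τ.reg Var.v.reg
      | .ker => τ.reg Var.l.reg
      | .twRe => τ.reg Var.m.reg
      | .twIm => τ.reg Var.st.reg
      | .sigRe => τ.reg Var.x.reg
      | .sigIm => τ.reg Var.y.reg
      | .kerRe => τ.reg Var.z.reg
      | .kerIm => τ.reg Var.a.reg := by
  refine ⟨_, .seq (.instr _ _) (.seq (.instr _ _) (.seq (.instr _ _) (.seq (.instr _ _)
    (.seq (.instr _ _) (.seq (.instr _ _) (.seq (.instr _ _) (.seq (.instr _ _)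
      (.instr _ _)))))))), rfl, fun x => ?_, fun a => ?_⟩
  · simp [WordRAM.Instr.apply, (Arr.reg_ne_var _ _).symm]
  · cases a <;> simp [WordRAM.Instr.apply, Arr.reg_inj,
      (Arr.reg_ne_var _ _).symm]

end ArrayLang

/-! ### The complete RAM program and its running time -/

namespace ArrayLang

open Stmt Finset FFT MMVerification WordRAM

/-- The verification program, for the modulus `p ^ g`. -/
def program (g : ℕ) : Program :=
  .seq (.seq (.instr (.move Var.t.reg 1)) (.instr (.const 1 0))) <|
  .seq (paramCode g).compile <| .seq baseCode <| .seq mainCode.compile <|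
  .instr (.move 0 Var.res.reg)

/-- The number of steps needed for the computation of the parameters. -/
def paramTime (n g : ℕ) : ℕ :=
  (n * n * 40 + n * 50 + 5) + ((n * 25 + 10) + ((derivedCode g).time + 50))

/-- The number of steps of the main computation. -/
def mainTime (n t g k : ℕ) : ℕ :=
  (n * n * 80 + 3) + ((100 * g + 2000) * (2 ^ k * k) +
    ((4 * n * (200 * (2 ^ k * k) + 5) + 3) +
      (t * (Nat.log 2 n + 2) * (n * 60 + 20) + n * 30 + 5)))

/-- The transform length is at most `4 * n` and its exponent at most `Nat.log 2 n + 2`, so the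
dominant terms are `n * (2 ^ k * k)` for the transforms and `t * n * (Nat.log 2 n + 2)` for the
inner products. -/
theorem time_le {n t g k : ℕ} (hn : 1 ≤ n) (hk : 2 ^ k ≤ 4 * n) :
    2 + (paramTime n g + (9 + (mainTime n t g k + 1))) ≤
      ((derivedCode g).time + 400 * g + 20000) * ((n * n + t * n) * (Nat.log 2 n + 2)) := by
  have hk' : k ≤ Nat.log 2 n + 2 := by
    have h1 : n < 2 ^ (Nat.log 2 n + 1) := Nat.lt_pow_succ_log_self (by norm_num) n
    have h2 : 2 ^ k < 2 ^ (Nat.log 2 n + 1 + 2) := by rw [pow_add _ _ 2]; omega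
    have := (Nat.pow_lt_pow_iff_right (by norm_num : 1 < 2)).1 h2
    omega
  obtain ⟨L, hL⟩ : ∃ L, L = Nat.log 2 n + 2 := ⟨_, rfl⟩
  obtain ⟨D, hD⟩ : ∃ D, D = (derivedCode g).time := ⟨_, rfl⟩
  rw [paramTime, mainTime, ← hD, ← hL]
  rw [← hL] at hk'
  have hL1 : 1 ≤ L := by omega
  have a1 : 2 ^ k * k ≤ 4 * (n * L) := by
    rw [← mul_assoc]; exact Nat.mul_le_mul hk hk'
  obtain ⟨X, hX⟩ : ∃ X, X = 2 ^ k * k := ⟨_, rfl⟩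
  rw [← hX] at a1 ⊢
  have a2 : n * X ≤ 4 * (n * n * L) := by
    have := Nat.mul_le_mul_left n a1
    calc n * X ≤ n * (4 * (n * L)) := this
      _ = _ := by ring
  have a3 : n * L ≤ n * n * L := Nat.mul_le_mul_right _ (Nat.le_mul_self n)
  have a4 : n * n ≤ n * n * L := Nat.le_mul_of_pos_right _ hL1
  have a5 : n ≤ n * n := Nat.le_mul_self n
  have a6 : D ≤ D * (n * n * L) := Nat.le_mul_of_pos_right _ (by positivity)
  have a7 : g * X ≤ 4 * (g * (n * n * L)) := by
    calc g * X ≤ g * (4 * (n * n * L)) := Nat.mul_le_mul_left _ (by omega)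
      _ = _ := by ring
  have a8 : t * L ≤ t * n * L := by
    have := Nat.mul_le_mul_left (t * L) hn
    calc t * L = t * L * 1 := by ring
      _ ≤ t * L * n := this
      _ = _ := by ring
  have e1 : 2 + (n * n * 40 + n * 50 + 5 + (n * 25 + 10 + (D + 50)) + (9 +
      (n * n * 80 + 3 + ((100 * g + 2000) * X + (4 * n * (200 * X + 5) + 3 +
      (t * L * (n * 60 + 20) + n * 30 + 5))) + 1))) =
      120 * (n * n) + 125 * n + 88 + D + 100 * (g * X) + 2000 * X + 800 * (n * X) +
      60 * (t * n * L) + 20 * (t * L) := by ring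
  have e2 : (D + 400 * g + 20000) * ((n * n + t * n) * L) =
      D * (n * n * L) + 400 * (g * (n * n * L)) + 20000 * (n * n * L) + D * (t * n * L) +
      400 * (g * (t * n * L)) + 20000 * (t * n * L) := by ring
  rw [e1, e2]
  have := Nat.zero_le (D * (t * n * L))
  have := Nat.zero_le (g * (t * n * L))
  omega

theorem abs_rowMajor_le {n c : ℕ} {M : Matrix (Fin n) (Fin n) ℤ} (h : EntriesBounded c M) (x : ℕ) :
    |rowMajor M x| ≤ (n : ℤ) ^ c := by
  rw [rowMajor]
  split_ifs
  · exact h _ _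
  · rw [abs_zero]; positivity

/-- The contents of the input cells. -/
def inputCell {n : ℕ} (A B C : Matrix (Fin n) (Fin n) ℤ) (x : ℕ) : ℤ :=
  if x < n * n then rowMajor A x else if x < 2 * (n * n) then rowMajor B (x - n * n)
  else rowMajor C (x - 2 * (n * n))

/-- The program runs under two layouts. Array positions depend on `n` and on the transform length,
so a first phase, which uses no arrays, computes the parameters; then the base registers are set and
the main phase starts on the same memory. -/
theorem program_spec {c g n t w : ℕ} (hg : 2 * c + 2 ≤ g) (ht1 : 1 ≤ t) (ht : t ≤ n ^ 2)
    (hW : (4 * n) ^ (6 * g + 40) ≤ 2 ^ w) (A B C : Matrix (Fin n) (Fin n) ℤ)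
    (hA : EntriesBounded c A) (hB : EntriesBounded c B) (hC : EntriesBounded c C) :
    ∃ (τ : State w) (steps : ℕ) (isEq : Bool), Exec (program g) (input w t A B C) τ steps ∧
      τ.reg 0 = (if isEq then 1 else 0) ∧ (errorCount A B C ≤ t → (isEq = true ↔ C = A * B)) ∧
      steps ≤ ((derivedCode g).time + 400 * g + 20000) *
        ((n * n + t * n) * (Nat.log 2 n + 2)) := by
  have hn : 1 ≤ n := by
    rcases Nat.eq_zero_or_pos n with rfl | h
    · simp at ht; omega
    · exact h
  have hnn : n ≤ n * n := Nat.le_mul_self n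
  have hmem : 256 * (n * n) ≤ 2 ^ w := by
    have h1 : (4 * n) ^ 4 ≤ (4 * n) ^ (6 * g + 40) := Nat.pow_le_pow_right (by omega) (by omega)
    have h2 : (4 * n) ^ 4 = 256 * (n * n) * (n * n) := by ring
    have h3 : 256 * (n * n) ≤ 256 * (n * n) * (n * n) := Nat.le_mul_of_pos_right _ (by positivity)
    omega
  let L₀ := inputLayout w n (by omega)
  let σ₀ : St := ⟨fun x => match x with
    | .n => n
    | .t => t
    | _ => 0, fun _ x => inputCell A B C x.toNat⟩
  -- Register `1` holds `t` on input but is the base register of `input`: its content is moved to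
  -- the register of `t` and then replaced by the base `0`.
  obtain ⟨τ₀, hx₀, hR₀⟩ : ∃ τ₀, Exec (.seq (.instr (.move Var.t.reg 1)) (.instr (.const 1 0)))
      (input w t A B C) τ₀ 2 ∧ Repr L₀ σ₀ τ₀ := by
    refine ⟨_, .seq (.instr _ _) (.instr _ _), ⟨fun x => ?_, fun a => ?_, fun a i hi => ?_⟩⟩
    · cases x <;> simp [Instr.apply, Var.reg, input, σ₀, Var.ctorIdx]
    · cases a <;> simp [Instr.apply, Var.reg, Arr.reg, input, L₀, inputLayout,
        Var.ctorIdx, Arr.ctorIdx]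
    · have hi' : i < 3 * (n * n) := by
        cases a <;> simp [L₀, inputLayout] at hi
        exact hi
      simp only [Instr.apply, input, L₀, inputLayout, σ₀, zero_add, Int.toNat_natCast, inputCell,
        BitVec.toNat_ofNat]
      rw [Nat.mod_eq_of_lt (by omega)]
  obtain ⟨σ₁, k₁, hr₁, hk₁, p, k, hp, hnp, hk, hk2, hk4, hpk, hinit, ad⟩ :=
    paramCode_spec (W := 2 ^ w) (sz := L₀.size) (σ := σ₀) (n := n) (t := t) (g := g) rfl rfl hn
      (by omega) hW
  obtain ⟨τ₁, hx₁, hR₁⟩ := hr₁.compile hR₀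
  obtain ⟨τ₂, hx₂, hm₂, hv₂, hb₂⟩ := baseCode_spec τ₁
  have hpos : 1 ≤ 2 ^ k := Nat.one_le_two_pow
  let L := mainLayout w n (2 ^ k) (by omega)
  -- The main phase starts from whatever the memory contains, read as signed integers; only the
  -- input array has to have known contents.
  let σ₂ : St := ⟨σ₁.var, fun a i => (τ₂.mem (BitVec.ofNat w (L.base a + i.toNat))).toInt⟩
  have hR₂ : Repr L σ₂ τ₂ := by
    refine ⟨fun x => by rw [hv₂, hR₁.var], fun a => ?_, fun a i hi => ?_⟩
    · obtain ⟨ad1, ad2, ad3, ad4, ad5, ad6, ad7, ad8, ad9⟩ := ad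
      rw [hb₂]
      cases a <;> simp only [hR₁.var, ad1, ad2, ad3, ad4, ad5, ad6, ad7, ad8, ad9,
        BitVec.ofInt_natCast] <;> first | rfl | exact hR₁.base .input
    · simp only [σ₂, Int.toNat_natCast, BitVec.ofInt_toInt]
  have hq : n < p ^ g := hnp.trans_le (Nat.le_self_pow (by omega) _)
  have hncq : n ^ c ≤ p ^ g := (Nat.pow_le_pow_left hnp.le c).trans
    (Nat.pow_le_pow_right hp.pos (by omega))
  have hd : Dims (2 ^ w) L.size n (p ^ g) g k := by
    refine ⟨hk, hn, hk2, hq, hpk, (Nat.pow_le_pow_left hk4 _).trans hW, ?_, ?_, ?_, ?_, ?_, ?_, ?_,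
      ?_, ?_, ?_⟩ <;> rfl
  -- Entries of absolute value at most `n ^ c` are recovered exactly from two's complement.
  have hW2 : 2 * n ^ c < 2 ^ w := by
    have h1 : 2 * n ^ c < 4 * n * n ^ c := by
      have : 0 < n ^ c := by positivity
      nlinarith
    refine h1.trans_le (le_trans ?_ hW)
    calc 4 * n * n ^ c ≤ 4 * n * (4 * n) ^ c :=
          Nat.mul_le_mul_left _ (Nat.pow_le_pow_left (by omega) _)
      _ = (4 * n) ^ (c + 1) := by ring
      _ ≤ (4 * n) ^ (6 * g + 40) := Nat.pow_le_pow_right (by omega) (by omega)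
  have hcell : ∀ x, |inputCell A B C x| ≤ (n : ℤ) ^ c := by
    intro x
    rw [inputCell]
    split_ifs
    · exact abs_rowMajor_le hA _
    · exact abs_rowMajor_le hB _
    · exact abs_rowMajor_le hC _
  have hinp : ∀ x : ℕ, x < 3 * (n * n) → σ₂.arr .input x = inputCell A B C x := by
    intro x hx
    have h1 := hR₁.mem .input x hx
    have h2 : σ₁.arr .input = σ₀.arr .input := hr₁.frame.arr .input rfl
    have h3 : τ₂.mem (BitVec.ofNat w (0 + x)) = BitVec.ofInt w (inputCell A B C x) := by
      rw [hm₂]; rw [h2] at h1; exact h1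
    change (τ₂.mem (BitVec.ofNat w (0 + x))).toInt = _
    rw [h3, BitVec.toInt_ofInt]
    have h4 := abs_le.1 (hcell x)
    have h5 : 2 * (n : ℤ) ^ c < (2 ^ w : ℕ) := by exact_mod_cast hW2
    exact Int.bmod_eq_of_le (by omega) (by omega)
  have hinit₂ : Init σ₂ n t (p ^ g) g k := hinit.of_eq fun _ _ => rfl
  obtain ⟨σ₃, k₃, hr₃, hk₃, hres, hiff⟩ := mainCode_spec hd hinit₂ ht A B C
    (fun x hx => by
      rw [hinp x hx]
      exact (hcell x).trans (by exact_mod_cast hncq))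
    (fun x hx => by rw [hinp x (by omega), inputCell, if_pos hx])
    (fun x hx => by
      rw [hinp _ (by omega), inputCell, if_neg (by omega), if_pos (by omega),
        Nat.add_sub_cancel_left])
    (fun x hx => by
      rw [hinp _ (by omega), inputCell, if_neg (by omega), if_neg (by omega),
        Nat.add_sub_cancel_left])
  obtain ⟨τ₃, hx₃, hR₃⟩ := hr₃.compile hR₂
  refine ⟨_, _, decide (σ₃.var .res = 1), .seq hx₀ (.seq hx₁ (.seq hx₂ (.seq hx₃ (.instr _ _)))),
    ?_, fun herr => ?_, ?_⟩
  · simp only [Instr.apply, Function.update_self, hR₃.var]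
    rcases hres with h | h <;> simp [h]
  · rw [decide_eq_true_iff, hiff]
    exact ⟨eq_mul_of_checkValue hp hnp hg hA hB hC herr,
      fun h s hs u hu _ => checkValue_eq_zero _ hs.le hu.le h⟩
  · refine le_trans ?_ (time_le hn hk4)
    have : k₁ ≤ paramTime n g := hk₁
    have : k₃ ≤ mainTime n t g k := hk₃
    omega

end ArrayLang

theorem theorem2 (c : ℕ) :
    ∃ (P : WordRAM.Program) (κ : ℕ) (K : ℝ) (ε : ℕ → ℝ),
      Tendsto ε atTop (𝓝 0) ∧
      ∀ (n t w : ℕ), 1 ≤ t → t ≤ n ^ 2 → κ * (Nat.log 2 n + 1) ≤ w →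
        ∀ (A B C : Matrix (Fin n) (Fin n) ℤ),
          MMVerification.EntriesBounded c A → MMVerification.EntriesBounded c B →
          MMVerification.EntriesBounded c C →
          ∃ (σ : WordRAM.State w) (steps : ℕ) (isEq : Bool),
            WordRAM.Exec P (MMVerification.input w t A B C) σ steps ∧
            σ.reg 0 = (if isEq then 1 else 0) ∧
            (MMVerification.errorCount A B C ≤ t → (isEq = true ↔ C = A * B)) ∧
            (2 ≤ n → (steps : ℝ) ≤
              K * ((n : ℝ) ^ 2 + (t : ℝ) * (n : ℝ)) * Real.log (n : ℝ) ^ (2 + ε n)) := by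
  obtain ⟨g, hg⟩ : ∃ g, g = 2 * c + 2 := ⟨_, rfl⟩
  obtain ⟨M, hM⟩ : ∃ M, M = (ArrayLang.derivedCode g).time + 400 * g + 20000 := ⟨_, rfl⟩
  -- The factor 3 comes from `4 * n ≤ 2 ^ (3 * (Nat.log 2 n + 1))`, the 12 from trading one
  -- logarithm for two below.
  refine ⟨ArrayLang.program g, 3 * (6 * g + 40), M * 12, fun _ => 0, tendsto_const_nhds, ?_⟩
  intro n t w ht1 ht hw A B C hA hB hC
  have hW : (4 * n) ^ (6 * g + 40) ≤ 2 ^ w := by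
    have h1 : n < 2 ^ (Nat.log 2 n + 1) := Nat.lt_pow_succ_log_self (by norm_num) n
    have h2 : 4 * n ≤ 2 ^ (3 * (Nat.log 2 n + 1)) := by
      calc 4 * n ≤ 2 ^ 2 * 2 ^ (Nat.log 2 n + 1) := by omega
        _ = 2 ^ (2 + (Nat.log 2 n + 1)) := by rw [← pow_add]
        _ ≤ 2 ^ (3 * (Nat.log 2 n + 1)) := Nat.pow_le_pow_right (by norm_num) (by omega)
    calc (4 * n) ^ (6 * g + 40) ≤ (2 ^ (3 * (Nat.log 2 n + 1))) ^ (6 * g + 40) :=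
          Nat.pow_le_pow_left h2 _
      _ = 2 ^ (3 * (6 * g + 40) * (Nat.log 2 n + 1)) := by rw [← pow_mul]; congr 1; ring
      _ ≤ 2 ^ w := Nat.pow_le_pow_right (by norm_num) hw
  obtain ⟨τ, steps, isEq, hx, h0, hiff, hs⟩ := ArrayLang.program_spec hg.ge ht1 ht hW A B C hA hB hC
  refine ⟨τ, steps, isEq, hx, h0, hiff, fun hn => ?_⟩
  rw [← hM] at hs
  have hn' : (2 : ℝ) ≤ n := by exact_mod_cast hn
  have hl2 := Real.log_two_gt_d9
  have hlog : Real.log 2 ≤ Real.log n := Real.log_le_log (by norm_num) hn'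
  have hnat : (Nat.log 2 n : ℝ) * Real.log 2 ≤ Real.log n := by
    rw [← Real.log_pow]
    refine Real.log_le_log (by positivity) ?_
    exact_mod_cast Nat.pow_log_le_self 2 (by omega)
  -- The running time has a single logarithm; for `n ≥ 2` the natural logarithm is bounded away from
  -- 0, so its square dominates both terms.
  have hL : (Nat.log 2 n : ℝ) + 2 ≤ 12 * Real.log n ^ 2 := by
    have h1 : (0 : ℝ) ≤ Nat.log 2 n := by positivity
    have h2 : (Nat.log 2 n : ℝ) * (1 / 2) ≤ Real.log n :=
      (mul_le_mul_of_nonneg_left (by linarith) h1).trans hnat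
    nlinarith
  have hs' : (steps : ℝ) ≤ M * ((n * n + t * n) * (Nat.log 2 n + 2)) := by exact_mod_cast hs
  have hpow : Real.log (n : ℝ) ^ ((2 : ℝ) + 0) = Real.log n ^ 2 := by
    rw [add_zero]; exact Real.rpow_two _
  rw [hpow]
  calc (steps : ℝ) ≤ M * ((n * n + t * n) * (Nat.log 2 n + 2)) := hs'
    _ ≤ M * ((n * n + t * n) * (12 * Real.log n ^ 2)) := by gcongr
    _ = _ := by ring
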